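/- **Setting.** Let $s_1,\dots,s_d\in\mathbb R^2$ be distinct locations, partitioned into $\mathcal D_1,\dots,\mathcal D_K$ ($d,K$ fixed), with thresholds $u_j=u(s_j)$. The parameter is $\theta=(\omega,\zeta,\beta_1,\beta_2,\beta_3)\in\Theta\subset\mathbb R^p$, with $\Theta$ compact. Put $\alpha=2e^{\omega}/(1+e^{\omega})$, $\phi=e^{\zeta}$ and, for covariates $z=(z_1,z_2,z_3)$, $\mu_j=z_1(s_j)^\top\beta_1$, $\sigma_j=\exp(z_2(s_j)^\top\beta_2)$, $\xi_j=z_3(s_j)^\top\beta_3$. Let $x_j(y)=\{1+\xi_j(y-\mu_j)/\sigma_j\}^{1/\xi_j}$ (read as $e^{(y-\mu_j)/\sigma_j}$ if $\xi_j=0$), $J_j=dx_j/dy$, and let $$V(x_1,x_2)=\tfrac1{x_1}\Phi\{\tfrac a2-\tfrac1a\log\tfrac{x_1}{x_2}\}+\tfrac1{x_2}\Phi\{\tfrac a2-\tfrac1a\log\tfrac{x_2}{x_1}\},\qquad a=a_{jj'}=\{2(\|s_j-s_{j'}\|/\phi)^{\alpha}\}^{1/2},$$ be the Brown–Resnick exponent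 measure of the pair $j,j'$. The observations $(z_i,Y_i)$, $i=1,\dots,n$, are i.i.d. copies of a covariate array $z$ and a vector $Y=(Y(s_1),\dots,Y(s_d))$, with law $P_{\theta_0}$, where $(P_\theta)_{\theta\in\Theta}$ is a family of laws with a common law of $z$ such that, under each $P_\theta$: almost surely $1+\xi_j(u_j-\mu_j)/\sigma_j>0$ for all $j$; and given $z$, any two locations $j\ne j'$ of the same $\mathcal D_k$ satisfy $P(Y(s_j)\le y,\,Y(s_{j'})\le y'\mid z)=\exp\{-V(x_j(y),x_{j'}(y'))\}$ for all $y\ge u_j$, $y'\ge u_{j'}$ in the interiors of the supports of the generalized extreme value margins. (The Brown–Resnick max-stable model is a special case.) The censored likelihood $g$ of a pair $(y_j,y_{j'})$ is $\partial_{x_1}\partial_{x_2}e^{-V(x_1,x_2)}\,J_jJ_{j'}$ at $(x_j(y_j),x_{j'}(y_{j'}))$ if both values exceed their thresholds; if only one exceeds, the value of the other is replaced by its threshold and $e^{-V}$ is differentiated only in the exceeding coordinate, with only its Jacobian; it is $e^{-V(x_j(u_j),x_{j'}(u_{j'}))}$ if none exceeds. Let $\psi_{ik}(\theta)=\nabla_\theta\sum\log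 g\in\mathbb R^p$, the sum being over the unordered pairs of distinct locations in $\mathcal D_k$ for replicate $i$, let $\Psi_k=\frac1n\sum_i\psi_{ik}$, and let $\psi_{i,all}=(\psi_{ik})_{k\le K}$, $\Psi_{all}=(\Psi_k)_{k\le K}$ be the stacked vectors. Let $i_k(\theta)=E_\theta\{\nabla_\theta\Psi_k(\theta)\}$, $c(\theta)=\mathrm{Var}_\theta\{\sqrt n\,\Psi_{all}(\theta)\}$ and $C(\theta)=\frac1n\sum_i\psi_{i,all}(\theta)\psi_{i,all}(\theta)^\top$, and let $\{A\}_{k,k'}$ be the $p\times p$ blocks of a $Kp\times Kp$ matrix $A$. **Conditions.** (C1) (i) The support of $P_\theta$ does not depend on $\theta\in\Theta$. (ii) $\Psi_{all}$ is twice continuously differentiable in $\theta\in\Theta$ for every observation in the support. (iii) $E_{\theta_0}\{\Psi_{all}(\theta)\}$ exists for $\theta\in\Theta$ and is zero only at $\theta_0$, an interior point of $\Theta$. (iv) $c(\theta)$ is finite and positive definite for all $\theta\in\Theta$. (v) Each $i_k(\theta)$ exists and has a uniformly bounded first derivative on a neighbourhood of $\theta_0$. (C2) For every $\delta_n\to\infty$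 and every $k$, $$\sup_{\theta\in\Theta,\ \|\theta-\theta_0\|\le\delta_n}\frac{n^{1/2}}{1+n^{1/2}\|\theta-\theta_0\|}\,\|\Psi_k(\theta)-\Psi_k(\theta_0)-E_{\theta_0}\Psi_k(\theta)\|=O_p(n^{-1/2}).$$ **Theorem.** Assume (C1), (C2) and that $h(\theta_0)$ is invertible, where $$h(\theta)=\sum_{k}i_k^\top(\theta)\{c^{-1}(\theta)\}_{k,k}i_k(\theta),\qquad g(\theta)=\sum_{k,k'}i_k^\top(\theta)\{c^{-1}(\theta)\}_{k,k}\{c(\theta)\}_{k,k'}\{c^{-1}(\theta)\}_{k',k'}i_{k'}(\theta).$$ Let $\hat\theta^\star_{GMM}$ be measurable and, with probability tending to one, a minimizer of $n\sum_k\Psi_k^\top(\theta)W_k(\theta)\Psi_k(\theta)$, $W_k(\theta)=\{C^{-1}(\theta)\}_{k,k}$, over the $\theta\in\Theta$ at which $C(\theta)$ is invertible. Then $g(\theta_0)$ is positive semidefinite and, as $n\to\infty$, $$\sqrt n\,(\hat\theta^\star_{GMM}-\theta_0)\ \xrightarrow{d}\ \mathcal N\big[0,\ h(\theta_0)^{-1}g(\theta_0)\{h^\top(\theta_0)\}^{-1}\big].$$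 -/

import Mathlib

open MeasureTheory ProbabilityTheory Filter Topology
open scoped ENNReal Matrix

noncomputable section

namespace CensoredBR

/-! ## Parameter, covariates, observations -/

/-- Index set of the parameter `θ = (ω, ζ, β₁, β₂, β₃)`, of size `p = 2 + q₁ + q₂ + q₃`. -/
abbrev ParamIdx (q₁ q₂ q₃ : ℕ) : Type := Fin 2 ⊕ Fin q₁ ⊕ Fin q₂ ⊕ Fin q₃

/-- `ℝ^p` with its Euclidean norm. -/
abbrev Param (q₁ q₂ q₃ : ℕ) : Type := EuclideanSpace ℝ (ParamIdx q₁ q₂ q₃)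

/-- The covariates of one replicate: for each of the `d` locations the three vectors
`z₁(s_j)`, `z₂(s_j)`, `z₃(s_j)` that enter the location, the scale and the shape. -/
abbrev Covariates (d q₁ q₂ q₃ : ℕ) : Type :=
  (Fin d → Fin q₁ → ℝ) × (Fin d → Fin q₂ → ℝ) × (Fin d → Fin q₃ → ℝ)

/-- One replicate: its covariates and the extreme values `y(s_1), …, y(s_d)`. -/
abbrev Obs (d q₁ q₂ q₃ : ℕ) : Type := Covariates d q₁ q₂ q₃ × (Fin d → ℝ)

/-- `d` distinct locations in the plane, their partition into the subsets
`D_1, …, D_K` (location `j` lies in `D_{block j}`), and the thresholds `u(s_j)`. -/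
structure Design (d K : ℕ) where
  site : Fin d → EuclideanSpace ℝ (Fin 2)
  site_injective : Function.Injective site
  block : Fin d → Fin K
  block_surjective : Function.Surjective block
  threshold : Fin d → ℝ

variable {d K q₁ q₂ q₃ : ℕ}

/-! ## Marginal and dependence parameters -/

/-- Smoothness `α = 2 exp(ω) / (1 + exp(ω))`. -/
def smoothness (θ : Param q₁ q₂ q₃) : ℝ :=
  2 * Real.exp (θ (Sum.inl 0)) / (1 + Real.exp (θ (Sum.inl 0)))

/-- Range `φ = exp(ζ)`. -/
def rangePar (θ : Param q₁ q₂ q₃) : ℝ := Real.exp (θ (Sum.inl 1))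

/-- Location `μ(s_j) = z₁(s_j)ᵀ β₁`. -/
def loc (z : Covariates d q₁ q₂ q₃) (θ : Param q₁ q₂ q₃) (j : Fin d) : ℝ :=
  ∑ t, z.1 j t * θ (Sum.inr (Sum.inl t))

/-- Scale `σ(s_j) = exp(z₂(s_j)ᵀ β₂)`. -/
def scale (z : Covariates d q₁ q₂ q₃) (θ : Param q₁ q₂ q₃) (j : Fin d) : ℝ :=
  Real.exp (∑ t, z.2.1 j t * θ (Sum.inr (Sum.inr (Sum.inl t))))

/-- Shape `ξ(s_j) = z₃(s_j)ᵀ β₃`. -/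
def shape (z : Covariates d q₁ q₂ q₃) (θ : Param q₁ q₂ q₃) (j : Fin d) : ℝ :=
  ∑ t, z.2.2 j t * θ (Sum.inr (Sum.inr (Sum.inr t)))

/-- `1 + ξ (y - μ) / σ`; it is positive exactly when `y` is in the interior of the support of
`GEV(μ, σ, ξ)`. -/
def gevArg (z : Covariates d q₁ q₂ q₃) (θ : Param q₁ q₂ q₃) (j : Fin d) (y : ℝ) : ℝ :=
  1 + shape z θ j * (y - loc z θ j) / scale z θ j

/-- The transformation of a GEV variable `y` at location `j` to the unit Fréchet scale,
`x = {1 + ξ (y - μ) / σ}^{1/ξ}`, read as its limit `exp((y - μ) / σ)` for `ξ = 0`. -/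
def toFrechet (z : Covariates d q₁ q₂ q₃) (θ : Param q₁ q₂ q₃) (j : Fin d) (y : ℝ) : ℝ :=
  if shape z θ j = 0 then Real.exp ((y - loc z θ j) / scale z θ j)
  else gevArg z θ j y ^ (1 / shape z θ j)

/-- The Jacobian `J(y; β) = dx/dy`. -/
def jacobian (z : Covariates d q₁ q₂ q₃) (θ : Param q₁ q₂ q₃) (j : Fin d) (y : ℝ) : ℝ :=
  deriv (toFrechet z θ j) y

/-- The isotropic semivariogram `γ(h) = (‖h‖ / φ)^α` of the Brown-Resnick process. -/
def semivariogram (θ : Param q₁ q₂ q₃) (h : EuclideanSpace ℝ (Fin 2)) : ℝ :=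
  (‖h‖ / rangePar θ) ^ smoothness θ

/-- `a_{ij} = {2 γ(s_i - s_j)}^{1/2}`. -/
def pairDep (D : Design d K) (θ : Param q₁ q₂ q₃) (j j' : Fin d) : ℝ :=
  Real.sqrt (2 * semivariogram θ (D.site j - D.site j'))

/-- The standard normal distribution function `Φ`. -/
def stdNormalCdf (x : ℝ) : ℝ := cdf (gaussianReal 0 1) x

/-- The bivariate Brown-Resnick exponent measure `V(x₁, x₂)` with dependence constant `a`. -/
def expMeasure (a x₁ x₂ : ℝ) : ℝ :=
  1 / x₁ * stdNormalCdf (a / 2 - 1 / a * Real.log (x₁ / x₂)) +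
    1 / x₂ * stdNormalCdf (a / 2 - 1 / a * Real.log (x₂ / x₁))

/-- The bivariate distribution function `exp{-V(x₁, x₂)}` on the unit Fréchet scale. -/
def pairCdf (a x₁ x₂ : ℝ) : ℝ := Real.exp (-expMeasure a x₁ x₂)

/-! ## Censored pairwise likelihood and its score -/

/-- The censored likelihood contribution `g(y_j, y_{j'}; θ, u)` of the pair of locations
`j, j'`. -/
def pairLik (D : Design d K) (o : Obs d q₁ q₂ q₃) (θ : Param q₁ q₂ q₃) (j j' : Fin d) : ℝ :=
  let a := pairDep D θ j j'
  let x₁ := toFrechet o.1 θ j (o.2 j)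
  let x₂ := toFrechet o.1 θ j' (o.2 j')
  let v₁ := toFrechet o.1 θ j (D.threshold j)
  let v₂ := toFrechet o.1 θ j' (D.threshold j')
  let J₁ := jacobian o.1 θ j (o.2 j)
  let J₂ := jacobian o.1 θ j' (o.2 j')
  if D.threshold j < o.2 j then
    if D.threshold j' < o.2 j' then
      deriv (fun r₁ => deriv (fun r₂ => pairCdf a r₁ r₂) x₂) x₁ * J₁ * J₂
    else deriv (fun r₁ => pairCdf a r₁ v₂) x₁ * J₁
  else
    if D.threshold j' < o.2 j' then deriv (fun r₂ => pairCdf a v₁ r₂) x₂ * J₂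
    else pairCdf a v₁ v₂

/-- The set `P_k` of (unordered) pairs of distinct locations in `D_k`. -/
def pairs (D : Design d K) (k : Fin K) : Finset (Fin d × Fin d) :=
  Finset.univ.filter fun e => e.1 < e.2 ∧ D.block e.1 = k ∧ D.block e.2 = k

/-- The log censored composite likelihood of one replicate in `D_k`. -/
def logCCL (D : Design d K) (k : Fin K) (o : Obs d q₁ q₂ q₃) (θ : Param q₁ q₂ q₃) : ℝ :=
  ∑ e ∈ pairs D k, Real.log (pairLik D o θ e.1 e.2)

/-- The censored composite score kernel `ψ_k(θ)` of one replicate. -/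
def score (D : Design d K) (k : Fin K) (o : Obs d q₁ q₂ q₃) (θ : Param q₁ q₂ q₃) :
    Param q₁ q₂ q₃ :=
  gradient (logCCL D k o) θ

/-- `∂ψ_{k,a} / ∂θ_b` for one replicate. -/
def scoreDeriv (D : Design d K) (k : Fin K) (o : Obs d q₁ q₂ q₃) (θ : Param q₁ q₂ q₃)
    (a b : ParamIdx q₁ q₂ q₃) : ℝ :=
  (fderiv ℝ (fun τ => score D k o τ) θ (EuclideanSpace.single b 1)) a

/-- The stacked kernel `ψ_all(θ) ∈ ℝ^{Kp}` of one replicate. -/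
def scoreAll (D : Design d K) (o : Obs d q₁ q₂ q₃) (θ : Param q₁ q₂ q₃) :
    Fin K × ParamIdx q₁ q₂ q₃ → ℝ :=
  fun e => score D e.1 o θ e.2

/-! ## The model -/

/-- The law `P_θ` of one replicate: covariates with law `ν` and, given the covariates `z`,
extreme values with law `κ θ z`. -/
def obsLaw (ν : Measure (Covariates d q₁ q₂ q₃))
    (κ : Param q₁ q₂ q₃ → Kernel (Covariates d q₁ q₂ q₃) (Fin d → ℝ)) (θ : Param q₁ q₂ q₃) :
    Measure (Obs d q₁ q₂ q₃) :=
  ν ⊗ₘ κ θ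

/-- The censored Brown-Resnick model with parameter space `Θ`. The thresholds lie inside the
supports of the generalized extreme value margins, and above the thresholds every two values of
the same subset `D_k` have the bivariate Brown-Resnick distribution with generalized extreme value
margins. No model is imposed below the thresholds or on more than two values jointly; the
Brown-Resnick max-stable process itself is a special case. -/
structure IsModel (D : Design d K) (Θ : Set (Param q₁ q₂ q₃))
    (ν : Measure (Covariates d q₁ q₂ q₃))
    (κ : Param q₁ q₂ q₃ → Kernel (Covariates d q₁ q₂ q₃) (Fin d → ℝ)) : Prop where
  covariate_law : IsProbabilityMeasure ν
  markov : ∀ θ ∈ Θ, IsMarkovKernel (κ θ)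
  threshold_mem : ∀ θ ∈ Θ, ∀ᵐ z ∂ν, ∀ j, 0 < gevArg z θ j (D.threshold j)
  tail : ∀ θ ∈ Θ, ∀ᵐ z ∂ν, ∀ k, ∀ e ∈ pairs D k, ∀ y₁ y₂ : ℝ,
    D.threshold e.1 ≤ y₁ → D.threshold e.2 ≤ y₂ →
    0 < gevArg z θ e.1 y₁ → 0 < gevArg z θ e.2 y₂ →
    κ θ z {y | y e.1 ≤ y₁ ∧ y e.2 ≤ y₂} =
      ENNReal.ofReal
        (pairCdf (pairDep D θ e.1 e.2) (toFrechet z θ e.1 y₁) (toFrechet z θ e.2 y₂))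

/-- The sensitivity matrix `i_k(θ) = E_θ{∇_θ ψ_k(θ)} = E_θ{∇_θ Ψ_k(θ)}`. -/
def sens (D : Design d K) (P : Param q₁ q₂ q₃ → Measure (Obs d q₁ q₂ q₃)) (k : Fin K)
    (θ : Param q₁ q₂ q₃) : Matrix (ParamIdx q₁ q₂ q₃) (ParamIdx q₁ q₂ q₃) ℝ :=
  Matrix.of fun a b => ∫ o, scoreDeriv D k o θ a b ∂P θ

/-- The variability matrix `c(θ) = Var_θ{ψ_all(θ)} = Var_θ{√n Ψ_all(θ)}`. -/
def variab (D : Design d K) (P : Param q₁ q₂ q₃ → Measure (Obs d q₁ q₂ q₃))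
    (θ : Param q₁ q₂ q₃) :
    Matrix (Fin K × ParamIdx q₁ q₂ q₃) (Fin K × ParamIdx q₁ q₂ q₃) ℝ :=
  Matrix.of fun e e' => cov[fun o => scoreAll D o θ e, fun o => scoreAll D o θ e'; P θ]

/-- The block `{A}_{k,k'}` of a `Kp × Kp` matrix. -/
def blk (A : Matrix (Fin K × ParamIdx q₁ q₂ q₃) (Fin K × ParamIdx q₁ q₂ q₃) ℝ) (k k' : Fin K) :
    Matrix (ParamIdx q₁ q₂ q₃) (ParamIdx q₁ q₂ q₃) ℝ :=
  A.submatrix (fun a => (k, a)) (fun b => (k', b))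

/-- `h(θ) = ∑_k i_kᵀ {c⁻¹}_{k,k} i_k`. -/
def hMat (D : Design d K) (P : Param q₁ q₂ q₃ → Measure (Obs d q₁ q₂ q₃))
    (θ : Param q₁ q₂ q₃) : Matrix (ParamIdx q₁ q₂ q₃) (ParamIdx q₁ q₂ q₃) ℝ :=
  ∑ k, (sens D P k θ)ᵀ * blk (variab D P θ)⁻¹ k k * sens D P k θ

/-- `g(θ) = ∑_{k,k'} i_kᵀ {c⁻¹}_{k,k} {c}_{k,k'} {c⁻¹}_{k',k'} i_{k'}`. -/
def gMat (D : Design d K) (P : Param q₁ q₂ q₃ → Measure (Obs d q₁ q₂ q₃))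
    (θ : Param q₁ q₂ q₃) : Matrix (ParamIdx q₁ q₂ q₃) (ParamIdx q₁ q₂ q₃) ℝ :=
  ∑ k, ∑ k', (sens D P k θ)ᵀ * blk (variab D P θ)⁻¹ k k * blk (variab D P θ) k k' *
    blk (variab D P θ)⁻¹ k' k' * sens D P k' θ

/-! ## Sample quantities and the estimator -/

/-- `Ψ_k(θ) = (1/n) ∑_{i ≤ n} ψ_{ik}(θ)` for the sample `o 0, …, o (n - 1)`. -/
def sampleScore (D : Design d K) (n : ℕ) (o : ℕ → Obs d q₁ q₂ q₃) (k : Fin K)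
    (θ : Param q₁ q₂ q₃) : Param q₁ q₂ q₃ :=
  (1 / (n : ℝ)) • ∑ i ∈ Finset.range n, score D k (o i) θ

/-- `C(θ) = (1/n) ∑_{i ≤ n} ψ_{i,all}(θ) ψ_{i,all}(θ)ᵀ`. -/
def sampleCov (D : Design d K) (n : ℕ) (o : ℕ → Obs d q₁ q₂ q₃) (θ : Param q₁ q₂ q₃) :
    Matrix (Fin K × ParamIdx q₁ q₂ q₃) (Fin K × ParamIdx q₁ q₂ q₃) ℝ :=
  (1 / (n : ℝ)) •
    ∑ i ∈ Finset.range n, Matrix.vecMulVec (scoreAll D (o i) θ) (scoreAll D (o i) θ)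

/-- `n ∑_k Ψ_k(θ)ᵀ W_k(θ) Ψ_k(θ)` with `W_k(θ) = {C(θ)⁻¹}_{k,k}`. -/
def gmmObjective (D : Design d K) (n : ℕ) (o : ℕ → Obs d q₁ q₂ q₃) (θ : Param q₁ q₂ q₃) : ℝ :=
  n * ∑ k, (sampleScore D n o k θ).ofLp ⬝ᵥ
    (blk (sampleCov D n o θ)⁻¹ k k *ᵥ (sampleScore D n o k θ).ofLp)

/-- `θ` minimizes the objective over the parameters in `Θ` at which it is defined, i.e. at
which `C` is invertible. -/
def IsGMM (D : Design d K) (Θ : Set (Param q₁ q₂ q₃)) (n : ℕ) (o : ℕ → Obs d q₁ q₂ q₃)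
    (θ : Param q₁ q₂ q₃) : Prop :=
  IsMinOn (gmmObjective D n o) {τ ∈ Θ | IsUnit (sampleCov D n o τ).det} θ ∧
    θ ∈ Θ ∧ IsUnit (sampleCov D n o θ).det

/-! ## Regularity conditions -/

/-- Regularity of the score, for the laws `P_θ`, `θ ∈ Θ`, of one replicate and the true value `θ₀`. -/
structure ScoreRegularity (D : Design d K) (Θ : Set (Param q₁ q₂ q₃))
    (P : Param q₁ q₂ q₃ → Measure (Obs d q₁ q₂ q₃)) (θ₀ : Param q₁ q₂ q₃) : Prop where
  /-- (i) The support does not depend on the parameter. -/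
  support_eq : ∀ θ ∈ Θ, (P θ).support = (P θ₀).support
  /-- (ii) The estimating function is twice continuously differentiable in the parameter. -/
  contDiff : ∀ o ∈ (P θ₀).support, ∀ k, ContDiffOn ℝ 2 (fun θ => score D k o θ) Θ
  /-- (iii) The expectation under `θ₀` exists, and its only zero is `θ₀`, an interior point. -/
  interior : θ₀ ∈ interior Θ
  integrable : ∀ θ ∈ Θ, ∀ k, Integrable (fun o => score D k o θ) (P θ₀)
  unique_zero : ∀ θ ∈ Θ, (∀ k, ∫ o, score D k o θ ∂P θ₀ = 0) ↔ θ = θ₀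
  /-- (iv) The variability matrix is finite and positive definite. -/
  finite_var : ∀ θ ∈ Θ, ∀ k, MemLp (fun o => score D k o θ) 2 (P θ)
  posDef : ∀ θ ∈ Θ, (variab D P θ).PosDef
  /-- (v) The sensitivity matrices exist near `θ₀` and have a bounded first derivative there. -/
  sens_integrable : ∀ᶠ θ in 𝓝 θ₀, ∀ k a b, Integrable (fun o => scoreDeriv D k o θ a b) (P θ)
  sens_deriv : ∃ B : ℝ, ∀ᶠ θ in 𝓝 θ₀, ∀ k a b,
    DifferentiableAt ℝ (fun τ => sens D P k τ a b) θ ∧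
      ‖fderiv ℝ (fun τ => sens D P k τ a b) θ‖ ≤ B

/-- `X_n = O_p(r_n)` for random variables with values in `[0, ∞]`. -/
def IsBigOP {Ω : Type*} [MeasurableSpace Ω] (μ : Measure Ω) (X : ℕ → Ω → ℝ≥0∞)
    (r : ℕ → ℝ) : Prop :=
  ∀ ε : ℝ, 0 < ε → ∃ M : ℝ, ∀ᶠ n in atTop,
    μ {w | ENNReal.ofReal (M * r n) < X n w} ≤ ENNReal.ofReal ε

/-- Uniform expansion of the sample scores: for every `δ_n → ∞` and every `k`, the supremum over `θ ∈ Θ` with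
`‖θ - θ₀‖ ≤ δ_n` of
`n^{1/2} / (1 + n^{1/2} ‖θ - θ₀‖) * ‖Ψ_k(θ) - Ψ_k(θ₀) - E_{θ₀} Ψ_k(θ)‖` is `O_p(n^{-1/2})`. -/
def UniformExpansion {Ω : Type*} [MeasurableSpace Ω] (μ : Measure Ω) (O : ℕ → Ω → Obs d q₁ q₂ q₃)
    (D : Design d K) (Θ : Set (Param q₁ q₂ q₃))
    (P : Param q₁ q₂ q₃ → Measure (Obs d q₁ q₂ q₃)) (θ₀ : Param q₁ q₂ q₃) : Prop :=
  ∀ δ : ℕ → ℝ, Tendsto δ atTop atTop → ∀ k : Fin K,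
    IsBigOP μ
      (fun n w => ⨆ θ ∈ {θ ∈ Θ | ‖θ - θ₀‖ ≤ δ n},
        ENNReal.ofReal (Real.sqrt n / (1 + Real.sqrt n * ‖θ - θ₀‖) *
          ‖sampleScore D n (fun i => O i w) k θ - sampleScore D n (fun i => O i w) k θ₀ -
            ∫ o, score D k o θ ∂P θ₀‖))
      (fun n => 1 / Real.sqrt n)

end CensoredBR

end

/-!
# Asymptotic normality of the weighted estimator

Write `f = scoreAll D` for the stacked score of one replicate, `e(θ) = E_{θ₀} f(θ)` (`meanScore`) and
`X_i(θ) = f_i(θ) - f_i(θ₀) - e(θ)` for the fluctuations (`fluct`). The uniform expansion says that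
`∑_{i<n} X_i(θ) = O_p(1 + √n ‖θ - θ₀‖)` uniformly in `θ ∈ Θ`. Nothing is assumed about the matrix
`C(θ)` away from `θ₀`, nor about interchanging derivative and expectation; both are consequences of
this bound.

* *Squares of the fluctuations* (`exists_sum_sq_bound`). The sample is exchangeable, so that the sum
  over any subset of the indices obeys the same bound, and hence so do the sums with arbitrary
  signs. If at most one in twelve of the signed sums of a finite sequence exceeds `A`, its sum of
  squares is at most `2 A²`, by the second and fourth moments of random signs
  (`sum_sq_le_of_signedSum`). Therefore `∑_{i<n} X_i(θ)² = O_p((1 + √n ‖θ - θ₀‖)²)`, again uniformly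
  in `θ`. This bounds `C(θ)` on `Θ` and makes it converge to `c(θ₀)` as `θ → θ₀`.

* *Derivative of the mean* (`UniformSample.isLittleO_meanScore`). At distance `t = ‖θ - θ₀‖` and with
  `n ≈ t⁻²` replicates the two bounds say that the difference quotients of `f` have bounded sample
  mean squares and that their sample averages are close to `e(θ) / t`. The difference quotients
  converge pointwise, and so `e` is differentiable at `θ₀` with derivative the stacked matrix `G`
  of the sensitivities `i_k(θ₀)`.

* *Minimization* (`MinDistance.tendsto_argmin`). The criterion is at least `n ‖Ψ(θ)‖² / T` when
  `C(θ) ≤ T`, and it is bounded at `θ₀`; hence `Ψ` at the minimizer is `O_p(n^{-1/2})`, and by the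
  uniform expansion so is `e`. Compactness of `Θ`, uniqueness of the zero of `e` and invertibility
  of `h` give the rate `√n` of the minimizer. At this scale the criterion is, up to `o_p(1)`, the
  quadratic form with weight `W = diagBlocks(c⁻¹)` at `√n Ψ(θ₀) + G u`, `u = √n (θ - θ₀)`, whose
  minimizer is `u = -h⁻¹ Gᵀ W √n Ψ(θ₀)`. No smoothness of the weights in `θ` is needed.

The multivariate central limit theorem (`tendstoInDistribution_inv_sqrt_smul_sum`) and Slutsky's
theorem then give the limit law. Convergence in probability is expressed by the filter `probFilter`
on pairs (sample size, outcome), so that the third step is a deterministic statement about a filter.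
-/

open MeasureTheory ProbabilityTheory Filter Topology
open scoped ENNReal Matrix

namespace CensoredBR

/-! ### Block-diagonal weights -/

section Weights

variable {κ J : Type*} [DecidableEq κ]

/-- The block-diagonal part of a matrix whose rows and columns are indexed by pairs (block, entry):
the entries outside the diagonal blocks are set to zero. -/
def diagBlocks (A : Matrix (κ × J) (κ × J) ℝ) : Matrix (κ × J) (κ × J) ℝ :=
  Matrix.of fun e e' => if e.1 = e'.1 then A e e' else 0

lemma diagBlocks_transpose (A : Matrix (κ × J) (κ × J) ℝ) : (diagBlocks A)ᵀ = diagBlocks Aᵀ := by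
  ext e e'
  simp only [diagBlocks, Matrix.transpose_apply, Matrix.of_apply, eq_comm]

lemma continuous_diagBlocks :
    Continuous (diagBlocks : Matrix (κ × J) (κ × J) ℝ → Matrix (κ × J) (κ × J) ℝ) := by
  refine continuous_matrix fun e e' => ?_
  simp only [diagBlocks, Matrix.of_apply]
  split_ifs
  · exact continuous_id.matrix_elem e e'
  · exact continuous_const

variable [Fintype κ] [Fintype J]

lemma dotProduct_diagBlocks_mulVec (A : Matrix (κ × J) (κ × J) ℝ) (x : κ × J → ℝ) :
    x ⬝ᵥ diagBlocks A *ᵥ x =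
      ∑ k, (fun e : κ × J => if e.1 = k then x e else 0) ⬝ᵥ
        A *ᵥ (fun e : κ × J => if e.1 = k then x e else 0) := by
  simp only [dotProduct, Matrix.mulVec, diagBlocks, Matrix.of_apply, Finset.mul_sum]
  symm
  rw [Finset.sum_comm]
  refine Finset.sum_congr rfl fun e _ => ?_
  rw [Finset.sum_comm]
  refine Finset.sum_congr rfl fun e' _ => ?_
  rw [Finset.sum_eq_single e.1]
  · by_cases h : e.1 = e'.1
    · simp [h]
    · simp [h, Ne.symm h]
  · intro b _ hb
    simp [hb.symm]
  · simp

lemma dotProduct_self_eq_sum_blocks (x : κ × J → ℝ) :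
    x ⬝ᵥ x = ∑ k, (fun e : κ × J => if e.1 = k then x e else 0) ⬝ᵥ
      (fun e : κ × J => if e.1 = k then x e else 0) := by
  simp only [dotProduct]
  rw [Finset.sum_comm]
  refine Finset.sum_congr rfl fun e _ => ?_
  simp

end Weights

section Quadratic

variable {n : Type*} [Fintype n]

/-- An upper bound on a positive definite quadratic form is a lower bound on the form of the
inverse matrix. -/
lemma dotProduct_self_le_mul_inv [DecidableEq n] {A : Matrix n n ℝ} (hA : A.PosSemidef) (hu : IsUnit A.det)
    {T : ℝ} (hT : 0 < T) (hle : ∀ x, x ⬝ᵥ A *ᵥ x ≤ T * (x ⬝ᵥ x)) (x : n → ℝ) :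
    x ⬝ᵥ x ≤ T * (x ⬝ᵥ A⁻¹ *ᵥ x) := by
  have h0 := hA.dotProduct_mulVec_nonneg (A⁻¹ *ᵥ x - T⁻¹ • x)
  have hAA : A *ᵥ (A⁻¹ *ᵥ x) = x := by
    rw [Matrix.mulVec_mulVec, Matrix.mul_nonsing_inv A hu, Matrix.one_mulVec]
  have hsym : (A⁻¹ *ᵥ x) ⬝ᵥ A *ᵥ x = x ⬝ᵥ x := by
    have : Aᵀ = A := by simpa using hA.isHermitian.eq
    rw [Matrix.dotProduct_mulVec, ← Matrix.mulVec_transpose, this, hAA]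
  rw [star_trivial, Matrix.mulVec_sub, hAA, Matrix.mulVec_smul, sub_dotProduct, dotProduct_sub,
    dotProduct_sub, smul_dotProduct, smul_dotProduct, dotProduct_smul, dotProduct_smul, hsym,
    dotProduct_comm (A⁻¹ *ᵥ x) x] at h0
  simp only [smul_eq_mul] at h0
  have h1 := hle x
  have h2 : T⁻¹ * (T⁻¹ * (x ⬝ᵥ A *ᵥ x)) ≤ T⁻¹ * (x ⬝ᵥ x) := by
    refine mul_le_mul_of_nonneg_left ?_ (by positivity)
    rw [inv_mul_le_iff₀ hT]; exact h1
  have h3 : T⁻¹ * (x ⬝ᵥ x) ≤ x ⬝ᵥ A⁻¹ *ᵥ x := by linarith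
  rwa [inv_mul_le_iff₀ hT] at h3

lemma dotProduct_self_le_mul_diagBlocks_inv {κ J : Type*} [Fintype κ] [Fintype J] [DecidableEq κ]
    [DecidableEq J] {A : Matrix (κ × J) (κ × J) ℝ} (hA : A.PosSemidef) (hu : IsUnit A.det)
    {T : ℝ} (hT : 0 < T) (hle : ∀ x, x ⬝ᵥ A *ᵥ x ≤ T * (x ⬝ᵥ x)) (x : κ × J → ℝ) :
    x ⬝ᵥ x ≤ T * (x ⬝ᵥ diagBlocks A⁻¹ *ᵥ x) := by
  rw [dotProduct_self_eq_sum_blocks, dotProduct_diagBlocks_mulVec, Finset.mul_sum]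
  exact Finset.sum_le_sum fun k _ => dotProduct_self_le_mul_inv hA hu hT hle _

lemma norm_sq_le_dotProduct_self (x : n → ℝ) : ‖x‖ ^ 2 ≤ x ⬝ᵥ x := by
  have hx : 0 ≤ x ⬝ᵥ x := Finset.sum_nonneg fun i _ => mul_self_nonneg _
  have h : ‖x‖ ≤ Real.sqrt (x ⬝ᵥ x) := by
    refine (pi_norm_le_iff_of_nonneg (Real.sqrt_nonneg _)).2 fun i => ?_
    refine Real.le_sqrt_of_sq_le ?_
    rw [Real.norm_eq_abs, sq_abs, sq]
    exact Finset.single_le_sum (f := fun i => x i * x i) (fun i _ => mul_self_nonneg _)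
      (Finset.mem_univ i)
  calc ‖x‖ ^ 2 ≤ Real.sqrt (x ⬝ᵥ x) ^ 2 := by gcongr
    _ = _ := Real.sq_sqrt hx

lemma dotProduct_self_le_norm_sq (x : n → ℝ) : x ⬝ᵥ x ≤ Fintype.card n * ‖x‖ ^ 2 := by
  have : ∀ i ∈ (Finset.univ : Finset n), x i * x i ≤ ‖x‖ ^ 2 := fun i _ => by
    rw [← sq, ← sq_abs]
    have := norm_le_pi_norm x i
    rw [Real.norm_eq_abs] at this
    gcongr
  simpa [dotProduct] using Finset.sum_le_card_nsmul _ _ _ this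

/-- Every real quadratic form is bounded by a multiple of the squared Euclidean norm. -/
lemma exists_dotProduct_mulVec_le (A : Matrix n n ℝ) :
    ∃ T : ℝ, 0 < T ∧ ∀ x, x ⬝ᵥ A *ᵥ x ≤ T * (x ⬝ᵥ x) := by
  refine ⟨(∑ i, ∑ j, |A i j|) + 1, by positivity, fun x => ?_⟩
  have hx : 0 ≤ x ⬝ᵥ x := Finset.sum_nonneg fun i _ => mul_self_nonneg _
  calc x ⬝ᵥ A *ᵥ x = ∑ i, ∑ j, x i * (A i j * x j) := by
        simp [dotProduct, Matrix.mulVec, Finset.mul_sum]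
    _ ≤ ∑ i, ∑ j, |A i j| * (x ⬝ᵥ x) := by
        refine Finset.sum_le_sum fun i _ => Finset.sum_le_sum fun j _ => ?_
        have hi := norm_le_pi_norm x i
        have hj := norm_le_pi_norm x j
        rw [Real.norm_eq_abs] at hi hj
        calc x i * (A i j * x j) ≤ |x i * (A i j * x j)| := le_abs_self _
          _ = |A i j| * (|x i| * |x j|) := by rw [abs_mul, abs_mul]; ring
          _ ≤ |A i j| * (‖x‖ * ‖x‖) := by gcongr
          _ ≤ |A i j| * (x ⬝ᵥ x) := by
            gcongr
            rw [← sq]; exact norm_sq_le_dotProduct_self x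
    _ = (∑ i, ∑ j, |A i j|) * (x ⬝ᵥ x) := by simp [Finset.sum_mul]
    _ ≤ _ := by nlinarith

/-- A positive definite form is bounded below by a multiple of the squared norm. -/
lemma exists_norm_sq_le_mul_of_posDef [DecidableEq n] {A : Matrix n n ℝ} (hA : A.PosDef) :
    ∃ T : ℝ, 0 < T ∧ ∀ x, ‖x‖ ^ 2 ≤ T * (x ⬝ᵥ A *ᵥ x) := by
  obtain ⟨T, hT, hle⟩ := exists_dotProduct_mulVec_le A⁻¹
  refine ⟨T, hT, fun x => (norm_sq_le_dotProduct_self x).trans ?_⟩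
  have hu : IsUnit A.det := hA.det_pos.ne'.isUnit
  have h := dotProduct_self_le_mul_inv hA.inv.posSemidef
    (Matrix.isUnit_nonsing_inv_det A hu) hT hle x
  rwa [Matrix.nonsing_inv_nonsing_inv A hu] at h

lemma norm_mulVec_le {m : Type*} [Fintype m] (A : Matrix m n ℝ) :
    ∃ C : ℝ, 0 < C ∧ ∀ x : n → ℝ, ‖A *ᵥ x‖ ≤ C * ‖x‖ := by
  obtain ⟨C, hC, h⟩ := (A.mulVecLin.toContinuousLinearMap).bound
  exact ⟨C, hC, fun x => by simpa using h x⟩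

/-- The map `A ↦ diagBlocks A⁻¹` preserves positive definiteness. -/
lemma posDef_diagBlocks_inv {κ J : Type*} [Fintype κ] [Fintype J] [DecidableEq κ]
    [DecidableEq J] {A : Matrix (κ × J) (κ × J) ℝ} (hA : A.PosDef) :
    (diagBlocks A⁻¹).PosDef := by
  have hAT : (A⁻¹)ᵀ = A⁻¹ := by simpa using hA.inv.isHermitian.eq
  obtain ⟨T, hT, hle⟩ := exists_dotProduct_mulVec_le A
  refine Matrix.PosDef.of_dotProduct_mulVec_pos ?_ fun x hx => ?_
  · rw [Matrix.IsHermitian, Matrix.conjTranspose_eq_transpose_of_trivial, diagBlocks_transpose, hAT]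
  · have h := dotProduct_self_le_mul_diagBlocks_inv hA.posSemidef hA.det_pos.ne'.isUnit hT hle x
    have hx' : 0 < x ⬝ᵥ x := by
      have := norm_sq_le_dotProduct_self x
      have := norm_pos_iff.2 hx
      nlinarith
    rw [star_trivial]
    exact pos_of_mul_pos_right (hx'.trans_le h) hT.le

end Quadratic

/-! ### Minimizers of quadratic forms in approximately linear functions -/

section Argmin

variable {α : Type*} {l : Filter α}

lemma norm_ofLp_le {n : Type*} [Fintype n] (x : EuclideanSpace ℝ n) : ‖x.ofLp‖ ≤ ‖x‖ :=
  (pi_norm_le_iff_of_nonneg (norm_nonneg _)).2 fun i => PiLp.norm_apply_le x i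

lemma norm_toLp_le {n : Type*} [Fintype n] (x : n → ℝ) :
    ‖WithLp.toLp 2 x‖ ≤ Real.sqrt (Fintype.card n) * ‖x‖ := by
  rw [EuclideanSpace.norm_eq]
  refine Real.sqrt_le_iff.2 ⟨by positivity, ?_⟩
  rw [mul_pow, Real.sq_sqrt (by positivity)]
  refine le_trans (le_of_eq ?_) (dotProduct_self_le_norm_sq x)
  simp [dotProduct, sq]

/-- A quadratic form is asymptotically unchanged if its bounded argument and its matrix are perturbed
by terms that tend to zero. -/
lemma tendsto_quadForm_sub {n : Type*} [Fintype n] {x y : α → n → ℝ} {W : α → Matrix n n ℝ}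
    {W₀ : Matrix n n ℝ} (hy : y =O[l] (fun _ => (1 : ℝ))) (hxy : Tendsto (x - y) l (𝓝 0))
    (hW : Tendsto W l (𝓝 W₀)) :
    Tendsto (fun a => x a ⬝ᵥ W a *ᵥ x a - y a ⬝ᵥ W₀ *ᵥ y a) l (𝓝 0) := by
  have hx : x =O[l] (fun _ => (1 : ℝ)) := by
    have := ((Asymptotics.isLittleO_one_iff ℝ).2 hxy).isBigO.add hy
    simpa using this
  have hentry : ∀ i j, (fun a => x a i * (W a i j * x a j) - y a i * (W₀ i j * y a j)) =o[l]
      (fun _ => (1 : ℝ)) := fun i j => by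
    have hxi : ∀ i, (fun a => x a i) =O[l] (fun _ => (1 : ℝ)) := fun i =>
      Asymptotics.IsBigO.trans (.of_bound 1 (.of_forall fun a => by
        simpa using norm_le_pi_norm (x a) i)) hx
    have hyi : ∀ i, (fun a => y a i) =O[l] (fun _ => (1 : ℝ)) := fun i =>
      Asymptotics.IsBigO.trans (.of_bound 1 (.of_forall fun a => by
        simpa using norm_le_pi_norm (y a) i)) hy
    have hd : ∀ i, (fun a => x a i - y a i) =o[l] (fun _ => (1 : ℝ)) := fun i =>
      (Asymptotics.isLittleO_one_iff ℝ).2 (by simpa using (tendsto_pi_nhds.1 hxy) i)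
    have hw : (fun a => W a i j - W₀ i j) =o[l] (fun _ => (1 : ℝ)) :=
      (Asymptotics.isLittleO_one_iff ℝ).2 <| by
        simpa using ((tendsto_pi_nhds.1 (tendsto_pi_nhds.1 hW i) j).sub_const (W₀ i j))
    have h1 : (fun a => (x a i * x a j) * (W a i j - W₀ i j)) =o[l] (fun _ => (1 : ℝ)) := by
      simpa using ((hxi i).mul (hxi j)).mul_isLittleO hw
    have h2 : (fun a => W₀ i j * (x a i * (x a j - y a j))) =o[l] (fun _ => (1 : ℝ)) := by
      simpa using ((hxi i).mul_isLittleO (hd j)).const_mul_left (W₀ i j)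
    have h3 : (fun a => W₀ i j * (y a j * (x a i - y a i))) =o[l] (fun _ => (1 : ℝ)) := by
      simpa using ((hyi j).mul_isLittleO (hd i)).const_mul_left (W₀ i j)
    refine ((h1.add h2).add h3).congr_left fun a => ?_
    ring
  rw [← Asymptotics.isLittleO_one_iff ℝ]
  refine (Asymptotics.IsLittleO.sum (s := Finset.univ) fun i _ =>
    Asymptotics.IsLittleO.sum (s := Finset.univ) fun j _ => hentry i j).congr_left fun a => ?_
  simp [dotProduct, Matrix.mulVec, Finset.mul_sum, Finset.sum_sub_distrib]

/-- On a compact set, approximate zeros of a continuous function approach its only zero. -/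
lemma tendsto_of_tendsto_zero_of_isCompact {V W : Type*} [TopologicalSpace V]
    [NormedAddCommGroup W] {s : Set V} (hs : IsCompact s) {θ₀ : V} {e : V → W}
    (he : ContinuousOn e s) (hzero : ∀ θ ∈ s, e θ = 0 → θ = θ₀) {τ : α → V}
    (hτ : ∀ᶠ a in l, τ a ∈ s) (h : Tendsto (fun a => e (τ a)) l (𝓝 0)) :
    Tendsto τ l (𝓝 θ₀) := by
  rw [tendsto_nhds]
  intro U hU hθ₀
  have hc : IsCompact (s \ U) := hs.diff hU
  rcases (s \ U).eq_empty_or_nonempty with hE | hE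
  · filter_upwards [hτ] with a ha
    by_contra hn
    exact (hE ▸ (⟨ha, hn⟩ : τ a ∈ s \ U) : τ a ∈ (∅ : Set V))
  · obtain ⟨θ, hθ, hmin⟩ := hc.exists_isMinOn hE (he.norm.mono Set.sdiff_subset)
    have hpos : 0 < ‖e θ‖ := by
      rw [norm_pos_iff]
      intro h0
      exact hθ.2 (hzero θ hθ.1 h0 ▸ hθ₀)
    filter_upwards [hτ, (by simpa using h.norm : Tendsto (fun a => ‖e (τ a)‖) l (𝓝 0)).eventually_lt_const hpos] with a ha hlt
    by_contra hn
    exact absurd (hmin (⟨ha, hn⟩ : τ a ∈ s \ U)) (not_le.2 hlt)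

variable {κ J ι : Type*} [Fintype κ] [DecidableEq κ] [Fintype J] [DecidableEq J] [Fintype ι]
  [DecidableEq ι]

/-- The Gram matrix `Gᵀ diagBlocks(c⁻¹) G` of the limiting least squares problem. -/
noncomputable def gramMat (G : Matrix (κ × J) ι ℝ) (c : Matrix (κ × J) (κ × J) ℝ) : Matrix ι ι ℝ :=
  Gᵀ * diagBlocks c⁻¹ * G

/-- The matrix sending `z` to the minimizer in `u` of the quadratic form with weight
`diagBlocks(c⁻¹)` at `z + G u`. -/
noncomputable def influenceMat (G : Matrix (κ × J) ι ℝ) (c : Matrix (κ × J) (κ × J) ℝ) :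
    Matrix ι (κ × J) ℝ :=
  -((gramMat G c)⁻¹ * Gᵀ * diagBlocks c⁻¹)

lemma posDef_gramMat {G : Matrix (κ × J) ι ℝ} {c : Matrix (κ × J) (κ × J) ℝ} (hc : c.PosDef)
    (hh : IsUnit (gramMat G c).det) : (gramMat G c).PosDef := by
  have h : (gramMat G c).PosSemidef := by
    simpa [gramMat] using (posDef_diagBlocks_inv hc).posSemidef.conjTranspose_mul_mul_same G
  refine (Matrix.PosSemidef.posDef_iff_isUnit h).2 ((Matrix.isUnit_iff_isUnit_det _).2 hh)

/-- Completing the square: the excess of the limiting quadratic form over its minimum. -/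
lemma quadForm_sub_quadForm_influenceMat {G : Matrix (κ × J) ι ℝ}
    {c : Matrix (κ × J) (κ × J) ℝ} (hc : c.PosDef) (hh : IsUnit (gramMat G c).det)
    (z : κ × J → ℝ) (u : ι → ℝ) :
    (z + G *ᵥ u) ⬝ᵥ diagBlocks c⁻¹ *ᵥ (z + G *ᵥ u) -
      (z + G *ᵥ (influenceMat G c *ᵥ z)) ⬝ᵥ diagBlocks c⁻¹ *ᵥ (z + G *ᵥ (influenceMat G c *ᵥ z)) =
    (u - influenceMat G c *ᵥ z) ⬝ᵥ gramMat G c *ᵥ (u - influenceMat G c *ᵥ z) := by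
  set W := diagBlocks c⁻¹ with hWdef
  have hWT : Wᵀ = W := by simpa using (posDef_diagBlocks_inv hc).isHermitian.eq
  set v := influenceMat G c *ᵥ z with hv
  have hnormal : Gᵀ *ᵥ (W *ᵥ (z + G *ᵥ v)) = 0 := by
    have h1 : gramMat G c *ᵥ v = -(Gᵀ *ᵥ (W *ᵥ z)) := by
      rw [hv, influenceMat, Matrix.mulVec_mulVec, Matrix.mul_neg, Matrix.mul_assoc,
        ← Matrix.mul_assoc (gramMat G c), Matrix.mul_nonsing_inv _ hh, Matrix.one_mul, Matrix.neg_mulVec, Matrix.mulVec_mulVec]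
    rw [Matrix.mulVec_add, Matrix.mulVec_add, Matrix.mulVec_mulVec (v := v),
      Matrix.mulVec_mulVec (v := v), ← Matrix.mul_assoc, ← gramMat, h1, add_neg_cancel]
  have hsplit : z + G *ᵥ u = (z + G *ᵥ v) + G *ᵥ (u - v) := by
    rw [Matrix.mulVec_sub]; abel
  have hcross : (G *ᵥ (u - v)) ⬝ᵥ W *ᵥ (z + G *ᵥ v) = 0 := by
    rw [dotProduct_comm, Matrix.dotProduct_mulVec, ← Matrix.mulVec_transpose, hnormal,
      zero_dotProduct]
  have hcross' : (z + G *ᵥ v) ⬝ᵥ W *ᵥ (G *ᵥ (u - v)) = 0 := by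
    rw [Matrix.dotProduct_mulVec, ← Matrix.mulVec_transpose, hWT, dotProduct_comm, hcross]
  have hquad : (G *ᵥ (u - v)) ⬝ᵥ W *ᵥ (G *ᵥ (u - v)) = (u - v) ⬝ᵥ gramMat G c *ᵥ (u - v) := by
    rw [gramMat, ← Matrix.mulVec_mulVec, ← Matrix.mulVec_mulVec, Matrix.dotProduct_mulVec (u - v),
      Matrix.vecMul_transpose]
  rw [hsplit, Matrix.mulVec_add, add_dotProduct, dotProduct_add, dotProduct_add, hcross, hcross',
    hquad]
  ring

/-- The criterion `(r ψ)ᵀ diagBlocks(C⁻¹) (r ψ)`. -/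
noncomputable def gmmCriterion (r : ℝ) (C : Matrix (κ × J) (κ × J) ℝ) (ψ : κ × J → ℝ) : ℝ :=
  (r • ψ) ⬝ᵥ diagBlocks C⁻¹ *ᵥ (r • ψ)

/-- Data of a sequence of minimum distance problems along a filter: estimating functions `Ψ`
which differ from `Ψ θ₀ + e` by little, uniformly in the parameter, and weights that come from
matrices `C` which are bounded above and converge near `θ₀`. -/
structure MinDistance (l : Filter α) (r : α → ℝ) (Θ : Set (EuclideanSpace ℝ ι))
    (θ₀ : EuclideanSpace ℝ ι) (e : EuclideanSpace ℝ ι → κ × J → ℝ) (G : Matrix (κ × J) ι ℝ)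
    (c : Matrix (κ × J) (κ × J) ℝ) (Ψ : α → EuclideanSpace ℝ ι → κ × J → ℝ)
    (C : α → EuclideanSpace ℝ ι → Matrix (κ × J) (κ × J) ℝ) (M T : ℝ) : Prop where
  rate : Tendsto r l atTop
  compact : IsCompact Θ
  interior : θ₀ ∈ interior Θ
  continuousOn : ContinuousOn e Θ
  zero : e θ₀ = 0
  unique_zero : ∀ θ ∈ Θ, e θ = 0 → θ = θ₀
  expansion : (fun θ => e θ - G *ᵥ (θ - θ₀).ofLp) =o[𝓝 θ₀] fun θ => θ - θ₀
  posDef : c.PosDef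
  isUnit : IsUnit (gramMat G c).det
  bounded : ∀ᶠ a in l, ‖r a • Ψ a θ₀‖ ≤ M
  remainder : ∀ᶠ a in l, ∀ θ ∈ Θ,
    ‖r a • (Ψ a θ - Ψ a θ₀ - e θ)‖ ≤ M * (1 / r a + ‖θ - θ₀‖)
  posSemidef : ∀ a θ, (C a θ).PosSemidef
  le : ∀ᶠ a in l, ∀ θ ∈ Θ, ∀ x, x ⬝ᵥ C a θ *ᵥ x ≤ T * (x ⬝ᵥ x)
  pos : 0 < T
  tendsto : ∀ τ : α → EuclideanSpace ℝ ι, (∀ᶠ a in l, τ a ∈ Θ) → Tendsto τ l (𝓝 θ₀) →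
    Tendsto (fun a => C a (τ a)) l (𝓝 c)

namespace MinDistance

variable {r : α → ℝ} {Θ : Set (EuclideanSpace ℝ ι)} {θ₀ : EuclideanSpace ℝ ι}
  {e : EuclideanSpace ℝ ι → κ × J → ℝ} {G : Matrix (κ × J) ι ℝ} {c : Matrix (κ × J) (κ × J) ℝ}
  {Ψ : α → EuclideanSpace ℝ ι → κ × J → ℝ}
  {C : α → EuclideanSpace ℝ ι → Matrix (κ × J) (κ × J) ℝ} {M T : ℝ}

lemma bounded_isBigO (h : MinDistance l r Θ θ₀ e G c Ψ C M T) :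
    (fun a => r a • Ψ a θ₀) =O[l] (fun _ => (1 : ℝ)) :=
  .of_bound M (by simpa using h.bounded)

lemma tendsto_weight (h : MinDistance l r Θ θ₀ e G c Ψ C M T) {τ : α → EuclideanSpace ℝ ι}
    (hτ : ∀ᶠ a in l, τ a ∈ Θ) (hlim : Tendsto τ l (𝓝 θ₀)) :
    (∀ᶠ a in l, IsUnit (C a (τ a)).det) ∧
      Tendsto (fun a => diagBlocks (C a (τ a))⁻¹) l (𝓝 (diagBlocks c⁻¹)) := by
  have hC := h.tendsto τ hτ hlim
  have hdet : Tendsto (fun a => (C a (τ a)).det) l (𝓝 c.det) :=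
    ((continuous_id.matrix_det).tendsto c).comp hC
  refine ⟨(hdet.eventually_ne h.posDef.det_pos.ne').mono fun a ha => ha.isUnit, ?_⟩
  refine (continuous_diagBlocks.tendsto _).comp ?_
  have hinv : ContinuousAt Ring.inverse c.det := by
    simpa using NormedRing.inverse_continuousAt (Units.mk0 c.det h.posDef.det_pos.ne')
  exact (continuousAt_matrix_inv c hinv).tendsto.comp hC

/-- At parameters within `O(1/r)` of `θ₀` the criterion is that of the linear limit problem. -/
lemma tendsto_criterion_sub (h : MinDistance l r Θ θ₀ e G c Ψ C M T)
    {τ : α → EuclideanSpace ℝ ι} (hτ : ∀ᶠ a in l, τ a ∈ Θ)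
    (hO : (fun a => r a • (τ a - θ₀)) =O[l] (fun _ => (1 : ℝ))) :
    Tendsto τ l (𝓝 θ₀) ∧
    Tendsto (fun a => gmmCriterion (r a) (C a (τ a)) (Ψ a (τ a)) -
      (r a • Ψ a θ₀ + G *ᵥ (r a • (τ a - θ₀)).ofLp) ⬝ᵥ
        diagBlocks c⁻¹ *ᵥ (r a • Ψ a θ₀ + G *ᵥ (r a • (τ a - θ₀)).ofLp)) l (𝓝 0) := by
  have hr0 : ∀ᶠ a in l, r a ≠ 0 := (h.rate.eventually_gt_atTop 0).mono fun a ha => ha.ne'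
  have hinv : Tendsto (fun a => (r a)⁻¹) l (𝓝 0) := tendsto_inv_atTop_zero.comp h.rate
  have hdiff : Tendsto (fun a => τ a - θ₀) l (𝓝 0) := by
    rw [← Asymptotics.isLittleO_one_iff ℝ]
    have := ((Asymptotics.isLittleO_one_iff ℝ).2 hinv).smul_isBigO hO
    refine (this.congr' ?_ (by simp))
    filter_upwards [hr0] with a ha
    rw [smul_smul, inv_mul_cancel₀ ha, one_smul]
  have hlim : Tendsto τ l (𝓝 θ₀) := by simpa using hdiff.add_const θ₀
  refine ⟨hlim, ?_⟩
  obtain ⟨B, hB, hGB⟩ := norm_mulVec_le G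
  have hGO : (fun a => G *ᵥ (r a • (τ a - θ₀)).ofLp) =O[l] (fun _ => (1 : ℝ)) := by
    refine Asymptotics.IsBigO.trans (.of_bound B (.of_forall fun a => ?_)) hO
    refine (hGB _).trans ?_
    gcongr
    exact norm_ofLp_le _
  refine tendsto_quadForm_sub (h.bounded_isBigO.add hGO) ?_ (h.tendsto_weight hτ hlim).2
  have h1 : Tendsto (fun a => r a • (Ψ a (τ a) - Ψ a θ₀ - e (τ a))) l (𝓝 0) := by
    refine squeeze_zero_norm' (a := fun a => M * (1 / r a + ‖τ a - θ₀‖)) ?_ ?_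
    · filter_upwards [h.remainder, hτ] with a ha hτa using ha _ hτa
    · simpa using (hinv.add hdiff.norm).const_mul M
  have h2 : Tendsto (fun a => r a • (e (τ a) - G *ᵥ (τ a - θ₀).ofLp)) l (𝓝 0) := by
    rw [← Asymptotics.isLittleO_one_iff ℝ]
    exact ((Asymptotics.isBigO_refl r l).smul_isLittleO (h.expansion.comp_tendsto hlim)).trans_isBigO
      hO
  have h3 := h1.add h2
  rw [add_zero] at h3
  refine h3.congr fun a => ?_
  have hG : G *ᵥ (r a • (τ a - θ₀)).ofLp = r a • G *ᵥ (τ a - θ₀).ofLp := by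
    rw [WithLp.ofLp_smul, Matrix.mulVec_smul]
  rw [Pi.sub_apply, hG]
  module

/-- Boundedness of the criterion forces the rate `1 / r`. -/
lemma isBigO_of_bounded_criterion (h : MinDistance l r Θ θ₀ e G c Ψ C M T)
    {τ : α → EuclideanSpace ℝ ι} (hτ : ∀ᶠ a in l, τ a ∈ Θ)
    (hu : ∀ᶠ a in l, IsUnit (C a (τ a)).det)
    (hQ : ∃ B, ∀ᶠ a in l, gmmCriterion (r a) (C a (τ a)) (Ψ a (τ a)) ≤ B) :
    (fun a => r a • (τ a - θ₀)) =O[l] (fun _ => (1 : ℝ)) := by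
  obtain ⟨B, hB⟩ := hQ
  have hr0 : ∀ᶠ a in l, 1 ≤ r a := h.rate.eventually_ge_atTop 1
  have hinv : Tendsto (fun a => (r a)⁻¹) l (𝓝 0) := tendsto_inv_atTop_zero.comp h.rate
  have hΨ : (fun a => r a • Ψ a (τ a)) =O[l] (fun _ => (1 : ℝ)) := by
    refine .of_bound (Real.sqrt (T * B)) ?_
    filter_upwards [hB, hτ, hu, h.le] with a hBa hτa hua hle
    have h1 := dotProduct_self_le_mul_diagBlocks_inv (h.posSemidef a (τ a)) hua h.pos
      (hle _ hτa) (r a • Ψ a (τ a))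
    have h2 := norm_sq_le_dotProduct_self (r a • Ψ a (τ a))
    rw [norm_one, mul_one]
    refine Real.le_sqrt_of_sq_le (h2.trans (h1.trans ?_))
    exact mul_le_mul_of_nonneg_left hBa h.pos.le
  obtain ⟨R, hR⟩ := h.compact.isBounded.subset_closedBall θ₀
  have hrem : (fun a => r a • (Ψ a (τ a) - Ψ a θ₀ - e (τ a))) =O[l] (fun _ => (1 : ℝ)) := by
    refine .of_bound (|M| * (1 + R)) ?_
    filter_upwards [h.remainder, hτ, hr0] with a ha hτa hra
    refine (ha _ hτa).trans ?_
    have hd : ‖τ a - θ₀‖ ≤ R := by simpa [dist_eq_norm] using hR hτa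
    have h1 : 1 / r a ≤ 1 := by rw [div_le_one (by linarith)]; exact hra
    have h0 : 0 ≤ 1 / r a := by positivity
    rw [norm_one, mul_one]
    calc M * (1 / r a + ‖τ a - θ₀‖) ≤ |M| * (1 / r a + ‖τ a - θ₀‖) := by
          gcongr; exact le_abs_self M
      _ ≤ _ := by gcongr
  have he : (fun a => r a • e (τ a)) =O[l] (fun _ => (1 : ℝ)) := by
    refine ((hΨ.sub h.bounded_isBigO).sub hrem).congr_left fun a => ?_
    simp only [smul_sub]; abel
  have he0 : Tendsto (fun a => e (τ a)) l (𝓝 0) := by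
    rw [← Asymptotics.isLittleO_one_iff ℝ]
    have := ((Asymptotics.isLittleO_one_iff ℝ).2 hinv).smul_isBigO he
    refine (this.congr' ?_ (by simp))
    filter_upwards [hr0] with a ha
    rw [smul_smul, inv_mul_cancel₀ (by linarith), one_smul]
  have hlim : Tendsto τ l (𝓝 θ₀) :=
    tendsto_of_tendsto_zero_of_isCompact h.compact h.continuousOn h.unique_zero hτ he0
  have hG : (fun a => τ a - θ₀) =O[l] fun a => G *ᵥ (τ a - θ₀).ofLp := by
    -- `v = h⁻¹ Gᵀ W G v` bounds `v` by `G v`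
    obtain ⟨B₁, hB₁, hB₁'⟩ := norm_mulVec_le ((gramMat G c)⁻¹ * (Gᵀ * diagBlocks c⁻¹))
    have hid : ∀ v : ι → ℝ, ((gramMat G c)⁻¹ * (Gᵀ * diagBlocks c⁻¹)) *ᵥ (G *ᵥ v) = v := fun v => by
      rw [Matrix.mulVec_mulVec, Matrix.mul_assoc, ← gramMat, Matrix.nonsing_inv_mul _ h.isUnit,
        Matrix.one_mulVec]
    have h1 : (fun a => τ a - θ₀) =O[l] fun a => (τ a - θ₀).ofLp :=
      Asymptotics.IsBigO.of_bound (Real.sqrt (Fintype.card ι)) (.of_forall fun a => by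
        exact norm_toLp_le _)
    refine h1.trans (.of_bound B₁ (.of_forall fun a => ?_))
    have := hB₁' (G *ᵥ (τ a - θ₀).ofLp)
    rwa [hid] at this
  have hsmall := (h.expansion.comp_tendsto hlim).trans_isBigO hG
  have hGe : (fun a => G *ᵥ (τ a - θ₀).ofLp) =O[l] fun a => e (τ a) :=
    Asymptotics.IsEquivalent.isBigO_symm (u := fun a => e (τ a)) hsmall
  exact ((Asymptotics.isBigO_refl r l).smul (hG.trans hGe)).trans he

/-- **Linearization of the minimizer.** The normalized error of a minimizer of the criterion is
asymptotically a linear function of the estimating function at `θ₀`. -/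
theorem tendsto_argmin (h : MinDistance l r Θ θ₀ e G c Ψ C M T)
    {τ : α → EuclideanSpace ℝ ι} (hτ : ∀ᶠ a in l, τ a ∈ Θ)
    (hu : ∀ᶠ a in l, IsUnit (C a (τ a)).det)
    (hmin : ∀ᶠ a in l, ∀ θ ∈ Θ, IsUnit (C a θ).det →
      gmmCriterion (r a) (C a (τ a)) (Ψ a (τ a)) ≤ gmmCriterion (r a) (C a θ) (Ψ a θ)) :
    Tendsto (fun a => (r a • (τ a - θ₀)).ofLp - influenceMat G c *ᵥ (r a • Ψ a θ₀)) l (𝓝 0) := by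
  have hr0 : ∀ᶠ a in l, r a ≠ 0 := (h.rate.eventually_gt_atTop 0).mono fun a ha => ha.ne'
  have hΘ : Θ ∈ 𝓝 θ₀ := mem_interior_iff_mem_nhds.1 h.interior
  -- comparison with the parameter `θ₀`
  have hu₀ := (h.tendsto_weight (τ := fun _ => θ₀) (.of_forall fun _ => mem_of_mem_nhds hΘ)
    tendsto_const_nhds).1
  have hQ₀ : ∃ B, ∀ᶠ a in l, gmmCriterion (r a) (C a θ₀) (Ψ a θ₀) ≤ B := by
    have h1 := (h.tendsto_criterion_sub (τ := fun _ => θ₀)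
      (.of_forall fun _ => mem_of_mem_nhds hΘ)
      (by simpa using Asymptotics.isBigO_zero (E' := EuclideanSpace ℝ ι) (fun _ => (1 : ℝ)) l)).2
    obtain ⟨S, hS, hS'⟩ := exists_dotProduct_mulVec_le (diagBlocks c⁻¹)
    refine ⟨1 + S * (Fintype.card (κ × J) * |M| ^ 2), ?_⟩
    filter_upwards [h1.eventually_lt_const zero_lt_one, h.bounded] with a ha hb
    simp only [sub_self, smul_zero, WithLp.ofLp_zero, Matrix.mulVec_zero, add_zero] at ha
    have h2 := hS' (r a • Ψ a θ₀)
    have h3 := dotProduct_self_le_norm_sq (r a • Ψ a θ₀)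
    have h4 : (r a • Ψ a θ₀) ⬝ᵥ (r a • Ψ a θ₀) ≤ Fintype.card (κ × J) * |M| ^ 2 :=
      h3.trans (by gcongr; exact hb.trans (le_abs_self M))
    have h5 := mul_le_mul_of_nonneg_left h4 hS.le
    linarith
  have hO : (fun a => r a • (τ a - θ₀)) =O[l] (fun _ => (1 : ℝ)) := by
    obtain ⟨B, hB⟩ := hQ₀
    refine h.isBigO_of_bounded_criterion hτ hu ⟨B, ?_⟩
    filter_upwards [hB, hmin, hu₀] with a ha hm hua
    exact (hm θ₀ (mem_of_mem_nhds hΘ) hua).trans ha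
  have hcrit := (h.tendsto_criterion_sub hτ hO).2
  -- comparison with the minimizer of the linear limit problem
  set σ : α → EuclideanSpace ℝ ι := fun a =>
    θ₀ + (r a)⁻¹ • WithLp.toLp 2 (influenceMat G c *ᵥ (r a • Ψ a θ₀)) with hσ
  have hσeq : ∀ᶠ a in l, r a • (σ a - θ₀) = WithLp.toLp 2 (influenceMat G c *ᵥ (r a • Ψ a θ₀)) := by
    filter_upwards [hr0] with a ha
    rw [hσ, add_sub_cancel_left, smul_smul, mul_inv_cancel₀ ha, one_smul]
  have hσO : (fun a => r a • (σ a - θ₀)) =O[l] (fun _ => (1 : ℝ)) := by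
    obtain ⟨B, hB, hB'⟩ := norm_mulVec_le (influenceMat G c)
    have h1 : (fun a => WithLp.toLp 2 (influenceMat G c *ᵥ (r a • Ψ a θ₀))) =O[l]
        fun a => influenceMat G c *ᵥ (r a • Ψ a θ₀) :=
      Asymptotics.IsBigO.of_bound (Real.sqrt (Fintype.card ι)) (.of_forall fun a => by
        exact norm_toLp_le _)
    have h2 : (fun a => influenceMat G c *ᵥ (r a • Ψ a θ₀)) =O[l] (fun _ => (1 : ℝ)) :=
      Asymptotics.IsBigO.trans (.of_bound B (.of_forall fun a => hB' _)) h.bounded_isBigO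
    refine (h1.trans h2).congr' ?_ .rfl
    filter_upwards [hσeq] with a ha using ha.symm
  have hσlim : Tendsto σ l (𝓝 θ₀) := by
    have hinv : Tendsto (fun a => (r a)⁻¹) l (𝓝 0) := tendsto_inv_atTop_zero.comp h.rate
    have := ((Asymptotics.isLittleO_one_iff ℝ).2 hinv).smul_isBigO hσO
    have h2 : Tendsto (fun a => σ a - θ₀) l (𝓝 0) := by
      rw [← Asymptotics.isLittleO_one_iff ℝ]
      refine (this.congr' ?_ (by simp))
      filter_upwards [hr0] with a ha
      rw [smul_smul, inv_mul_cancel₀ ha, one_smul]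
    simpa using h2.add_const θ₀
  have hσmem : ∀ᶠ a in l, σ a ∈ Θ := hσlim.eventually_mem hΘ
  have hσcrit := (h.tendsto_criterion_sub hσmem hσO).2
  have hσu := (h.tendsto_weight hσmem hσlim).1
  obtain ⟨S, hS, hS'⟩ := exists_norm_sq_le_mul_of_posDef (posDef_gramMat h.posDef h.isUnit)
  have hlim := ((hσcrit.sub hcrit).const_mul S)
  rw [sub_zero, mul_zero] at hlim
  have hsq : Tendsto (fun a =>
      ‖(r a • (τ a - θ₀)).ofLp - influenceMat G c *ᵥ (r a • Ψ a θ₀)‖ ^ 2) l (𝓝 0) := by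
    refine tendsto_of_tendsto_of_tendsto_of_le_of_le' tendsto_const_nhds hlim
      (.of_forall fun a => by positivity) ?_
    filter_upwards [hmin, hσmem, hσu, hσeq] with a hm hmem hua heq
    refine (hS' _).trans (mul_le_mul_of_nonneg_left ?_ hS.le)
    rw [heq, ← quadForm_sub_quadForm_influenceMat h.posDef h.isUnit]
    have := hm (σ a) hmem hua
    simp only
    linarith
  rw [tendsto_zero_iff_norm_tendsto_zero]
  have := (Real.continuous_sqrt.tendsto 0).comp hsq
  simpa [Function.comp_def, Real.sqrt_sq (norm_nonneg _)] using this

end MinDistance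

end Argmin

/-! ### Random signs -/

section Signs

variable {β : Type*} [DecidableEq β]

/-- The sum over `s` of `x` with the sign `+` on `I` and the sign `-` off `I`. -/
def signedSum (s I : Finset β) (x : β → ℝ) : ℝ := ∑ i ∈ s, if i ∈ I then x i else -x i

lemma signedSum_insert_of_subset {s I : Finset β} {a : β} (ha : a ∉ s) (hI : I ⊆ s) (x : β → ℝ) :
    signedSum (insert a s) I x = signedSum s I x - x a := by
  have : a ∉ I := fun h => ha (hI h)
  simp only [signedSum, Finset.sum_insert ha, this, if_false]
  ring

lemma signedSum_insert_insert {s I : Finset β} {a : β} (ha : a ∉ s) (x : β → ℝ) :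
    signedSum (insert a s) (insert a I) x = signedSum s I x + x a := by
  simp only [signedSum, Finset.sum_insert ha, Finset.mem_insert_self, if_true]
  rw [add_comm]
  congr 1
  refine Finset.sum_congr rfl fun i hi => ?_
  have : i ≠ a := fun h => ha (h ▸ hi)
  simp [this]

lemma signedSum_eq {s I : Finset β} (hI : I ⊆ s) (x : β → ℝ) :
    signedSum s I x = 2 * ∑ i ∈ I, x i - ∑ i ∈ s, x i := by
  have h1 : ∑ i ∈ I, x i = ∑ i ∈ s, if i ∈ I then x i else 0 := by
    rw [← Finset.sum_filter, Finset.filter_mem_eq_inter, Finset.inter_eq_right.2 hI]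
  rw [h1, signedSum, Finset.mul_sum, ← Finset.sum_sub_distrib]
  refine Finset.sum_congr rfl fun i _ => ?_
  split_ifs <;> ring

lemma sum_signedSum_sq (s : Finset β) (x : β → ℝ) :
    ∑ I ∈ s.powerset, signedSum s I x ^ 2 = 2 ^ s.card * ∑ i ∈ s, x i ^ 2 := by
  induction s using Finset.induction_on with
  | empty => simp [signedSum]
  | insert a s ha ih =>
    have h1 : ∀ I ∈ s.powerset,
        signedSum (insert a s) I x ^ 2 = (signedSum s I x - x a) ^ 2 := fun I hI => by
      rw [signedSum_insert_of_subset ha (Finset.mem_powerset.1 hI)]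
    rw [Finset.sum_powerset_insert ha, Finset.sum_congr rfl h1, ← Finset.sum_add_distrib]
    simp only [signedSum_insert_insert ha]
    have h2 : ∀ I ∈ s.powerset, (signedSum s I x - x a) ^ 2 + (signedSum s I x + x a) ^ 2 =
        2 * signedSum s I x ^ 2 + 2 * x a ^ 2 := fun I _ => by ring
    rw [Finset.sum_congr rfl h2, Finset.sum_add_distrib, ← Finset.mul_sum, ih, Finset.sum_const,
      Finset.card_powerset, Finset.card_insert_of_notMem ha, Finset.sum_insert ha]
    simp only [nsmul_eq_mul, Nat.cast_pow, Nat.cast_ofNat]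
    ring

lemma sum_signedSum_pow_four_le (s : Finset β) (x : β → ℝ) :
    ∑ I ∈ s.powerset, signedSum s I x ^ 4 ≤ 3 * 2 ^ s.card * (∑ i ∈ s, x i ^ 2) ^ 2 := by
  induction s using Finset.induction_on with
  | empty => simp [signedSum]
  | insert a s ha ih =>
    have h1 : ∀ I ∈ s.powerset,
        signedSum (insert a s) I x ^ 4 = (signedSum s I x - x a) ^ 4 := fun I hI => by
      rw [signedSum_insert_of_subset ha (Finset.mem_powerset.1 hI)]
    rw [Finset.sum_powerset_insert ha, Finset.sum_congr rfl h1, ← Finset.sum_add_distrib]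
    simp only [signedSum_insert_insert ha]
    have h2 : ∀ I ∈ s.powerset, (signedSum s I x - x a) ^ 4 + (signedSum s I x + x a) ^ 4 =
        2 * signedSum s I x ^ 4 + (12 * x a ^ 2) * signedSum s I x ^ 2 + 2 * x a ^ 4 :=
      fun I _ => by ring
    rw [Finset.sum_congr rfl h2, Finset.sum_add_distrib, Finset.sum_add_distrib, ← Finset.mul_sum,
      ← Finset.mul_sum, sum_signedSum_sq, Finset.sum_const,
      Finset.card_powerset, Finset.card_insert_of_notMem ha, Finset.sum_insert ha]
    simp only [nsmul_eq_mul, Nat.cast_pow, Nat.cast_ofNat]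
    have h3 : (0 : ℝ) ≤ 2 ^ s.card * x a ^ 4 := by positivity
    rw [pow_succ (2 : ℝ)]
    nlinarith [ih, h3]

/-- If at most one in twelve of the signed sums of `x` exceeds `A`, then the sum of squares of `x`
is at most `2 A²` (a Paley-Zygmund argument with the second and fourth moments). -/
lemma sum_sq_le_of_signedSum {s : Finset β} {x : β → ℝ} {A : ℝ}
    (h : 12 * (s.powerset.filter fun I => A < |signedSum s I x|).card ≤ 2 ^ s.card) :
    ∑ i ∈ s, x i ^ 2 ≤ 2 * A ^ 2 := by
  set B := s.powerset.filter fun I => A < |signedSum s I x| with hB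
  set σ := ∑ i ∈ s, x i ^ 2 with hσ
  have hσ0 : 0 ≤ σ := Finset.sum_nonneg fun i _ => sq_nonneg _
  have hN : (0 : ℝ) < 2 ^ s.card := by positivity
  have h' : 12 * (B.card : ℝ) ≤ 2 ^ s.card := by exact_mod_cast h
  have hbad : ∑ I ∈ B, signedSum s I x ^ 2 ≤ 2 ^ s.card * σ / 2 := by
    have hcs : (∑ I ∈ B, signedSum s I x ^ 2) ^ 2 ≤ B.card * ∑ I ∈ B, (signedSum s I x ^ 2) ^ 2 :=
      sq_sum_le_card_mul_sum_sq
    have h4 : ∑ I ∈ B, (signedSum s I x ^ 2) ^ 2 ≤ 3 * 2 ^ s.card * σ ^ 2 := by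
      refine le_trans ?_ (sum_signedSum_pow_four_le s x)
      rw [Finset.sum_congr rfl fun I _ => show (signedSum s I x ^ 2) ^ 2 = signedSum s I x ^ 4 by
        ring]
      exact Finset.sum_le_sum_of_subset_of_nonneg (Finset.filter_subset _ _)
        fun I _ _ => by positivity
    refine le_of_sq_le_sq ?_ (by positivity)
    calc _ ≤ (B.card : ℝ) * (3 * 2 ^ s.card * σ ^ 2) := hcs.trans (by gcongr)
      _ ≤ (2 ^ s.card / 12) * (3 * 2 ^ s.card * σ ^ 2) := by
        gcongr; linarith
      _ = _ := by ring
  have hgood : ∑ I ∈ s.powerset.filter (fun I => ¬ A < |signedSum s I x|), signedSum s I x ^ 2 ≤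
      2 ^ s.card * A ^ 2 := by
    have h1 : ∀ I ∈ s.powerset.filter (fun I => ¬ A < |signedSum s I x|),
        signedSum s I x ^ 2 ≤ A ^ 2 := fun I hI => by
      rw [← sq_abs]
      have := not_lt.1 (Finset.mem_filter.1 hI).2
      gcongr
    refine (Finset.sum_le_card_nsmul _ _ _ h1).trans ?_
    rw [nsmul_eq_mul]
    gcongr
    have := Finset.card_filter_le s.powerset (fun I => ¬ A < |signedSum s I x|)
    rw [Finset.card_powerset] at this
    exact_mod_cast this
  have htot := sum_signedSum_sq s x
  rw [← Finset.sum_filter_add_sum_filter_not s.powerset (fun I => A < |signedSum s I x|)] at htot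
  have : 2 ^ s.card * (σ / 2) ≤ 2 ^ s.card * A ^ 2 := by linarith
  have := le_of_mul_le_mul_left this hN
  linarith

end Signs

/-! ### From bounded sums to bounded sums of squares -/

section SumSq

variable {Ω : Type*} [MeasurableSpace Ω] {μ : Measure Ω}

/-- Markov's inequality for the number of events that occur: the probability that more than one in
twelve of events of probability at most `η` occur is at most `12 η`. The events need not be
measurable. -/
lemma measure_card_lt_twelve_mul_le {β : Type*} (T : Finset β) (D : β → Set Ω) {η : ℝ≥0∞}
    (h : ∀ I ∈ T, μ (D I) ≤ η) :
    μ {w | ∃ S ⊆ T, (∀ I ∈ S, w ∈ D I) ∧ T.card < 12 * S.card} ≤ 12 * η := by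
  classical
  rcases T.eq_empty_or_nonempty with rfl | hT
  · have : {w : Ω | ∃ S ⊆ (∅ : Finset β), (∀ I ∈ S, w ∈ D I) ∧
        (∅ : Finset β).card < 12 * S.card} = ∅ := by
      ext w
      simp +contextual [Finset.subset_empty]
    rw [this]; simp
  set f : Ω → ℝ≥0∞ := fun w => ∑ I ∈ T, (toMeasurable μ (D I)).indicator (fun _ => 12) w with hf
  have hfm : Measurable f := Finset.measurable_sum _ fun I _ =>
    measurable_const.indicator (measurableSet_toMeasurable _ _)
  have hint : ∫⁻ w, f w ∂μ ≤ T.card * (12 * η) := by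
    rw [lintegral_finsetSum _ fun I _ =>
      measurable_const.indicator (measurableSet_toMeasurable _ _)]
    refine (Finset.sum_le_card_nsmul _ _ (12 * η) fun I hI => ?_).trans (by simp)
    rw [lintegral_indicator_const (measurableSet_toMeasurable _ _), measure_toMeasurable]
    gcongr
    exact h I hI
  have hsub : {w | ∃ S ⊆ T, (∀ I ∈ S, w ∈ D I) ∧ T.card < 12 * S.card} ⊆
      {w | (T.card : ℝ≥0∞) ≤ f w} := by
    rintro w ⟨S, hST, hS, hlt⟩
    calc (T.card : ℝ≥0∞) ≤ ((12 * S.card : ℕ) : ℝ≥0∞) := by exact_mod_cast hlt.le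
      _ = ∑ I ∈ S, (toMeasurable μ (D I)).indicator (fun _ => 12) w := by
        rw [Finset.sum_congr rfl fun I hI =>
          Set.indicator_of_mem (subset_toMeasurable μ (D I) (hS I hI)) _]
        simp [mul_comm]
      _ ≤ f w := Finset.sum_le_sum_of_subset hST
  have hmk := (mul_meas_ge_le_lintegral hfm (T.card : ℝ≥0∞)).trans hint
  have hc : (T.card : ℝ≥0∞) ≠ 0 := by simpa using hT.ne_empty
  exact (measure_mono hsub).trans
    ((ENNReal.mul_le_mul_iff_right hc (ENNReal.natCast_ne_top _)).1 hmk)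

variable {X : Type*} [MeasurableSpace X] {P : Measure X}
  {O : ℕ → Ω → X}

/-- Any `m` distinct members of an i.i.d. sequence have the product law. -/
lemma measure_preimage_iid [IsProbabilityMeasure μ] (hm : ∀ i, Measurable (O i))
    (hind : iIndepFun O μ) (hlaw : ∀ i, μ.map (O i) = P) {m : ℕ} {s : Fin m → ℕ}
    (hs : Function.Injective s) {B : Set (Fin m → X)}
    (hB : NullMeasurableSet B (Measure.pi fun _ : Fin m => P)) :
    μ {w | (fun j => O (s j) w) ∈ B} = Measure.pi (fun _ : Fin m => P) B := by
  have h1 : iIndepFun (fun j => O (s j)) μ := hind.precomp hs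
  have h2 := (iIndepFun_iff_map_fun_eq_pi_map fun j => (hm (s j)).aemeasurable).1 h1
  simp only [hlaw] at h2
  rw [← h2] at hB ⊢
  exact (Measure.map_apply₀ (measurable_pi_lambda _ fun j => hm (s j)).aemeasurable hB).symm

/-- Exchangeability: the uniform bound on the sum over `I` has the probability of the uniform bound
on the sum over the first `#I` indices. -/
lemma measure_exists_lt_abs_sum [IsProbabilityMeasure μ] [IsProbabilityMeasure P]
    (hm : ∀ i, Measurable (O i))
    (hind : iIndepFun O μ) (hlaw : ∀ i, μ.map (O i) = P) {V : Type*} {Q : Set V}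
    (hQ : Q.Countable) {g : X → V → ℝ} (hg : ∀ q ∈ Q, AEMeasurable (fun o => g o q) P)
    (b : V → ℝ) (I : Finset ℕ) :
    μ {w | ∃ q ∈ Q, b q < |∑ i ∈ I, g (O i w) q|} =
      μ {w | ∃ q ∈ Q, b q < |∑ i ∈ Finset.range I.card, g (O i w) q|} := by
  set B : Set (Fin I.card → X) := {v | ∃ q ∈ Q, b q < |∑ j, g (v j) q|} with hBdef
  have hB : NullMeasurableSet B (Measure.pi fun _ : Fin I.card => P) := by
    have : B = ⋃ q ∈ Q, {v | b q < |∑ j, g (v j) q|} := by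
      ext v; simp [hBdef]
    rw [this]
    refine NullMeasurableSet.biUnion hQ fun q hq => ?_
    refine nullMeasurableSet_lt aemeasurable_const ?_
    have : AEMeasurable (fun v : Fin I.card → X => ∑ j, g (v j) q)
        (Measure.pi fun _ : Fin I.card => P) := by
      refine Finset.aemeasurable_fun_sum _ fun j _ => ?_
      exact (hg q hq).comp_quasiMeasurePreserving (Measure.quasiMeasurePreserving_eval _ j)
    simpa [Real.norm_eq_abs] using this.norm
  have h1 := measure_preimage_iid hm hind hlaw
    (s := fun j => ((I.equivFin.symm j : I) : ℕ))
    (Subtype.val_injective.comp I.equivFin.symm.injective) hB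
  have h2 := measure_preimage_iid hm hind hlaw (s := fun j : Fin I.card => (j : ℕ))
    Fin.val_injective hB
  rw [← h2] at h1
  have e1 : ∀ w q, ∑ j, g (O (I.equivFin.symm j : I) w) q = ∑ i ∈ I, g (O i w) q := fun w q => by
    rw [← Finset.sum_coe_sort I]
    exact I.equivFin.symm.sum_comp (fun i : I => g (O i w) q)
  have e2 : ∀ w q, ∑ j : Fin I.card, g (O j w) q = ∑ i ∈ Finset.range I.card, g (O i w) q :=
    fun w q => (Finset.sum_range fun i => g (O i w) q).symm
  simpa [hBdef, e1, e2] using h1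

/-- **Bounded sums have bounded sums of squares.** If with high probability the sums of
`g (O i) q`, `i < n`, are at most `M (1 + √n t(q))` simultaneously for all `q`, then with high
probability the sums of the squares are at most `M' (1 + √n t(q))²` simultaneously for all `q`.
By exchangeability the sums with arbitrary signs are bounded as well, and most of the signed sums of
a sequence are at least of the order of the root of its sum of squares. -/
theorem exists_sum_sq_bound [IsProbabilityMeasure μ] [IsProbabilityMeasure P]
    (hm : ∀ i, Measurable (O i))
    (hind : iIndepFun O μ) (hlaw : ∀ i, μ.map (O i) = P) {V : Type*} {Q : Set V}
    (hQ : Q.Countable) {g : X → V → ℝ} (hg : ∀ q ∈ Q, AEMeasurable (fun o => g o q) P)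
    {t : V → ℝ} (ht : ∀ q, 0 ≤ t q)
    (H : ∀ ε : ℝ, 0 < ε → ∃ M : ℝ, ∀ᶠ n : ℕ in atTop,
      μ {w | ∃ q ∈ Q, M * (1 + √n * t q) < |∑ i ∈ Finset.range n, g (O i w) q|} ≤
        ENNReal.ofReal ε)
    {ε : ℝ} (hε : 0 < ε) :
    ∃ M : ℝ, 0 ≤ M ∧ ∀ᶠ n : ℕ in atTop,
      μ {w | ∃ q ∈ Q, M * (1 + √n * t q) ^ 2 < ∑ i ∈ Finset.range n, g (O i w) q ^ 2} ≤
        ENNReal.ofReal ε := by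
  -- each signed sum fails its bound on two events, and Markov's inequality costs a factor `12`
  obtain ⟨M₀, hM₀⟩ := H (ε / 24) (by positivity)
  obtain ⟨N, hN⟩ := eventually_atTop.1 hM₀
  set M := max M₀ 0 with hMdef
  have hM : 0 ≤ M := le_max_right _ _
  refine ⟨18 * M ^ 2, by positivity, eventually_atTop.2 ⟨2 * N, fun n hn => ?_⟩⟩
  -- the exceptional event of the sum over `I`
  set B : Finset ℕ → Set Ω := fun I =>
    {w | ∃ q ∈ Q, M * (1 + √(I.card : ℝ) * t q) < |∑ i ∈ I, g (O i w) q|} with hBdef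
  have hBle : ∀ I : Finset ℕ, N ≤ I.card → μ (B I) ≤ ENNReal.ofReal (ε / 24) := fun I hI => by
    have h := measure_exists_lt_abs_sum hm hind hlaw hQ hg
      (fun q => M * (1 + √(I.card : ℝ) * t q)) I
    refine (h.le.trans (measure_mono ?_)).trans (hN _ hI)
    rintro w ⟨q, hq, hlt⟩
    refine ⟨q, hq, lt_of_le_of_lt ?_ hlt⟩
    have := ht q
    gcongr
    exact le_max_left _ _
  -- either `I` or its complement has at least half of the indices
  set big : Finset ℕ → Finset ℕ := fun I =>
    if n ≤ 2 * I.card then I else Finset.range n \ I with hbig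
  set D : Finset ℕ → Set Ω := fun I => B (big I) ∪ B (Finset.range n) with hD
  have hcard : ∀ I ∈ (Finset.range n).powerset, N ≤ (big I).card ∧ big I ⊆ Finset.range n := by
    intro I hI
    have hI' := Finset.mem_powerset.1 hI
    by_cases h : n ≤ 2 * I.card
    · simp only [hbig, h, if_true]
      exact ⟨by omega, hI'⟩
    · simp only [hbig, h, if_false]
      refine ⟨?_, Finset.sdiff_subset⟩
      rw [Finset.card_sdiff_of_subset hI', Finset.card_range]
      omega
  have hDle : ∀ I ∈ (Finset.range n).powerset, μ (D I) ≤ ENNReal.ofReal (ε / 12) := by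
    intro I hI
    refine (measure_union_le _ _).trans ?_
    refine (add_le_add (hBle _ (hcard I hI).1) (hBle _ (by rw [Finset.card_range]; omega))).trans ?_
    rw [← ENNReal.ofReal_add (by positivity) (by positivity)]
    exact ENNReal.ofReal_le_ofReal (by linarith)
  have hsign : ∀ I ∈ (Finset.range n).powerset, ∀ w ∉ D I, ∀ q ∈ Q,
      |signedSum (Finset.range n) I (fun i => g (O i w) q)| ≤ 3 * M * (1 + √n * t q) := by
    intro I hI w hw q hq
    have hI' := Finset.mem_powerset.1 hI
    rw [hD, Set.mem_union, not_or] at hw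
    have htq := ht q
    have h1 : |∑ i ∈ big I, g (O i w) q| ≤ M * (1 + √n * t q) := by
      have h := hw.1
      simp only [hBdef, Set.mem_ofPred_eq, not_exists, not_and, not_lt] at h
      refine (h q hq).trans ?_
      have hle : (big I).card ≤ n := by
        simpa using Finset.card_le_card (hcard I hI).2
      gcongr
    have h2 : |∑ i ∈ Finset.range n, g (O i w) q| ≤ M * (1 + √n * t q) := by
      have h := hw.2
      simp only [hBdef, Set.mem_ofPred_eq, not_exists, not_and, not_lt, Finset.card_range] at h
      exact h q hq
    have h3 : |signedSum (Finset.range n) I (fun i => g (O i w) q)| =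
        |2 * ∑ i ∈ big I, g (O i w) q - ∑ i ∈ Finset.range n, g (O i w) q| := by
      rw [signedSum_eq hI']
      by_cases h : n ≤ 2 * I.card
      · simp only [hbig, h, if_true]
      · simp only [hbig, h, if_false]
        rw [← Finset.sum_sdiff hI', abs_sub_comm]
        congr 1
        ring
    rw [h3, abs_le]
    rw [abs_le] at h1 h2
    constructor <;> linarith [h1.1, h1.2, h2.1, h2.2]
  have hfin := measure_card_lt_twelve_mul_le (μ := μ) (Finset.range n).powerset D hDle
  have h12 : 12 * ENNReal.ofReal (ε / 12) = ENNReal.ofReal ε := by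
    rw [show (12 : ℝ≥0∞) = ENNReal.ofReal 12 by simp, ← ENNReal.ofReal_mul (by norm_num)]
    congr 1; ring
  rw [h12] at hfin
  refine (measure_mono ?_).trans hfin
  rintro w ⟨q, hq, hlt⟩
  refine ⟨(Finset.range n).powerset.filter fun I =>
    3 * M * (1 + √n * t q) < |signedSum (Finset.range n) I (fun i => g (O i w) q)|,
    Finset.filter_subset _ _, fun I hI => ?_, ?_⟩
  · by_contra hn
    have := hsign I (Finset.mem_filter.1 hI).1 w hn q hq
    exact absurd (Finset.mem_filter.1 hI).2 (not_lt.2 this)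
  · by_contra hn
    rw [not_lt, Finset.card_powerset] at hn
    have := sum_sq_le_of_signedSum hn
    have h18 : 2 * (3 * M * (1 + √n * t q)) ^ 2 = 18 * M ^ 2 * (1 + √n * t q) ^ 2 := by ring
    linarith

end SumSq

/-! ### I.i.d. estimating functions with small fluctuations -/

section Fluctuation

variable {Ω X V E : Type*} [MeasurableSpace Ω] {μ : Measure Ω} [MeasurableSpace X] {P : Measure X}

lemma ae_forall_sample {O : ℕ → Ω → X} (hm : ∀ i, Measurable (O i))
    (hlaw : ∀ i, μ.map (O i) = P) {p : X → Prop} (h : ∀ᵐ o ∂P, p o) : ∀ᵐ w ∂μ, ∀ i, p (O i w) :=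
  ae_all_iff.2 fun i => ae_of_ae_map (hm i).aemeasurable (by rwa [hlaw i])

lemma exists_notMem_of_measure_lt_one [IsProbabilityMeasure μ] {B : Set Ω} (hB : μ B < 1)
    {p : Ω → Prop} (h : ∀ᵐ w ∂μ, p w) : ∃ w, w ∉ B ∧ p w := by
  by_contra! hn
  have h1 : {w | p w} ⊆ B := fun w hw => by
    by_contra hB
    exact hn w hB hw
  have h2 : (1 : ℝ≥0∞) = μ {w | p w} := by
    have : {w | p w} =ᵐ[μ] Set.univ := eventuallyEq_univ.2 h
    rw [measure_congr this, measure_univ]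
  exact absurd (h2.le.trans (measure_mono h1)) (not_le.2 hB)

/-- Markov's inequality for the average of a nonnegative function over the sample. -/
lemma measure_le_average_le [IsProbabilityMeasure μ] {O : ℕ → Ω → X} (hm : ∀ i, Measurable (O i))
    (hlaw : ∀ i, μ.map (O i) = P) {h : X → ℝ} (h0 : ∀ o, 0 ≤ h o) (hint : Integrable h P)
    {n : ℕ} (hn : 0 < n) {a : ℝ} (ha : 0 < a) :
    μ {w | n * a ≤ ∑ i ∈ Finset.range n, h (O i w)} ≤ ENNReal.ofReal ((∫ o, h o ∂P) / a) := by
  have hi : ∀ i, Integrable (fun w => h (O i w)) μ := fun i => by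
    have : Integrable h (μ.map (O i)) := by rwa [hlaw i]
    exact this.comp_measurable (hm i)
  have hI : ∀ i, ∫ w, h (O i w) ∂μ = ∫ o, h o ∂P := fun i => by
    rw [← hlaw i, integral_map (hm i).aemeasurable]
    rw [hlaw i]; exact hint.aestronglyMeasurable
  have key := mul_meas_ge_le_integral_of_nonneg (μ := μ)
    (f := fun w => ∑ i ∈ Finset.range n, h (O i w))
    (.of_forall fun w => Finset.sum_nonneg fun i _ => h0 _)
    (integrable_finsetSum _ fun i _ => hi i) (n * a)
  rw [integral_finsetSum _ fun i _ => hi i] at key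
  simp only [hI, Finset.sum_const, Finset.card_range, nsmul_eq_mul] at key
  have hn' : (0 : ℝ) < n := by exact_mod_cast hn
  rw [mul_assoc] at key
  have key' := le_of_mul_le_mul_left key hn'
  rw [← ofReal_measureReal]
  refine ENNReal.ofReal_le_ofReal ?_
  rw [le_div_iff₀ ha, mul_comm]
  exact key'

/-- The mean under `P` of an estimating function. -/
noncomputable def meanScore (P : Measure X) (f : X → V → E → ℝ) (θ : V) : E → ℝ :=
  fun i => ∫ o, f o θ i ∂P

/-- The increment of an estimating function from `θ₀` to `θ`, minus the mean at `θ`. -/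
noncomputable def fluct (P : Measure X) (f : X → V → E → ℝ) (θ₀ : V) (o : X) (θ : V) : E → ℝ :=
  f o θ - f o θ₀ - meanScore P f θ

variable [Fintype E] [NormedAddCommGroup V]

/-- An i.i.d. sample with law `P` and an estimating function `f`, continuous and integrable on the
compact set `Θ`, whose centered increments have sums of the order `1 + √n ‖θ - θ₀‖` in
probability, uniformly in `θ`. -/
structure UniformSample (μ : Measure Ω) (P : Measure X) (O : ℕ → Ω → X) (Θ : Set V) (θ₀ : V)
    (f : X → V → E → ℝ) : Prop where
  meas : ∀ i, Measurable (O i)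
  indep : iIndepFun O μ
  law : ∀ i, μ.map (O i) = P
  compact : IsCompact Θ
  interior : θ₀ ∈ interior Θ
  cont : ∀ᵐ o ∂P, ContinuousOn (f o) Θ
  integrable : ∀ θ ∈ Θ, ∀ i, Integrable (fun o => f o θ i) P
  uniform : ∀ ε : ℝ, 0 < ε → ∃ M : ℝ, 0 ≤ M ∧ ∀ᶠ n : ℕ in atTop,
    μ {w | ∃ θ ∈ Θ, M * (1 + √n * ‖θ - θ₀‖) <
      ‖∑ i ∈ Finset.range n, fluct P f θ₀ (O i w) θ‖} ≤ ENNReal.ofReal ε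

namespace UniformSample

variable {O : ℕ → Ω → X} {Θ : Set V} {θ₀ : V} {f : X → V → E → ℝ}

/-- The mean is a uniform limit of sample averages, hence continuous. -/
lemma continuousOn_meanScore [IsProbabilityMeasure μ] (h : UniformSample μ P O Θ θ₀ f) :
    ContinuousOn (meanScore P f) Θ := by
  refine continuousOn_of_uniform_approx_of_continuousOn fun u hu => ?_
  obtain ⟨η, hη, hηu⟩ := Metric.mem_uniformity_dist.1 hu
  obtain ⟨M, hM, hMn⟩ := h.uniform (1 / 2) (by norm_num)
  obtain ⟨R, hR⟩ := h.compact.isBounded.subset_closedBall θ₀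
  have hR0 : 0 ≤ R := by
    have := hR (interior_subset h.interior)
    simpa using this
  have hlim : Tendsto (fun n : ℕ => M * (((n : ℝ))⁻¹ + (√(n : ℝ))⁻¹ * R)) atTop (𝓝 0) := by
    have h1 : Tendsto (fun n : ℕ => ((n : ℝ))⁻¹) atTop (𝓝 0) := tendsto_inv_atTop_nhds_zero_nat
    have h2 : Tendsto (fun n : ℕ => (√(n : ℝ))⁻¹) atTop (𝓝 0) :=
      tendsto_inv_atTop_zero.comp (Real.tendsto_sqrt_atTop.comp tendsto_natCast_atTop_atTop)
    simpa using (h1.add (h2.mul_const R)).const_mul M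
  obtain ⟨n, hn, hlt, hn0⟩ :=
    (hMn.and ((hlim.eventually_lt_const hη).and (eventually_gt_atTop 0))).exists
  obtain ⟨w, hw, hcw⟩ := exists_notMem_of_measure_lt_one
    (hn.trans_lt (by rw [ENNReal.ofReal_lt_one]; norm_num)) (ae_forall_sample h.meas h.law h.cont)
  refine ⟨fun θ => (n : ℝ)⁻¹ • ∑ i ∈ Finset.range n, (f (O i w) θ - f (O i w) θ₀), ?_, ?_⟩
  · exact ContinuousOn.const_smul
      (continuousOn_finsetSum _ fun i _ => (hcw i).sub continuousOn_const) ((n : ℝ)⁻¹)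
  · intro θ hθ
    refine hηu ?_
    simp only [Set.mem_ofPred_eq, not_exists, not_and, not_lt] at hw
    have hn' : (0 : ℝ) < n := by exact_mod_cast hn0
    have hs : 0 < √(n : ℝ) := Real.sqrt_pos.2 hn'
    have h1 := hw θ hθ
    have h2 : (n : ℝ)⁻¹ • ∑ i ∈ Finset.range n, (f (O i w) θ - f (O i w) θ₀) - meanScore P f θ =
        (n : ℝ)⁻¹ • ∑ i ∈ Finset.range n, fluct P f θ₀ (O i w) θ := by
      simp only [fluct]
      rw [Finset.sum_sub_distrib _ (fun _ => meanScore P f θ), smul_sub, Finset.sum_const,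
        Finset.card_range, ← Nat.cast_smul_eq_nsmul ℝ, smul_smul, inv_mul_cancel₀ hn'.ne', one_smul]
    rw [dist_comm, dist_eq_norm, h2, norm_smul, norm_inv, Real.norm_natCast]
    refine lt_of_le_of_lt ?_ hlt
    have hd : ‖θ - θ₀‖ ≤ R := by simpa [dist_eq_norm] using hR hθ
    have hsq : (√(n : ℝ))⁻¹ = (n : ℝ)⁻¹ * √n := by
      rw [inv_eq_iff_eq_inv, mul_inv, inv_inv, ← div_eq_mul_inv, eq_div_iff hs.ne',
        Real.mul_self_sqrt hn'.le]
    calc (n : ℝ)⁻¹ * ‖∑ i ∈ Finset.range n, fluct P f θ₀ (O i w) θ‖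
        ≤ (n : ℝ)⁻¹ * (M * (1 + √n * R)) := by gcongr; exact h1.trans (by gcongr)
      _ = _ := by rw [hsq]; ring

lemma integrable_fluct [IsFiniteMeasure P] (h : UniformSample μ P O Θ θ₀ f) {θ : V} (hθ : θ ∈ Θ)
    (i : E) : Integrable (fun o => fluct P f θ₀ o θ i) P :=
  ((h.integrable θ hθ i).sub (h.integrable θ₀ (interior_subset h.interior) i)).sub
    (integrable_const _)

/-- The sums of squares of the fluctuations are bounded uniformly in the parameter. -/
lemma exists_sum_fluct_sq_bound [IsProbabilityMeasure μ] [IsProbabilityMeasure P]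
    [TopologicalSpace.SeparableSpace V]
    (h : UniformSample μ P O Θ θ₀ f) {ε : ℝ} (hε : 0 < ε) :
    ∃ M : ℝ, 0 ≤ M ∧ ∀ᶠ n : ℕ in atTop,
      μ {w | ∃ θ ∈ Θ, ∃ j, M * (1 + √n * ‖θ - θ₀‖) ^ 2 <
        ∑ i ∈ Finset.range n, fluct P f θ₀ (O i w) θ j ^ 2} ≤ ENNReal.ofReal ε := by
  -- a countable dense set makes the events measurable; continuity extends the bounds to `Θ`
  obtain ⟨Q, hQΘ, hQc, hQd⟩ :=
    (TopologicalSpace.IsSeparable.of_separableSpace Θ).exists_countable_dense_subset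
  set δ := ε / (Fintype.card E + 1) with hδ
  have hδ0 : 0 < δ := by positivity
  have hcoord : ∀ j : E, ∃ M : ℝ, 0 ≤ M ∧ ∀ᶠ n : ℕ in atTop,
      μ {w | ∃ q ∈ Q, M * (1 + √n * ‖q - θ₀‖) ^ 2 <
        ∑ i ∈ Finset.range n, fluct P f θ₀ (O i w) q j ^ 2} ≤ ENNReal.ofReal δ := fun j => by
    refine exists_sum_sq_bound h.meas h.indep h.law hQc
      (g := fun o θ => fluct P f θ₀ o θ j) (t := fun θ => ‖θ - θ₀‖)
      (fun q hq => (h.integrable_fluct (hQΘ hq) j).aestronglyMeasurable.aemeasurable)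
      (fun q => norm_nonneg _) (fun ε' hε' => ?_) hδ0
    obtain ⟨M, -, hM⟩ := h.uniform ε' hε'
    refine ⟨M, hM.mono fun n hn => (measure_mono ?_).trans hn⟩
    rintro w ⟨q, hq, hlt⟩
    refine ⟨q, hQΘ hq, hlt.trans_le ?_⟩
    have := norm_le_pi_norm (∑ i ∈ Finset.range n, fluct P f θ₀ (O i w) q) j
    rwa [Finset.sum_apply, Real.norm_eq_abs] at this
  choose M hM0 hM using hcoord
  refine ⟨∑ j, M j, Finset.sum_nonneg fun j _ => hM0 j, ?_⟩
  filter_upwards [eventually_all.2 hM] with n hn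
  have hae := ae_forall_sample h.meas h.law h.cont
  have hext : ∀ w, (∀ i, ContinuousOn (f (O i w)) Θ) → ∀ j,
      (∀ q ∈ Q, ∑ i ∈ Finset.range n, fluct P f θ₀ (O i w) q j ^ 2 ≤
        M j * (1 + √n * ‖q - θ₀‖) ^ 2) → ∀ θ ∈ Θ,
      ∑ i ∈ Finset.range n, fluct P f θ₀ (O i w) θ j ^ 2 ≤ M j * (1 + √n * ‖θ - θ₀‖) ^ 2 := by
    intro w hw j hq θ hθ
    have hc1 : ContinuousOn (fun θ => ∑ i ∈ Finset.range n, fluct P f θ₀ (O i w) θ j ^ 2) Θ := by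
      refine continuousOn_finsetSum _ fun i _ => ContinuousOn.pow ?_ 2
      exact continuousOn_pi.1 (((hw i).sub continuousOn_const).sub h.continuousOn_meanScore) j
    have hc2 : ContinuousOn (fun θ => M j * (1 + √n * ‖θ - θ₀‖) ^ 2) Θ := by fun_prop
    have : (𝓝[Q] θ).NeBot := mem_closure_iff_nhdsWithin_neBot.1 (hQd hθ)
    exact le_of_tendsto_of_tendsto ((hc1 θ hθ).mono_left (nhdsWithin_mono _ hQΘ))
      ((hc2 θ hθ).mono_left (nhdsWithin_mono _ hQΘ))
      (eventually_nhdsWithin_of_forall fun q hq' => hq q hq')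
  calc μ {w | ∃ θ ∈ Θ, ∃ j, (∑ j, M j) * (1 + √n * ‖θ - θ₀‖) ^ 2 <
        ∑ i ∈ Finset.range n, fluct P f θ₀ (O i w) θ j ^ 2}
      ≤ μ (⋃ j, {w | ∃ q ∈ Q, M j * (1 + √n * ‖q - θ₀‖) ^ 2 <
        ∑ i ∈ Finset.range n, fluct P f θ₀ (O i w) q j ^ 2}) := by
        refine measure_mono_ae ?_
        filter_upwards [hae] with w hw
        rintro ⟨θ, hθ, j, hlt⟩
        by_contra hn
        have hj := mt (fun hj => Set.mem_iUnion.2 ⟨j, hj⟩) hn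
        simp only [Set.mem_ofPred_eq, not_exists, not_and, not_lt] at hj
        refine absurd hlt (not_lt.2 ((hext w hw j hj θ hθ).trans ?_))
        gcongr
        exact Finset.single_le_sum (fun j _ => hM0 j) (Finset.mem_univ j)
    _ ≤ ∑ j, μ {w | ∃ q ∈ Q, M j * (1 + √n * ‖q - θ₀‖) ^ 2 <
        ∑ i ∈ Finset.range n, fluct P f θ₀ (O i w) q j ^ 2} := measure_iUnion_fintype_le _ _
    _ ≤ ∑ _j : E, ENNReal.ofReal δ := Finset.sum_le_sum fun j _ => hn j
    _ = ENNReal.ofReal (Fintype.card E * δ) := by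
        rw [Finset.sum_const, ← ENNReal.ofReal_nsmul]
        simp
    _ ≤ ENNReal.ofReal ε := by
        refine ENNReal.ofReal_le_ofReal ?_
        rw [hδ, mul_div_assoc', div_le_iff₀ (by positivity)]
        nlinarith

end UniformSample

end Fluctuation

/-! ### Differentiation of the mean -/

section Derivative

variable {Ω X : Type*} [MeasurableSpace Ω] {μ : Measure Ω} [MeasurableSpace X] {P : Measure X}

/-- The strong law of large numbers for a function that is integrable under the law of the
sample. -/
lemma ae_tendsto_average {O : ℕ → Ω → X} (hm : ∀ i, Measurable (O i)) (hind : iIndepFun O μ)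
    (hlaw : ∀ i, μ.map (O i) = P) {u : X → ℝ} (hu : Integrable u P) :
    ∀ᵐ w ∂μ, Tendsto (fun n : ℕ => (∑ i ∈ Finset.range n, u (O i w)) / n) atTop
      (𝓝 (∫ o, u o ∂P)) := by
  set v := hu.aestronglyMeasurable.mk u with hv
  have hvm : Measurable v := hu.aestronglyMeasurable.stronglyMeasurable_mk.measurable
  have huv : u =ᵐ[P] v := hu.aestronglyMeasurable.ae_eq_mk
  have hvint : Integrable v P := hu.congr huv
  have hmap : ∀ i, ∫ w, v (O i w) ∂μ = ∫ o, u o ∂P := fun i => by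
    rw [integral_congr_ae huv, ← hlaw i,
      integral_map (hm i).aemeasurable hvm.aestronglyMeasurable]
  have hident : ∀ i, IdentDistrib (O i) (O 0) μ μ := fun i =>
    ⟨(hm i).aemeasurable, (hm 0).aemeasurable, by rw [hlaw i, hlaw 0]⟩
  have hslln := strong_law_ae_real (μ := μ) (fun i w => v (O i w))
    (by
      have : Integrable v (μ.map (O 0)) := by rwa [hlaw 0]
      exact this.comp_measurable (hm 0))
    (fun i j hij => (hind.comp (fun _ => v) fun _ => hvm).indepFun hij)
    (fun i => (hident i).comp hvm)
  filter_upwards [hslln, ae_forall_sample hm hlaw huv] with w hw hw'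
  rw [hmap 0] at hw
  simpa only [hw'] using hw

/-- Truncation: if the `φ i` are small where `B i = 0` and dominated by `g i`, `t N i` and `Q` where
`B i = 1`, then bounds on the sums of `g` and `g²` bound `Q`. -/
lemma mul_abs_le_of_truncation {n : ℕ} {φ g N B : ℕ → ℝ} {t η κ τ Q M₁ M₂ : ℝ}
    (ht : 0 ≤ t) (hη : 0 ≤ η) (hN : ∀ i, 0 ≤ N i) (hB : ∀ i, B i = 0 ∨ B i = 1)
    (hφ : ∀ i, B i = 0 → |φ i| ≤ η * t) (hg : ∀ i, |φ i| ≤ |g i| + t * N i + |Q|)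
    (hsum : n * |Q| ≤ |∑ i ∈ Finset.range n, g i| + t * (n * τ) + ∑ i ∈ Finset.range n, |φ i|)
    (hκ : ∑ i ∈ Finset.range n, B i * (1 + N i) ≤ n * κ)
    (h1 : |∑ i ∈ Finset.range n, g i| ≤ M₁) (h2 : ∑ i ∈ Finset.range n, g i ^ 2 ≤ M₂) :
    n * |Q| ≤ M₁ + t * (n * τ) + n * (η * t) + √(n * κ) * √M₂ + t * (n * κ) + n * κ * |Q| := by
  have hB0 : ∀ i, 0 ≤ B i := fun i => by rcases hB i with h | h <;> simp [h]
  have hB2 : ∀ i, B i ^ 2 = B i := fun i => by rcases hB i with h | h <;> simp [h]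
  have hsB : ∑ i ∈ Finset.range n, B i ≤ n * κ :=
    (Finset.sum_le_sum fun i _ => le_mul_of_one_le_right (hB0 i) (by linarith [hN i])).trans hκ
  have hsN : ∑ i ∈ Finset.range n, B i * N i ≤ n * κ :=
    (Finset.sum_le_sum fun i _ => mul_le_mul_of_nonneg_left (by linarith) (hB0 i)).trans hκ
  have hφ' : ∀ i ∈ Finset.range n,
      |φ i| ≤ η * t + (B i * |g i| + t * (B i * N i) + B i * |Q|) := fun i _ => by
    rcases hB i with h | h
    · simpa [h] using hφ i h
    · have := hg i
      have : 0 ≤ η * t := by positivity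
      simp only [h]
      linarith
  have hcs : ∑ i ∈ Finset.range n, B i * |g i| ≤ √(n * κ) * √M₂ := by
    refine (Real.sum_mul_le_sqrt_mul_sqrt _ _ _).trans ?_
    simp only [hB2, sq_abs]
    gcongr
  have htot := Finset.sum_le_sum hφ'
  rw [Finset.sum_add_distrib, Finset.sum_add_distrib, Finset.sum_add_distrib, Finset.sum_const,
    ← Finset.mul_sum, ← Finset.sum_mul, Finset.card_range, nsmul_eq_mul] at htot
  have h3 : t * ∑ i ∈ Finset.range n, B i * N i ≤ t * (n * κ) := by gcongr
  have h4 : (∑ i ∈ Finset.range n, B i) * |Q| ≤ n * κ * |Q| := by gcongr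
  linarith

lemma le_of_truncation_bound {n t η κ q M₁ M₂ : ℝ} (hn : 0 < n) (ht : 0 < t)
    (hnt : 1 ≤ n * t ^ 2) (hη : 0 < η) (hκ : 0 < κ) (hκ1 : κ ≤ 1 / 2) (hκ2 : κ ≤ η)
    (hκ3 : 9 * M₂ * κ ≤ η ^ 2) (hM₁ : 3 * M₁ * t ≤ η) (hq : 0 ≤ q)
    (h : n * q ≤ 3 * M₁ + t * (n * η) + n * (η * t) + √(n * κ) * √(9 * M₂) + t * (n * κ) +
      n * κ * q) : q ≤ 10 * η * t := by
  have hsqrt : √(n * κ) * √(9 * M₂) ≤ n * (η * t) := by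
    rw [← Real.sqrt_mul (by positivity)]
    refine Real.sqrt_le_iff.2 ⟨by positivity, ?_⟩
    calc n * κ * (9 * M₂) = n * (9 * M₂ * κ) := by ring
      _ ≤ n * η ^ 2 := by gcongr
      _ = n * η ^ 2 * 1 := by ring
      _ ≤ n * η ^ 2 * (n * t ^ 2) := by gcongr
      _ = _ := by ring
  have h3M : 3 * M₁ ≤ n * (η * t) := by
    rcases le_or_gt M₁ 0 with h0 | h0
    · have : 0 ≤ n * (η * t) := by positivity
      linarith
    · calc 3 * M₁ = 3 * M₁ * 1 := by ring
        _ ≤ 3 * M₁ * (n * t ^ 2) := by gcongr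
        _ = (3 * M₁ * t) * (n * t) := by ring
        _ ≤ η * (n * t) := by gcongr
        _ = _ := by ring
  have hκt : t * (n * κ) ≤ t * (n * η) := by gcongr
  have hκq : n * κ * q ≤ n * (1 / 2) * q := by gcongr
  have hfin : n * (q / 2) ≤ n * (5 * η * t) := by linarith
  have := le_of_mul_le_mul_left hfin hn
  linarith

variable {E ι : Type*} [Fintype E] [Fintype ι] {O : ℕ → Ω → X} {Θ : Set (EuclideanSpace ℝ ι)}
  {θ₀ : EuclideanSpace ℝ ι} {f : X → EuclideanSpace ℝ ι → E → ℝ}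

lemma abs_dotProduct_le (x : ι → ℝ) (v : EuclideanSpace ℝ ι) :
    |x ⬝ᵥ v.ofLp| ≤ ‖v‖ * ∑ b, |x b| := by
  rw [dotProduct, Finset.mul_sum]
  refine (Finset.abs_sum_le_sum_abs _ _).trans (Finset.sum_le_sum fun b _ => ?_)
  rw [abs_mul, mul_comm]
  gcongr
  simpa using PiLp.norm_apply_le v b

set_option maxHeartbeats 800000 in
/-- **Differentiation of the mean.** The uniform bound on the fluctuations at distance
`t = ‖θ - θ₀‖` and for `n ≈ t⁻²` makes the difference quotients of the estimating function uniformly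
integrable, so that the mean can be differentiated at `θ₀` under the integral sign. -/
theorem UniformSample.isLittleO_meanScore [IsProbabilityMeasure μ] [IsProbabilityMeasure P]
    (h : UniformSample μ P O Θ θ₀ f) (hzero : meanScore P f θ₀ = 0) {J : X → Matrix E ι ℝ}
    (hJint : ∀ j b, Integrable (fun o => J o j b) P)
    (hJ : ∀ᵐ o ∂P, (fun θ => f o θ - f o θ₀ - J o *ᵥ (θ - θ₀).ofLp) =o[𝓝 θ₀] fun θ => θ - θ₀) :
    (fun θ => meanScore P f θ - (Matrix.of fun j b => ∫ o, J o j b ∂P) *ᵥ (θ - θ₀).ofLp)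
      =o[𝓝 θ₀] fun θ => θ - θ₀ := by
  rw [Asymptotics.isLittleO_pi]
  intro j
  set G : ι → ℝ := fun b => ∫ o, J o j b ∂P with hG
  -- the remainder of `f` and its mean
  set φ : EuclideanSpace ℝ ι → X → ℝ := fun θ o =>
    f o θ j - f o θ₀ j - J o j ⬝ᵥ (θ - θ₀).ofLp with hφ
  set Q : EuclideanSpace ℝ ι → ℝ := fun θ => meanScore P f θ j - G ⬝ᵥ (θ - θ₀).ofLp with hQ
  change Q =o[𝓝 θ₀] fun θ => θ - θ₀
  have hJj : ∀ᵐ o ∂P, (fun θ => φ θ o) =o[𝓝 θ₀] fun θ => θ - θ₀ := by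
    filter_upwards [hJ] with o ho using (Asymptotics.isLittleO_pi.1 ho) j
  set N : X → ℝ := fun o => ∑ b, |J o j b - G b| with hN
  have hN0 : ∀ o, 0 ≤ N o := fun o => Finset.sum_nonneg fun b _ => abs_nonneg _
  have hNint : Integrable N P :=
    integrable_finsetSum _ fun b _ => ((hJint j b).sub (integrable_const _)).abs
  have hΘ : Θ ∈ 𝓝 θ₀ := mem_interior_iff_mem_nhds.1 h.interior
  have hφm : ∀ θ ∈ Θ, AEStronglyMeasurable (φ θ) P := fun θ hθ => by
    refine (((h.integrable θ hθ j).sub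
      (h.integrable θ₀ (interior_subset h.interior) j)).sub ?_).aestronglyMeasurable
    exact integrable_finsetSum _ fun b _ => (hJint j b).mul_const _
  obtain ⟨M₁, hM₁, hE₁⟩ := h.uniform (1 / 8) (by norm_num)
  obtain ⟨M₂, hM₂, hE₂⟩ := h.exists_sum_fluct_sq_bound (ε := 1 / 8) (by norm_num)
  rw [Asymptotics.isLittleO_iff]
  intro c hc
  set η := c / 10 with hη
  have hη0 : 0 < η := by positivity
  set κ := min (1 / 2) (min η (η ^ 2 / (9 * M₂ + 1))) with hκdef
  have hκ0 : 0 < κ := by positivity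
  have hκ1 : κ ≤ 1 / 2 := min_le_left _ _
  have hκ2 : κ ≤ η := (min_le_right _ _).trans (min_le_left _ _)
  have hκ3 : 9 * M₂ * κ ≤ η ^ 2 := by
    have h1 : κ ≤ η ^ 2 / (9 * M₂ + 1) := (min_le_right _ _).trans (min_le_right _ _)
    rw [le_div_iff₀ (by positivity)] at h1
    nlinarith
  -- the mean of the part of `1 + N` where the remainder is not small tends to zero
  set s : EuclideanSpace ℝ ι → Set X := fun θ => {o | η * ‖θ - θ₀‖ < |φ θ o|} with hs
  set H : EuclideanSpace ℝ ι → X → ℝ := fun θ => (s θ).indicator fun o => 1 + N o with hH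
  have hint1 : Integrable (fun o => 1 + N o) P := (integrable_const _).add hNint
  have hsm : ∀ θ ∈ Θ, NullMeasurableSet (s θ) P := fun θ hθ =>
    nullMeasurableSet_lt aemeasurable_const (by
      simpa [Real.norm_eq_abs] using (hφm θ hθ).aemeasurable.norm)
  have hHint : ∀ θ ∈ Θ, Integrable (H θ) P := fun θ hθ => by
    refine hint1.mono (hint1.aestronglyMeasurable.indicator₀ (hsm θ hθ)) (.of_forall fun o => ?_)
    exact norm_indicator_le_norm_self _ _
  have hH0 : Tendsto (fun θ => ∫ o, H θ o ∂P) (𝓝 θ₀) (𝓝 0) := by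
    have h0 : (0 : ℝ) = ∫ _o : X, (0 : ℝ) ∂P := by simp
    rw [h0]
    refine tendsto_integral_filter_of_dominated_convergence (fun o => 1 + N o) ?_ ?_ hint1 ?_
    · filter_upwards [hΘ] with θ hθ using (hHint θ hθ).aestronglyMeasurable
    · refine .of_forall fun θ => .of_forall fun o => ?_
      refine (norm_indicator_le_norm_self _ _).trans ?_
      rw [Real.norm_of_nonneg (by linarith [hN0 o])]
    · filter_upwards [hJj] with o ho
      refine tendsto_const_nhds.congr' ?_
      filter_upwards [(Asymptotics.isLittleO_iff.1 ho) hη0] with θ hθ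
      refine (Set.indicator_of_notMem ?_ _).symm
      simpa [hs] using hθ
  -- a sample size of the order `t⁻²`, at which the two terms of `1 + √n t` are comparable
  set nn : EuclideanSpace ℝ ι → ℕ := fun θ => ⌈(‖θ - θ₀‖ ^ 2)⁻¹⌉₊ with hnn
  have hd : Tendsto (fun θ => ‖θ - θ₀‖) (𝓝[≠] θ₀) (𝓝[>] 0) := by
    refine tendsto_nhdsWithin_iff.2 ⟨?_, ?_⟩
    · have : Tendsto (fun θ : EuclideanSpace ℝ ι => ‖θ - θ₀‖) (𝓝 θ₀) (𝓝 ‖θ₀ - θ₀‖) :=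
        (continuous_id.sub continuous_const).norm.tendsto _
      rw [sub_self, norm_zero] at this
      exact this.mono_left nhdsWithin_le_nhds
    · filter_upwards [self_mem_nhdsWithin] with θ hθ
      exact norm_pos_iff.2 (sub_ne_zero.2 hθ)
  have hnnlim : Tendsto nn (𝓝[≠] θ₀) atTop := by
    refine tendsto_nat_ceil_atTop.comp (tendsto_inv_nhdsGT_zero.comp ?_)
    refine tendsto_nhdsWithin_iff.2 ⟨?_, ?_⟩
    · simpa using ((tendsto_nhdsWithin_iff.1 hd).1.pow 2)
    · filter_upwards [self_mem_nhdsWithin] with θ hθ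
      have : 0 < ‖θ - θ₀‖ := norm_pos_iff.2 (sub_ne_zero.2 hθ)
      exact pow_pos this 2
  -- law of large numbers for the derivative
  have hA : Tendsto (fun n : ℕ => μ {w | η ≤
      ∑ b, |(∑ i ∈ Finset.range n, J (O i w) j b) / n - G b|}) atTop (𝓝 0) := by
    have hae : ∀ᵐ w ∂μ, Tendsto (fun n : ℕ =>
        ∑ b, |(∑ i ∈ Finset.range n, J (O i w) j b) / n - G b|) atTop (𝓝 0) := by
      filter_upwards [ae_all_iff.2 fun b => ae_tendsto_average h.meas h.indep h.law (hJint j b)]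
        with w hw
      have : Tendsto (fun n : ℕ => ∑ b, |(∑ i ∈ Finset.range n, J (O i w) j b) / n - G b|) atTop
          (𝓝 (∑ b : ι, |G b - G b|)) :=
        tendsto_finsetSum _ fun b _ => ((hw b).sub_const _).abs
      simpa using this
    have hmeas : ∀ n : ℕ, AEStronglyMeasurable (fun w =>
        ∑ b, |(∑ i ∈ Finset.range n, J (O i w) j b) / n - G b|) μ := fun n => by
      have hJm : ∀ i b, AEMeasurable (fun w => J (O i w) j b) μ := fun i b => by
        have : AEMeasurable (fun o => J o j b) (μ.map (O i)) := by
          rw [h.law i]; exact (hJint j b).aestronglyMeasurable.aemeasurable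
        exact this.comp_measurable (h.meas i)
      have : AEMeasurable (fun w =>
          ∑ b, |(∑ i ∈ Finset.range n, J (O i w) j b) / n - G b|) μ := by
        refine Finset.aemeasurable_fun_sum _ fun b _ => ?_
        exact (((Finset.aemeasurable_fun_sum _ fun i _ => hJm i b).div_const _).sub_const _).abs
      exact this.aestronglyMeasurable
    have := (tendstoInMeasure_of_tendsto_ae hmeas hae) (ENNReal.ofReal η) (by simpa using hη0)
    refine this.congr fun n => ?_
    congr 1
    ext w
    have h0 : 0 ≤ ∑ b, |(∑ i ∈ Finset.range n, J (O i w) j b) / n - G b| :=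
      Finset.sum_nonneg fun b _ => abs_nonneg _
    simp [edist_dist, ENNReal.ofReal_le_ofReal_iff, abs_of_nonneg h0]
  -- the bound on `Q` away from `θ₀`
  have key : ∀ᶠ θ in 𝓝[≠] θ₀, ‖Q θ‖ ≤ c * ‖θ - θ₀‖ := by
    have hH0' : ∀ᶠ θ in 𝓝[≠] θ₀, ∫ o, H θ o ∂P < κ / 8 :=
      (hH0.mono_left nhdsWithin_le_nhds).eventually_lt_const (by positivity)
    have hd0 := (tendsto_nhdsWithin_iff.1 hd).1
    have hsmall : ∀ᶠ θ in 𝓝[≠] θ₀, ‖θ - θ₀‖ < min 1 (η / (3 * M₁ + 1)) :=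
      hd0.eventually_lt_const (by positivity)
    have h18 : (0 : ℝ≥0∞) < ENNReal.ofReal (1 / 8) := by simp
    filter_upwards [hH0', hsmall, hnnlim.eventually hE₁, hnnlim.eventually hE₂,
      hnnlim.eventually (hA.eventually_lt_const h18), self_mem_nhdsWithin,
      nhdsWithin_le_nhds hΘ] with θ hHθ hsm hE₁ hE₂ hA hne hθΘ
    set t := ‖θ - θ₀‖ with ht
    have ht0 : 0 < t := norm_pos_iff.2 (sub_ne_zero.2 hne)
    have ht1 : t ≤ 1 := (hsm.trans_le (min_le_left _ _)).le
    have ht3 : 3 * M₁ * t ≤ η := by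
      have h1 : t ≤ η / (3 * M₁ + 1) := (hsm.trans_le (min_le_right _ _)).le
      rw [le_div_iff₀ (by positivity)] at h1
      nlinarith
    set n := nn θ with hn
    have hn1 : 1 ≤ (n : ℝ) * t ^ 2 := by
      have : (t ^ 2)⁻¹ ≤ (n : ℝ) := Nat.le_ceil _
      rwa [inv_le_iff_one_le_mul₀ (by positivity)] at this
    have hn0' : (0 : ℝ) < n := by
      by_contra hcon
      nlinarith [sq_nonneg t]
    have hn0 : 0 < n := by exact_mod_cast hn0'
    have hn2 : (n : ℝ) * t ^ 2 ≤ 2 := by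
      have h1 : (n : ℝ) < (t ^ 2)⁻¹ + 1 := Nat.ceil_lt_add_one (by positivity)
      have h2 : (n : ℝ) * t ^ 2 ≤ ((t ^ 2)⁻¹ + 1) * t ^ 2 := by gcongr
      rw [add_mul, inv_mul_cancel₀ (by positivity)] at h2
      nlinarith
    have hst : √(n : ℝ) * t ≤ 2 := by
      refine le_of_sq_le_sq ?_ (by norm_num)
      rw [mul_pow, Real.sq_sqrt hn0'.le]
      linarith
    -- a sample point outside the exceptional events
    have hE₃ := measure_le_average_le h.meas h.law
      (h := H θ) (fun o => Set.indicator_nonneg (fun o _ => by linarith [hN0 o]) o)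
      (hHint θ hθΘ) hn0 hκ0
    have hE₃' : ENNReal.ofReal ((∫ o, H θ o ∂P) / κ) ≤ ENNReal.ofReal (1 / 8) := by
      refine ENNReal.ofReal_le_ofReal ?_
      rw [div_le_iff₀ hκ0]; linarith
    have hbad := (measure_union_le (μ := μ) _ _).trans (add_le_add
      ((measure_union_le _ _).trans (add_le_add hE₁ hE₂))
      ((measure_union_le _ _).trans (add_le_add (hE₃.trans hE₃') hA.le)))
    rw [← ENNReal.ofReal_add (by norm_num) (by norm_num),
      ← ENNReal.ofReal_add (by norm_num) (by norm_num)] at hbad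
    obtain ⟨w, hw, -⟩ := exists_notMem_of_measure_lt_one (p := fun _ => True)
      (hbad.trans_lt (by rw [ENNReal.ofReal_lt_one]; norm_num)) (by simp)
    simp only [Set.mem_union, not_or, Set.mem_ofPred_eq, not_exists, not_and, not_lt, not_le] at hw
    obtain ⟨⟨hw₁, hw₂⟩, hw₃, hw₄⟩ := hw
    set g : ℕ → ℝ := fun i => fluct P f θ₀ (O i w) θ j with hg
    have hgsum : |∑ i ∈ Finset.range n, g i| ≤ 3 * M₁ := by
      have h1 := (norm_le_pi_norm (∑ i ∈ Finset.range n, fluct P f θ₀ (O i w) θ) j).trans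
        (hw₁ θ hθΘ)
      rw [Finset.sum_apply, Real.norm_eq_abs] at h1
      refine h1.trans ?_
      rw [mul_comm]
      gcongr
      linarith
    have hgsq : ∑ i ∈ Finset.range n, g i ^ 2 ≤ 9 * M₂ := by
      refine (hw₂ θ hθΘ j).trans ?_
      have h0 : 0 ≤ √(n : ℝ) * t := by positivity
      have : (1 + √(n : ℝ) * t) ^ 2 ≤ 9 := by nlinarith
      nlinarith
    have hdecomp : ∀ i, g i = φ θ (O i w) + (J (O i w) j - G) ⬝ᵥ (θ - θ₀).ofLp - Q θ := fun i => by
      simp only [hg, fluct, hφ, hQ, Pi.sub_apply, sub_dotProduct]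
      ring
    classical
    have hmain := mul_abs_le_of_truncation (n := n) (φ := fun i => φ θ (O i w)) (g := g)
      (N := fun i => N (O i w)) (B := fun i => if O i w ∈ s θ then 1 else 0) (t := t) (η := η)
      (κ := κ) (τ := η) (Q := Q θ) (M₁ := 3 * M₁) (M₂ := 9 * M₂) ht0.le hη0.le
      (fun i => hN0 _) (fun i => by split_ifs <;> simp)
      (fun i hi => by
        by_contra hcon
        have : O i w ∈ s θ := not_le.1 hcon
        simp [this] at hi)
      (fun i => by
        have h1 : φ θ (O i w) = g i - (J (O i w) j - G) ⬝ᵥ (θ - θ₀).ofLp + Q θ := by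
          rw [hdecomp i]; ring
        have h2 := abs_dotProduct_le (J (O i w) j - G) (θ - θ₀)
        rw [h1]
        refine (abs_add_le _ _).trans ?_
        gcongr
        refine (abs_sub _ _).trans ?_
        gcongr
        simpa [hN] using h2)
      (by
        have h1 : n * Q θ = -(∑ i ∈ Finset.range n, g i) +
            (∑ i ∈ Finset.range n, (J (O i w) j - G)) ⬝ᵥ (θ - θ₀).ofLp +
            ∑ i ∈ Finset.range n, φ θ (O i w) := by
          rw [sum_dotProduct]
          simp only [hdecomp, Finset.sum_sub_distrib, Finset.sum_add_distrib, Finset.sum_const,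
            Finset.card_range, nsmul_eq_mul]
          ring
        have h2 : |(∑ i ∈ Finset.range n, (J (O i w) j - G)) ⬝ᵥ (θ - θ₀).ofLp| ≤ t * (n * η) := by
          refine (abs_dotProduct_le _ _).trans ?_
          refine mul_le_mul_of_nonneg_left ?_ ht0.le
          rw [← div_le_iff₀' hn0', Finset.sum_div]
          refine le_trans (le_of_eq ?_) hw₄.le
          refine Finset.sum_congr rfl fun b _ => ?_
          rw [← abs_of_pos hn0', ← abs_div, abs_of_pos hn0', Finset.sum_apply]
          congr 1
          simp only [Pi.sub_apply, Finset.sum_sub_distrib, Finset.sum_const, Finset.card_range,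
            nsmul_eq_mul]
          field_simp
        have h3 := Finset.abs_sum_le_sum_abs (fun i => φ θ (O i w)) (Finset.range n)
        rw [← abs_of_pos hn0', ← abs_mul, abs_of_pos hn0', h1]
        refine (abs_add_le _ _).trans (add_le_add ((abs_add_le _ _).trans ?_) h3)
        rw [abs_neg]
        gcongr)
      (by
        refine le_trans (le_of_eq ?_) hw₃.le
        refine Finset.sum_congr rfl fun i _ => ?_
        by_cases hi : O i w ∈ s θ <;> simp [hH, hi])
      hgsum hgsq
    have hfin := le_of_truncation_bound hn0' ht0 hn1 hη0 hκ0 hκ1 hκ2 hκ3 ht3 (abs_nonneg (Q θ))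
      hmain
    rw [Real.norm_eq_abs]
    have hc10 : c = 10 * η := by rw [hη]; ring
    rw [hc10]
    exact hfin
  rw [eventually_nhdsWithin_iff] at key
  filter_upwards [key] with θ hθ
  by_cases hθ0 : θ = θ₀
  · subst hθ0
    simp [hQ, hzero]
  · exact hθ hθ0

end Derivative

/-! ### Limit theorems for sample averages -/

section Limits

variable {Ω X : Type*} [MeasurableSpace Ω] {μ : Measure Ω} [MeasurableSpace X] {P : Measure X}
  {O : ℕ → Ω → X}

lemma aemeasurable_comp_sample (hm : ∀ i, Measurable (O i)) (hlaw : ∀ i, μ.map (O i) = P)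
    {β : Type*} [MeasurableSpace β] {u : X → β} (hu : AEMeasurable u P) (i : ℕ) :
    AEMeasurable (fun w => u (O i w)) μ := by
  have : AEMeasurable u (μ.map (O i)) := by rwa [hlaw i]
  exact this.comp_measurable (hm i)

lemma memLp_comp_sample (hm : ∀ i, Measurable (O i)) (hlaw : ∀ i, μ.map (O i) = P)
    {F : Type*} [NormedAddCommGroup F] {p : ℝ≥0∞} {u : X → F} (hu : MemLp u p P) (i : ℕ) :
    MemLp (fun w => u (O i w)) p μ := by
  have : MemLp u p (μ.map (O i)) := by rwa [hlaw i]
  exact this.comp_of_map (hm i).aemeasurable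

lemma integral_comp_sample (hm : ∀ i, Measurable (O i)) (hlaw : ∀ i, μ.map (O i) = P)
    {u : X → ℝ} (hu : AEStronglyMeasurable u P) (i : ℕ) :
    ∫ w, u (O i w) ∂μ = ∫ o, u o ∂P := by
  rw [← hlaw i, integral_map (hm i).aemeasurable]
  rwa [hlaw i]

lemma iIndepFun_comp_sample (hm : ∀ i, Measurable (O i)) (hind : iIndepFun O μ)
    (hlaw : ∀ i, μ.map (O i) = P) {β : Type*} [MeasurableSpace β] {u : X → β}
    (hu : AEMeasurable u P) : iIndepFun (fun i w => u (O i w)) μ :=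
  hind.comp₀ (fun _ => u) (fun i => (hm i).aemeasurable) fun i => by rwa [hlaw i]

lemma identDistrib_comp_sample (hm : ∀ i, Measurable (O i)) (hlaw : ∀ i, μ.map (O i) = P)
    {β : Type*} [MeasurableSpace β] {u : X → β} (hu : AEMeasurable u P) (i : ℕ) :
    IdentDistrib (fun w => u (O i w)) (fun w => u (O 0 w)) μ μ := by
  have h : IdentDistrib (O i) (O 0) μ μ :=
    ⟨(hm i).aemeasurable, (hm 0).aemeasurable, by rw [hlaw i, hlaw 0]⟩
  exact h.comp_of_aemeasurable (by rwa [hlaw i])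

/-- The multivariate central limit theorem for centered square integrable vectors. -/
theorem tendstoInDistribution_inv_sqrt_smul_sum [IsProbabilityMeasure μ]
    (hm : ∀ i, Measurable (O i)) (hind : iIndepFun O μ) (hlaw : ∀ i, μ.map (O i) = P)
    {ι : Type*} [Fintype ι] [DecidableEq ι] {Y : X → EuclideanSpace ℝ ι} (hY : MemLp Y 2 P)
    (hY0 : ∀ a, ∫ o, Y o a ∂P = 0) {S : Matrix ι ι ℝ} (hS : S.PosSemidef)
    (hcov : ∀ a b, ∫ o, Y o a * Y o b ∂P = S a b) :
    TendstoInDistribution (fun (n : ℕ) w => (√n)⁻¹ • ∑ i ∈ Finset.range n, Y (O i w)) atTop id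
      (fun _ => μ) (multivariateGaussian 0 S) := by
  have hYa : ∀ a, MemLp (fun o => Y o a) 2 P := fun a => hY.eval_piLp a
  have hSm : ∀ n : ℕ, AEMeasurable
      (fun w => (√(n : ℝ))⁻¹ • ∑ i ∈ Finset.range n, Y (O i w)) μ := fun n =>
    (Finset.aemeasurable_fun_sum (Finset.range n) fun i _ =>
      aemeasurable_comp_sample hm hlaw hY.aestronglyMeasurable.aemeasurable i).const_smul (√(n : ℝ))⁻¹
  refine ⟨hSm, aemeasurable_id, ProbabilityMeasure.tendsto_iff_tendsto_charFun.2 fun t => ?_⟩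
  -- the one-dimensional projection on `t`
  set u : X → ℝ := fun o => Y o ⬝ᵥ t.ofLp with hu
  have hu2 : MemLp u 2 P := memLp_finsetSum _ fun a _ => (hYa a).mul_const (t a)
  have hP : IsProbabilityMeasure P := by
    rw [← hlaw 0]; exact Measure.isProbabilityMeasure_map (hm 0).aemeasurable
  have hu0 : ∫ o, u o ∂P = 0 := by
    have : ∀ a, Integrable (fun o => Y o a * t a) P := fun a =>
      ((hYa a).integrable (by norm_num)).mul_const _
    simp only [hu, dotProduct]
    rw [integral_finsetSum _ fun a _ => this a]
    simp [integral_mul_const, hY0]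
  have hvar : ∫ o, u o ^ 2 ∂P = t.ofLp ⬝ᵥ S *ᵥ t.ofLp := by
    have hint : ∀ a b, Integrable (fun o => t a * (Y o a * Y o b * t b)) P := fun a b =>
      (((hYa a).integrable_mul (hYa b)).mul_const _).const_mul _
    have h1 : ∀ o, u o ^ 2 = ∑ a, ∑ b, t a * (Y o a * Y o b * t b) := fun o => by
      simp only [hu, dotProduct, sq, Finset.sum_mul_sum]
      refine Finset.sum_congr rfl fun a _ => Finset.sum_congr rfl fun b _ => ?_
      ring
    simp only [h1]
    rw [integral_finsetSum _ fun a _ => integrable_finsetSum _ fun b _ => hint a b]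
    simp only [dotProduct, Matrix.mulVec, Finset.mul_sum]
    refine Finset.sum_congr rfl fun a _ => ?_
    rw [integral_finsetSum _ fun b _ => hint a b]
    refine Finset.sum_congr rfl fun b _ => ?_
    rw [integral_const_mul, integral_mul_const, hcov]
  have hum := hu2.aestronglyMeasurable
  have hV : Var[fun w => u (O 0 w); μ] = t.ofLp ⬝ᵥ S *ᵥ t.ofLp := by
    rw [variance_of_integral_eq_zero (aemeasurable_comp_sample hm hlaw hum.aemeasurable 0)
      (by rw [integral_comp_sample hm hlaw hum, hu0])]
    rw [← hvar]
    exact integral_comp_sample hm hlaw (u := fun o => u o ^ 2) (hum.pow 2) 0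
  have hclt := tendstoInDistribution_inv_sqrt_mul_sum_sub (P := μ)
    (X := fun i w => u (O i w)) (Y := id)
    (P' := gaussianReal 0 (Var[fun w => u (O 0 w); μ]).toNNReal)
    ⟨aemeasurable_id, Measure.map_id⟩ (memLp_comp_sample hm hlaw hu2 0)
    (iIndepFun_comp_sample hm hind hlaw hum.aemeasurable)
    (fun i => identDistrib_comp_sample hm hlaw hum.aemeasurable i)
  have h1 := ProbabilityMeasure.tendsto_iff_tendsto_charFun.1 hclt.tendsto 1
  have hlim : charFun ((gaussianReal 0 (Var[fun w => u (O 0 w); μ]).toNNReal).map id) 1 =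
      charFun ((multivariateGaussian 0 S).map id) t := by
    rw [Measure.map_id, Measure.map_id, charFun_gaussianReal, charFun_multivariateGaussian hS, hV]
    have : 0 ≤ t.ofLp ⬝ᵥ S *ᵥ t.ofLp := by simpa using hS.dotProduct_mulVec_nonneg t.ofLp
    simp [Real.coe_toNNReal _ this]
  change Tendsto _ _ (𝓝 (charFun ((multivariateGaussian 0 S).map id) t))
  rw [← hlim]
  refine h1.congr fun n => ?_
  change charFun (μ.map _) 1 = charFun (μ.map _) t
  have hint0 : ∫ w, u (O 0 w) ∂μ = 0 := by rw [integral_comp_sample hm hlaw hum, hu0]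
  rw [charFun_apply, charFun_apply, integral_map (hclt.forall_aemeasurable n) (by fun_prop),
    integral_map (hSm n) (by fun_prop)]
  congr 1
  ext w
  congr 3
  rw [hint0, mul_zero, sub_zero, inner_smul_left, sum_inner]
  simp [hu, PiLp.inner_apply, dotProduct, mul_comm]

/-- Normalized sums of centered square integrable vectors are bounded in probability. -/
lemma exists_norm_sum_bound [IsProbabilityMeasure μ]
    (hm : ∀ i, Measurable (O i)) (hind : iIndepFun O μ) (hlaw : ∀ i, μ.map (O i) = P)
    {E : Type*} [Fintype E] {u : X → E → ℝ} (hu : ∀ j, MemLp (fun o => u o j) 2 P)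
    (hu0 : ∀ j, ∫ o, u o j ∂P = 0) {ε : ℝ} (hε : 0 < ε) :
    ∃ M : ℝ, 0 ≤ M ∧ ∀ n : ℕ,
      μ {w | M * √n < ‖∑ i ∈ Finset.range n, u (O i w)‖} ≤ ENNReal.ofReal ε := by
  set δ := ε / (Fintype.card E + 1) with hδ
  have hδ0 : 0 < δ := by positivity
  set V := ∑ j, ∫ o, u o j ^ 2 ∂P with hVdef
  have hV0 : 0 ≤ V := Finset.sum_nonneg fun j _ => integral_nonneg fun o => sq_nonneg _
  set M := √((V + 1) / δ) with hM
  have hM0 : 0 < M := Real.sqrt_pos.2 (by positivity)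
  refine ⟨M, hM0.le, fun n => ?_⟩
  rcases Nat.eq_zero_or_pos n with rfl | hn
  · simp
  have hn' : (0 : ℝ) < n := by exact_mod_cast hn
  have hj : ∀ j, μ {w | M * √n ≤ |∑ i ∈ Finset.range n, u (O i w) j|} ≤ ENNReal.ofReal δ := by
    intro j
    have hmem : ∀ i, MemLp (fun w => u (O i w) j) 2 μ := fun i =>
      memLp_comp_sample hm hlaw (hu j) i
    have hsum : MemLp (fun w => ∑ i ∈ Finset.range n, u (O i w) j) 2 μ :=
      memLp_finsetSum _ fun i _ => hmem i
    have hum := (hu j).aestronglyMeasurable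
    have hmean : ∀ i, ∫ w, u (O i w) j ∂μ = 0 := fun i => by
      rw [integral_comp_sample hm hlaw hum, hu0]
    have hmean' : ∫ w, ∑ i ∈ Finset.range n, u (O i w) j ∂μ = 0 := by
      rw [integral_finsetSum _ fun i _ => (hmem i).integrable (by norm_num)]
      simp [hmean]
    have hvar : Var[fun w => ∑ i ∈ Finset.range n, u (O i w) j; μ] =
        n * ∫ o, u o j ^ 2 ∂P := by
      have h1 := IndepFun.variance_sum (μ := μ) (X := fun i w => u (O i w) j)
        (s := Finset.range n) (fun i _ => hmem i) fun i _ k _ hik =>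
          (iIndepFun_comp_sample hm hind hlaw hum.aemeasurable).indepFun hik
      have h2 : (∑ i ∈ Finset.range n, fun w => u (O i w) j) =
          fun w => ∑ i ∈ Finset.range n, u (O i w) j := by ext w; simp
      rw [h2] at h1
      rw [h1]
      have h3 : ∀ i ∈ Finset.range n, Var[fun w => u (O i w) j; μ] = ∫ o, u o j ^ 2 ∂P :=
        fun i _ => by
          rw [variance_of_integral_eq_zero (hmem i).aestronglyMeasurable.aemeasurable (hmean i)]
          exact integral_comp_sample hm hlaw (u := fun o => u o j ^ 2) (hum.pow 2) i
      rw [Finset.sum_congr rfl h3]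
      simp
    have hch := meas_ge_le_variance_div_sq hsum (c := M * √n) (by positivity)
    rw [hmean', hvar] at hch
    simp only [sub_zero] at hch
    refine hch.trans (ENNReal.ofReal_le_ofReal ?_)
    rw [mul_pow, Real.sq_sqrt hn'.le, hM, Real.sq_sqrt (by positivity), div_le_iff₀ (by positivity)]
    have : ∫ o, u o j ^ 2 ∂P ≤ V := Finset.single_le_sum
      (f := fun j => ∫ o, u o j ^ 2 ∂P) (fun j _ => integral_nonneg fun o => sq_nonneg _)
      (Finset.mem_univ j)
    calc n * ∫ o, u o j ^ 2 ∂P ≤ n * (V + 1) := by gcongr; linarith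
      _ = δ * ((V + 1) / δ * n) := by field_simp
  calc μ {w | M * √n < ‖∑ i ∈ Finset.range n, u (O i w)‖}
      ≤ μ (⋃ j, {w | M * √n ≤ |∑ i ∈ Finset.range n, u (O i w) j|}) := by
        refine measure_mono fun w hw => ?_
        by_contra hcon
        simp only [Set.mem_iUnion, Set.mem_ofPred_eq, not_exists, not_le] at hcon
        refine absurd hw (not_lt.2 ((pi_norm_le_iff_of_nonneg (by positivity)).2 fun j => ?_))
        rw [Finset.sum_apply, Real.norm_eq_abs]
        exact (hcon j).le
    _ ≤ ∑ j, μ {w | M * √n ≤ |∑ i ∈ Finset.range n, u (O i w) j|} := measure_iUnion_fintype_le _ _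
    _ ≤ ∑ _j : E, ENNReal.ofReal δ := Finset.sum_le_sum fun j _ => hj j
    _ = ENNReal.ofReal (Fintype.card E * δ) := by
        rw [Finset.sum_const, ← ENNReal.ofReal_nsmul]
        simp
    _ ≤ ENNReal.ofReal ε := by
        refine ENNReal.ofReal_le_ofReal ?_
        rw [hδ, mul_div_assoc', div_le_iff₀ (by positivity)]
        nlinarith

end Limits

/-! ### Convergence in probability as convergence along a filter -/

section ProbFilter

variable {Ω : Type*} [MeasurableSpace Ω]

/-- The filter of the events, depending on the sample size `n`, whose probability tends to one.
Convergence along it is convergence in probability. -/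
def probFilter (μ : Measure Ω) : Filter (ℕ × Ω) where
  sets := {S | Tendsto (fun n => μ {w | (n, w) ∉ S}) atTop (𝓝 0)}
  univ_sets := by simp
  sets_of_superset {S T} hS hST := by
    refine tendsto_of_tendsto_of_tendsto_of_le_of_le tendsto_const_nhds hS
      (fun _ => bot_le) fun n => measure_mono fun w hw => ?_
    exact fun h => hw (hST h)
  inter_sets {S T} hS hT := by
    have h := Tendsto.add hS hT
    rw [add_zero] at h
    refine tendsto_of_tendsto_of_tendsto_of_le_of_le tendsto_const_nhds h
      (fun _ => bot_le) fun n => ?_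
    refine (measure_mono fun w hw => ?_).trans (measure_union_le _ _)
    by_contra hcon
    simp only [Set.mem_union, Set.mem_ofPred_eq, not_or, not_not] at hcon
    exact hw hcon

variable {μ : Measure Ω}

lemma mem_probFilter {S : Set (ℕ × Ω)} :
    S ∈ probFilter μ ↔ Tendsto (fun n => μ {w | (n, w) ∉ S}) atTop (𝓝 0) := Iff.rfl

lemma tendsto_fst_probFilter : Tendsto Prod.fst (probFilter μ) atTop := by
  intro S hS
  rw [mem_map, mem_probFilter]
  refine tendsto_const_nhds.congr' ?_
  filter_upwards [hS] with n hn
  simp [hn]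

lemma tendsto_probFilter_of_ae [IsFiniteMeasure μ] {u : ℕ → Ω → ℝ} {x : ℝ}
    (hm : ∀ n, AEStronglyMeasurable (u n) μ)
    (h : ∀ᵐ w ∂μ, Tendsto (fun n => u n w) atTop (𝓝 x)) :
    Tendsto (fun a : ℕ × Ω => u a.1 a.2) (probFilter μ) (𝓝 x) := by
  rw [Metric.tendsto_nhds]
  intro η hη
  refine mem_probFilter.2 ?_
  refine (tendstoInMeasure_iff_dist.1 (tendstoInMeasure_of_tendsto_ae hm h) η hη).congr fun n => ?_
  simp

end ProbFilter

/-! ### Sample second moments of the estimating function -/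

section SampleGram

variable {X V E : Type*}

/-- The average of an estimating function over a sample of size `n`. -/
noncomputable def sampleMean (f : X → V → E → ℝ) (n : ℕ) (o : ℕ → X) (θ : V) : E → ℝ :=
  (1 / (n : ℝ)) • ∑ i ∈ Finset.range n, f (o i) θ

/-- The matrix of the uncentered second moments of an estimating function over a sample of
size `n`. -/
noncomputable def sampleGram (f : X → V → E → ℝ) (n : ℕ) (o : ℕ → X) (θ : V) : Matrix E E ℝ :=
  (1 / (n : ℝ)) • ∑ i ∈ Finset.range n, Matrix.vecMulVec (f (o i) θ) (f (o i) θ)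

/-- The sample mean square of the increment of one coordinate of an estimating function. -/
noncomputable def meanSqIncrement (f : X → V → E → ℝ) (n : ℕ) (o : ℕ → X) (θ₀ θ : V) (j : E) : ℝ :=
  (1 / (n : ℝ)) * ∑ i ∈ Finset.range n, (f (o i) θ j - f (o i) θ₀ j) ^ 2

variable {f : X → V → E → ℝ} {n : ℕ} {o : ℕ → X} {θ θ₀ : V}

lemma sampleGram_apply (j k : E) :
    sampleGram f n o θ j k = (1 / (n : ℝ)) * ∑ i ∈ Finset.range n, f (o i) θ j * f (o i) θ k := by
  simp [sampleGram, Matrix.sum_apply, Matrix.vecMulVec_apply]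

lemma posSemidef_sampleGram [Fintype E] : (sampleGram f n o θ).PosSemidef := by
  refine Matrix.PosSemidef.smul (Matrix.posSemidef_sum _ fun i _ => ?_) (by positivity)
  simpa using Matrix.posSemidef_vecMulVec_self_star (f (o i) θ)

lemma dotProduct_sampleGram_mulVec_le [Fintype E] (x : E → ℝ) :
    x ⬝ᵥ sampleGram f n o θ *ᵥ x ≤ (∑ j, sampleGram f n o θ j j) * (x ⬝ᵥ x) := by
  have h1 : x ⬝ᵥ sampleGram f n o θ *ᵥ x =
      (1 / (n : ℝ)) * ∑ i ∈ Finset.range n, (∑ j, f (o i) θ j * x j) ^ 2 := by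
    rw [sampleGram, Matrix.smul_mulVec, dotProduct_smul, Matrix.sum_mulVec, dotProduct_sum,
      smul_eq_mul]
    congr 1
    refine Finset.sum_congr rfl fun i _ => ?_
    rw [Matrix.vecMulVec_mulVec, sq]
    simp [dotProduct, Finset.mul_sum, mul_comm, mul_left_comm]
  have h2 : (∑ j, sampleGram f n o θ j j) * (x ⬝ᵥ x) =
      (1 / (n : ℝ)) * ∑ i ∈ Finset.range n, (∑ j, f (o i) θ j ^ 2) * ∑ j, x j ^ 2 := by
    simp only [sampleGram_apply]
    rw [← Finset.mul_sum, Finset.sum_comm, ← Finset.sum_mul, mul_assoc]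
    simp only [dotProduct, sq]
  rw [h1, h2]
  gcongr with i _
  exact Finset.sum_mul_sq_le_sq_mul_sq _ _ _

lemma abs_average_mul_le (n : ℕ) (a b : ℕ → ℝ) :
    |(1 / (n : ℝ)) * ∑ i ∈ Finset.range n, a i * b i| ≤
      √((1 / (n : ℝ)) * ∑ i ∈ Finset.range n, a i ^ 2) *
        √((1 / (n : ℝ)) * ∑ i ∈ Finset.range n, b i ^ 2) := by
  have hn : (0 : ℝ) ≤ 1 / n := by positivity
  have h1 := Real.sum_mul_le_sqrt_mul_sqrt (Finset.range n) (fun i => |a i|) (fun i => |b i|)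
  simp only [sq_abs, ← abs_mul] at h1
  rw [Real.sqrt_mul hn, Real.sqrt_mul hn, abs_mul, abs_of_nonneg hn]
  calc 1 / (n : ℝ) * |∑ i ∈ Finset.range n, a i * b i|
      ≤ 1 / (n : ℝ) * (√(∑ i ∈ Finset.range n, a i ^ 2) * √(∑ i ∈ Finset.range n, b i ^ 2)) := by
        gcongr
        exact (Finset.abs_sum_le_sum_abs _ _).trans h1
    _ = (√(1 / (n : ℝ)) * √(1 / (n : ℝ))) *
        (√(∑ i ∈ Finset.range n, a i ^ 2) * √(∑ i ∈ Finset.range n, b i ^ 2)) := by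
        rw [Real.mul_self_sqrt hn]
    _ = _ := by ring

lemma abs_sampleGram_sub_le (j k : E) :
    |sampleGram f n o θ j k - sampleGram f n o θ₀ j k| ≤
      √(sampleGram f n o θ₀ j j) * √(meanSqIncrement f n o θ₀ θ k) +
      √(meanSqIncrement f n o θ₀ θ j) * √(sampleGram f n o θ₀ k k) +
      √(meanSqIncrement f n o θ₀ θ j) * √(meanSqIncrement f n o θ₀ θ k) := by
  have h1 := abs_average_mul_le n (fun i => f (o i) θ₀ j) (fun i => f (o i) θ k - f (o i) θ₀ k)
  have h2 := abs_average_mul_le n (fun i => f (o i) θ j - f (o i) θ₀ j) (fun i => f (o i) θ₀ k)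
  have h3 := abs_average_mul_le n (fun i => f (o i) θ j - f (o i) θ₀ j)
    (fun i => f (o i) θ k - f (o i) θ₀ k)
  have hsplit : sampleGram f n o θ j k - sampleGram f n o θ₀ j k =
      (1 / (n : ℝ)) * ∑ i ∈ Finset.range n, f (o i) θ₀ j * (f (o i) θ k - f (o i) θ₀ k) +
      (1 / (n : ℝ)) * ∑ i ∈ Finset.range n, (f (o i) θ j - f (o i) θ₀ j) * f (o i) θ₀ k +
      (1 / (n : ℝ)) * ∑ i ∈ Finset.range n,
        (f (o i) θ j - f (o i) θ₀ j) * (f (o i) θ k - f (o i) θ₀ k) := by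
    rw [sampleGram_apply, sampleGram_apply, ← mul_sub, ← mul_add, ← mul_add,
      ← Finset.sum_sub_distrib, ← Finset.sum_add_distrib, ← Finset.sum_add_distrib]
    congr 1
    refine Finset.sum_congr rfl fun i _ => ?_
    ring
  rw [hsplit]
  simp only [sampleGram_apply, meanSqIncrement, ← sq]
  exact (abs_add_le _ _).trans (add_le_add ((abs_add_le _ _).trans (add_le_add h1 h2)) h3)

lemma sampleGram_self_le (j : E) :
    sampleGram f n o θ j j ≤
      2 * sampleGram f n o θ₀ j j + 2 * meanSqIncrement f n o θ₀ θ j := by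
  rw [sampleGram_apply, sampleGram_apply, meanSqIncrement, mul_left_comm 2, mul_left_comm 2,
    ← mul_add]
  refine mul_le_mul_of_nonneg_left ?_ (by positivity)
  rw [Finset.mul_sum, Finset.mul_sum, ← Finset.sum_add_distrib]
  refine Finset.sum_le_sum fun i _ => ?_
  nlinarith [sq_nonneg (f (o i) θ j - 2 * f (o i) θ₀ j)]

end SampleGram

/-! ### Asymptotics of the minimizer -/

section Asymptotic

variable {Ω X κ J ι : Type*} [MeasurableSpace Ω] {μ : Measure Ω} [MeasurableSpace X] {P : Measure X}
  [Fintype κ] [Fintype J] [Fintype ι]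

/-- The sample on which the estimating function at `θ₀` has a small sum and the fluctuations have
small sums and small sums of squares, with constant `M`. -/
structure IsRegularSample {E V : Type*} [Fintype E] [NormedAddCommGroup V] (P : Measure X)
    (f : X → V → E → ℝ) (Θ : Set V) (θ₀ : V) (M : ℝ) (n : ℕ) (o : ℕ → X) : Prop where
  sum_le : ‖∑ i ∈ Finset.range n, f (o i) θ₀‖ ≤ M * √n
  fluct_le : ∀ θ ∈ Θ, ‖∑ i ∈ Finset.range n, fluct P f θ₀ (o i) θ‖ ≤ M * (1 + √n * ‖θ - θ₀‖)
  fluct_sq_le : ∀ θ ∈ Θ, ∀ j,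
    ∑ i ∈ Finset.range n, fluct P f θ₀ (o i) θ j ^ 2 ≤ M * (1 + √n * ‖θ - θ₀‖) ^ 2

lemma IsRegularSample.meanSqIncrement_le {E V : Type*} [Fintype E] [NormedAddCommGroup V]
    {f : X → V → E → ℝ} {Θ : Set V} {θ₀ : V} {M : ℝ} {n : ℕ} {o : ℕ → X}
    (h : IsRegularSample P f Θ θ₀ M n o) (hn : 0 < n) {θ : V} (hθ : θ ∈ Θ) (j : E) :
    meanSqIncrement f n o θ₀ θ j ≤
      2 * M * ((√n)⁻¹ + ‖θ - θ₀‖) ^ 2 + 2 * meanScore P f θ j ^ 2 := by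
  have hn' : (0 : ℝ) < n := by exact_mod_cast hn
  have hs : 0 < √(n : ℝ) := Real.sqrt_pos.2 hn'
  have h1 : ∀ i ∈ Finset.range n, (f (o i) θ j - f (o i) θ₀ j) ^ 2 ≤
      2 * fluct P f θ₀ (o i) θ j ^ 2 + 2 * meanScore P f θ j ^ 2 := fun i _ => by
    have : f (o i) θ j - f (o i) θ₀ j = fluct P f θ₀ (o i) θ j + meanScore P f θ j := by
      simp [fluct]
    rw [this]
    nlinarith [sq_nonneg (fluct P f θ₀ (o i) θ j - meanScore P f θ j)]
  have h2 := Finset.sum_le_sum h1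
  rw [Finset.sum_add_distrib, ← Finset.mul_sum, Finset.sum_const, Finset.card_range,
    nsmul_eq_mul] at h2
  have h3 := h.fluct_sq_le θ hθ j
  have h4 : (1 + √n * ‖θ - θ₀‖) ^ 2 = n * ((√n)⁻¹ + ‖θ - θ₀‖) ^ 2 := by
    have : 1 + √n * ‖θ - θ₀‖ = √n * ((√n)⁻¹ + ‖θ - θ₀‖) := by
      rw [mul_add, mul_inv_cancel₀ hs.ne']
    rw [this, mul_pow, Real.sq_sqrt hn'.le]
  rw [h4] at h3
  rw [meanSqIncrement, one_div, inv_mul_le_iff₀ hn']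
  linarith

variable {O : ℕ → Ω → X} {Θ : Set (EuclideanSpace ℝ ι)} {θ₀ : EuclideanSpace ℝ ι}

namespace UniformSample

lemma exists_isRegularSample [IsProbabilityMeasure μ] [IsProbabilityMeasure P] {E : Type*}
    [Fintype E] {f : X → EuclideanSpace ℝ ι → E → ℝ} (h : UniformSample μ P O Θ θ₀ f)
    (h2 : ∀ j, MemLp (fun o => f o θ₀ j) 2 P) (h0 : meanScore P f θ₀ = 0) {ε : ℝ} (hε : 0 < ε) :
    ∃ M : ℝ, 0 ≤ M ∧ ∀ᶠ n : ℕ in atTop,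
      μ {w | ¬ IsRegularSample P f Θ θ₀ M n fun i => O i w} ≤ ENNReal.ofReal ε := by
  have hε3 : 0 < ε / 3 := by positivity
  obtain ⟨M₁, hM₁, h1⟩ := exists_norm_sum_bound h.meas h.indep h.law (u := fun o => f o θ₀) h2
    (fun j => congrFun h0 j) hε3
  obtain ⟨M₂, hM₂, h2⟩ := h.uniform _ hε3
  obtain ⟨M₃, hM₃, h3⟩ := h.exists_sum_fluct_sq_bound hε3
  refine ⟨M₁ + M₂ + M₃, by positivity, ?_⟩
  filter_upwards [h2, h3] with n hn2 hn3
  have hsum : ENNReal.ofReal ε =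
      ENNReal.ofReal (ε / 3) + (ENNReal.ofReal (ε / 3) + ENNReal.ofReal (ε / 3)) := by
    rw [← ENNReal.ofReal_add hε3.le hε3.le, ← ENNReal.ofReal_add hε3.le (by positivity)]
    congr 1; ring
  rw [hsum]
  refine le_trans (measure_mono ?_) ((measure_union_le _ _).trans
    (add_le_add (h1 n) ((measure_union_le _ _).trans (add_le_add hn2 hn3))))
  intro w hw
  by_contra hcon
  simp only [Set.mem_union, Set.mem_ofPred_eq, not_or, not_exists, not_and, not_lt] at hcon
  refine hw ⟨hcon.1.trans ?_, fun θ hθ => (hcon.2.1 θ hθ).trans ?_,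
    fun θ hθ j => (hcon.2.2 θ hθ j).trans ?_⟩
  · gcongr; linarith
  · gcongr; linarith
  · gcongr; linarith

variable {f : X → EuclideanSpace ℝ ι → κ × J → ℝ}

lemma tendsto_sampleGram [IsProbabilityMeasure μ] (h : UniformSample μ P O Θ θ₀ f)
    (h2 : ∀ j, MemLp (fun o => f o θ₀ j) 2 P) (j k : κ × J) :
    Tendsto (fun a : ℕ × Ω => sampleGram f a.1 (fun i => O i a.2) θ₀ j k) (probFilter μ)
      (𝓝 (∫ o, f o θ₀ j * f o θ₀ k ∂P)) := by
  have hint : Integrable (fun o => f o θ₀ j * f o θ₀ k) P := (h2 j).integrable_mul (h2 k)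
  refine tendsto_probFilter_of_ae (u := fun n w => sampleGram f n (fun i => O i w) θ₀ j k)
    (fun n => ?_) ?_
  · simp only [sampleGram_apply]
    refine AEMeasurable.aestronglyMeasurable ?_
    refine (Finset.aemeasurable_fun_sum (Finset.range n) fun i _ => ?_).const_mul _
    exact aemeasurable_comp_sample h.meas h.law hint.aestronglyMeasurable.aemeasurable i
  · filter_upwards [ae_tendsto_average h.meas h.indep h.law hint] with w hw
    refine hw.congr fun n => ?_
    rw [sampleGram_apply, one_div, inv_mul_eq_div]

variable [DecidableEq κ] [DecidableEq J] [DecidableEq ι]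

/-- Along the regular samples, the weighted estimating functions form a minimum distance problem. -/
lemma exists_minDistance [IsProbabilityMeasure μ] [IsProbabilityMeasure P]
    (h : UniformSample μ P O Θ θ₀ f) (h2 : ∀ j, MemLp (fun o => f o θ₀ j) 2 P)
    (hzero : ∀ θ ∈ Θ, meanScore P f θ = 0 ↔ θ = θ₀) {c : Matrix (κ × J) (κ × J) ℝ}
    (hc : c.PosDef) (hcov : ∀ j k, ∫ o, f o θ₀ j * f o θ₀ k ∂P = c j k)
    {D : X → Matrix (κ × J) ι ℝ} (hDint : ∀ j b, Integrable (fun o => D o j b) P)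
    (hD : ∀ᵐ o ∂P, (fun θ => f o θ - f o θ₀ - D o *ᵥ (θ - θ₀).ofLp) =o[𝓝 θ₀] fun θ => θ - θ₀)
    (hG : IsUnit (gramMat (Matrix.of fun j b => ∫ o, D o j b ∂P) c).det) {M : ℝ} (hM : 0 ≤ M) :
    ∃ T, MinDistance (probFilter μ ⊓
        𝓟 {a : ℕ × Ω | IsRegularSample P f Θ θ₀ M a.1 fun i => O i a.2})
      (fun a => √(a.1 : ℝ)) Θ θ₀ (meanScore P f) (Matrix.of fun j b => ∫ o, D o j b ∂P) c
      (fun a θ => sampleMean f a.1 (fun i => O i a.2) θ)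
      (fun a θ => sampleGram f a.1 (fun i => O i a.2) θ) M T := by
  set l := probFilter μ ⊓ 𝓟 {a : ℕ × Ω | IsRegularSample P f Θ θ₀ M a.1 fun i => O i a.2} with hl
  have hΘ : Θ ∈ 𝓝 θ₀ := mem_interior_iff_mem_nhds.1 h.interior
  have hθ₀ : θ₀ ∈ Θ := mem_of_mem_nhds hΘ
  have h0 : meanScore P f θ₀ = 0 := (hzero θ₀ hθ₀).2 rfl
  have hreg : ∀ᶠ a in l, IsRegularSample P f Θ θ₀ M a.1 fun i => O i a.2 :=
    mem_inf_of_right (mem_principal_self _)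
  have hfst : Tendsto (fun a : ℕ × Ω => a.1) l atTop := tendsto_fst_probFilter.mono_left inf_le_left
  have hpos : ∀ᶠ a in l, 0 < a.1 := hfst.eventually_gt_atTop 0
  have hrate : Tendsto (fun a : ℕ × Ω => √(a.1 : ℝ)) l atTop :=
    Real.tendsto_sqrt_atTop.comp (tendsto_natCast_atTop_atTop.comp hfst)
  have hinv : Tendsto (fun a : ℕ × Ω => (√(a.1 : ℝ))⁻¹) l (𝓝 0) :=
    tendsto_inv_atTop_zero.comp hrate
  have hgram : ∀ j k, Tendsto (fun a : ℕ × Ω => sampleGram f a.1 (fun i => O i a.2) θ₀ j k) l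
      (𝓝 (c j k)) := fun j k => by
    rw [← hcov]; exact (h.tendsto_sampleGram h2 j k).mono_left inf_le_left
  obtain ⟨R, hR⟩ := h.compact.isBounded.subset_closedBall θ₀
  have hR' : ∀ θ ∈ Θ, ‖θ - θ₀‖ ≤ R := fun θ hθ => by simpa [dist_eq_norm] using hR hθ
  obtain ⟨S, hS⟩ := h.compact.exists_bound_of_continuousOn h.continuousOn_meanScore
  have hS' : ∀ θ ∈ Θ, ∀ j, meanScore P f θ j ^ 2 ≤ S ^ 2 := fun θ hθ j => by
    have h1 := (norm_le_pi_norm (meanScore P f θ) j).trans (hS θ hθ)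
    rw [← sq_abs, ← Real.norm_eq_abs]
    gcongr
  set T₀ : ℝ := ∑ j : κ × J, (2 * (c j j + 1) + 2 * (2 * M * (1 + R) ^ 2 + 2 * S ^ 2)) with hT₀
  refine ⟨|T₀| + 1, ⟨hrate, h.compact, h.interior, h.continuousOn_meanScore, h0,
    fun θ hθ => (hzero θ hθ).1, h.isLittleO_meanScore h0 hDint hD, hc, hG, ?_, ?_,
    fun a θ => posSemidef_sampleGram, ?_, by positivity, ?_⟩⟩
  · filter_upwards [hreg, hpos] with a ha hn
    have hn' : (0 : ℝ) < a.1 := by exact_mod_cast hn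
    rw [sampleMean, norm_smul, norm_smul, Real.norm_of_nonneg (Real.sqrt_nonneg _),
      Real.norm_of_nonneg (by positivity)]
    calc √(a.1 : ℝ) * (1 / (a.1 : ℝ) * ‖∑ i ∈ Finset.range a.1, f (O i a.2) θ₀‖)
        ≤ √(a.1 : ℝ) * (1 / (a.1 : ℝ) * (M * √(a.1 : ℝ))) := by gcongr; exact ha.sum_le
      _ = M * ((√(a.1 : ℝ) * √(a.1 : ℝ)) / a.1) := by ring
      _ = M := by rw [Real.mul_self_sqrt hn'.le, div_self hn'.ne', mul_one]
  · filter_upwards [hreg, hpos] with a ha hn θ hθ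
    have hn' : (0 : ℝ) < a.1 := by exact_mod_cast hn
    have hs : 0 < √(a.1 : ℝ) := Real.sqrt_pos.2 hn'
    have h1 : sampleMean f a.1 (fun i => O i a.2) θ - sampleMean f a.1 (fun i => O i a.2) θ₀ -
        meanScore P f θ =
        (1 / (a.1 : ℝ)) • ∑ i ∈ Finset.range a.1, fluct P f θ₀ (O i a.2) θ := by
      simp only [fluct, sampleMean]
      rw [Finset.sum_sub_distrib _ (fun _ => meanScore P f θ), Finset.sum_sub_distrib, smul_sub,
        smul_sub, Finset.sum_const, Finset.card_range, ← Nat.cast_smul_eq_nsmul ℝ, smul_smul,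
        one_div, inv_mul_cancel₀ hn'.ne', one_smul]
    rw [h1, norm_smul, norm_smul, Real.norm_of_nonneg (Real.sqrt_nonneg _),
      Real.norm_of_nonneg (by positivity)]
    calc √(a.1 : ℝ) * (1 / (a.1 : ℝ) * ‖∑ i ∈ Finset.range a.1, fluct P f θ₀ (O i a.2) θ‖)
        ≤ √(a.1 : ℝ) * (1 / (a.1 : ℝ) * (M * (1 + √(a.1 : ℝ) * ‖θ - θ₀‖))) := by
          gcongr; exact ha.fluct_le θ hθ
      _ = M * (√(a.1 : ℝ) / a.1 + (√(a.1 : ℝ) * √(a.1 : ℝ)) / a.1 * ‖θ - θ₀‖) := by ring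
      _ = M * (1 / √(a.1 : ℝ) + ‖θ - θ₀‖) := by
          rw [Real.mul_self_sqrt hn'.le, div_self hn'.ne', one_mul, Real.sqrt_div_self, one_div]
  · have hle : ∀ᶠ a in l, ∀ j, sampleGram f a.1 (fun i => O i a.2) θ₀ j j ≤ c j j + 1 :=
      eventually_all.2 fun j => ((hgram j j).eventually_lt_const (lt_add_one _)).mono
        fun a ha => ha.le
    filter_upwards [hreg, hpos, hle, hinv.eventually_lt_const zero_lt_one] with a ha hn hle hi θ hθ x
    refine (dotProduct_sampleGram_mulVec_le x).trans ?_
    have hx : 0 ≤ x ⬝ᵥ x := Finset.sum_nonneg fun i _ => mul_self_nonneg _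
    refine mul_le_mul_of_nonneg_right ?_ hx
    refine le_trans ?_ ((le_abs_self T₀).trans (le_add_of_nonneg_right zero_le_one))
    refine Finset.sum_le_sum fun j _ => (sampleGram_self_le (θ₀ := θ₀) j).trans ?_
    have h1 := ha.meanSqIncrement_le hn hθ j
    have h3 : 0 ≤ (√(a.1 : ℝ))⁻¹ + ‖θ - θ₀‖ := by positivity
    have h4 : 2 * M * ((√(a.1 : ℝ))⁻¹ + ‖θ - θ₀‖) ^ 2 ≤ 2 * M * (1 + R) ^ 2 := by
      have := hR' θ hθ
      gcongr
    have h5 := hS' θ hθ j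
    have h6 := hle j
    linarith
  · intro τ hτ hlim
    have hd : Tendsto (fun a => ‖τ a - θ₀‖) l (𝓝 0) := by
      simpa using (hlim.sub_const θ₀).norm
    have he : ∀ j, Tendsto (fun a => meanScore P f (τ a) j) l (𝓝 0) := fun j => by
      have h1 := ((h.continuousOn_meanScore.continuousAt hΘ).tendsto.comp hlim)
      rw [h0] at h1
      exact tendsto_pi_nhds.1 h1 j
    have hinc : ∀ j, Tendsto (fun a : ℕ × Ω =>
        √(meanSqIncrement f a.1 (fun i => O i a.2) θ₀ (τ a) j)) l (𝓝 0) := fun j => by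
      have h1 : Tendsto (fun a : ℕ × Ω => 2 * M * ((√(a.1 : ℝ))⁻¹ + ‖τ a - θ₀‖) ^ 2 +
          2 * meanScore P f (τ a) j ^ 2) l (𝓝 0) := by
        simpa using (((hinv.add hd).pow 2).const_mul (2 * M)).add (((he j).pow 2).const_mul 2)
      have h2 : Tendsto (fun a : ℕ × Ω =>
          meanSqIncrement f a.1 (fun i => O i a.2) θ₀ (τ a) j) l (𝓝 0) := by
        refine tendsto_of_tendsto_of_tendsto_of_le_of_le' tendsto_const_nhds h1
          (.of_forall fun a => ?_) ?_
        · exact mul_nonneg (by positivity) (Finset.sum_nonneg fun i _ => sq_nonneg _)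
        · filter_upwards [hreg, hpos, hτ] with a ha hn hτa using ha.meanSqIncrement_le hn hτa j
      simpa using h2.sqrt
    refine tendsto_pi_nhds.2 fun j => tendsto_pi_nhds.2 fun k => ?_
    -- the moments at `τ` and at `θ₀` differ by terms bounded by the mean squares of the increments
    have hsub : Tendsto (fun a : ℕ × Ω => sampleGram f a.1 (fun i => O i a.2) (τ a) j k -
        sampleGram f a.1 (fun i => O i a.2) θ₀ j k) l (𝓝 0) := by
      refine squeeze_zero_norm (fun a => abs_sampleGram_sub_le j k) ?_
      simpa using (((hgram j j).sqrt.mul (hinc k)).add ((hinc j).mul (hgram k k).sqrt)).add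
        ((hinc j).mul (hinc k))
    simpa using hsub.add (hgram j k)

/-- **Asymptotic linearity.** A minimizer of the weighted criterion is asymptotically a linear
function of the sum of the estimating functions at `θ₀`. -/
theorem tendstoInMeasure_argmin [IsProbabilityMeasure μ] [IsProbabilityMeasure P]
    (h : UniformSample μ P O Θ θ₀ f) (h2 : ∀ j, MemLp (fun o => f o θ₀ j) 2 P)
    (hzero : ∀ θ ∈ Θ, meanScore P f θ = 0 ↔ θ = θ₀) {c : Matrix (κ × J) (κ × J) ℝ}
    (hc : c.PosDef) (hcov : ∀ j k, ∫ o, f o θ₀ j * f o θ₀ k ∂P = c j k)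
    {D : X → Matrix (κ × J) ι ℝ} (hDint : ∀ j b, Integrable (fun o => D o j b) P)
    (hD : ∀ᵐ o ∂P, (fun θ => f o θ - f o θ₀ - D o *ᵥ (θ - θ₀).ofLp) =o[𝓝 θ₀] fun θ => θ - θ₀)
    (hG : IsUnit (gramMat (Matrix.of fun j b => ∫ o, D o j b ∂P) c).det)
    {τ : ℕ → Ω → EuclideanSpace ℝ ι}
    (hτ : ∀ᶠ a in probFilter μ, τ a.1 a.2 ∈ Θ ∧
      IsUnit (sampleGram f a.1 (fun i => O i a.2) (τ a.1 a.2)).det ∧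
      ∀ θ ∈ Θ, IsUnit (sampleGram f a.1 (fun i => O i a.2) θ).det →
        gmmCriterion (√(a.1 : ℝ)) (sampleGram f a.1 (fun i => O i a.2) (τ a.1 a.2))
          (sampleMean f a.1 (fun i => O i a.2) (τ a.1 a.2)) ≤
        gmmCriterion (√(a.1 : ℝ)) (sampleGram f a.1 (fun i => O i a.2) θ)
          (sampleMean f a.1 (fun i => O i a.2) θ)) :
    Tendsto (fun a : ℕ × Ω => (√(a.1 : ℝ) • (τ a.1 a.2 - θ₀)).ofLp -
      influenceMat (Matrix.of fun j b => ∫ o, D o j b ∂P) c *ᵥ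
        (√(a.1 : ℝ) • sampleMean f a.1 (fun i => O i a.2) θ₀)) (probFilter μ) (𝓝 0) := by
  rw [Metric.tendsto_nhds]
  intro η hη
  set S : Set (ℕ × Ω) := {a | dist ((√(a.1 : ℝ) • (τ a.1 a.2 - θ₀)).ofLp -
      influenceMat (Matrix.of fun j b => ∫ o, D o j b ∂P) c *ᵥ
        (√(a.1 : ℝ) • sampleMean f a.1 (fun i => O i a.2) θ₀)) 0 < η} with hSdef
  change S ∈ probFilter μ
  rw [mem_probFilter, ENNReal.tendsto_nhds_zero]
  intro ε hε
  -- outside an event of probability `ε / 2` the sample is regular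
  obtain ⟨δ, hδ, hδε⟩ : ∃ δ : ℝ, 0 < δ ∧ ENNReal.ofReal δ ≤ ε / 2 := by
    rcases eq_or_ne ε ⊤ with rfl | hε'
    · exact ⟨1, one_pos, by simp [ENNReal.top_div_of_ne_top]⟩
    · refine ⟨(ε / 2).toReal, ENNReal.toReal_pos (by simpa using hε.ne') ?_, ?_⟩
      · exact (ENNReal.div_lt_top hε' (by norm_num)).ne
      · exact ENNReal.ofReal_toReal_le
  obtain ⟨M, hM, hMn⟩ := h.exists_isRegularSample h2
    ((hzero θ₀ (interior_subset h.interior)).2 rfl) hδ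
  obtain ⟨T, hT⟩ := h.exists_minDistance h2 hzero hc hcov hDint hD hG hM
  have hlim := hT.tendsto_argmin (τ := fun a => τ a.1 a.2)
    ((hτ.filter_mono inf_le_left).mono fun a ha => ha.1)
    ((hτ.filter_mono inf_le_left).mono fun a ha => ha.2.1)
    ((hτ.filter_mono inf_le_left).mono fun a ha => ha.2.2)
  have hmem := Metric.tendsto_nhds.1 hlim η hη
  rw [eventually_inf_principal] at hmem
  have hmem' := ENNReal.tendsto_nhds_zero.1 (mem_probFilter.1 hmem) (ε / 2)
    (ENNReal.half_pos hε.ne')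
  filter_upwards [hmem', hMn] with n h1 h2
  calc μ {w | (n, w) ∉ S} ≤ _ := measure_mono fun w hw => ?_
    _ ≤ _ := measure_union_le _ _
    _ ≤ ε / 2 + ε / 2 := add_le_add h1 (h2.trans hδε)
    _ = ε := ENNReal.add_halves ε
  by_contra hcon
  simp only [Set.mem_union, Set.mem_ofPred_eq, not_or, not_not] at hcon
  exact hw (hcon.1 hcon.2)

end UniformSample

end Asymptotic

/-! ### Stacked matrices -/

section Stack

variable {K q₁ q₂ q₃ : ℕ}

/-- The matrices `S k` stacked on top of each other. -/
def stack (S : Fin K → Matrix (ParamIdx q₁ q₂ q₃) (ParamIdx q₁ q₂ q₃) ℝ) :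
    Matrix (Fin K × ParamIdx q₁ q₂ q₃) (ParamIdx q₁ q₂ q₃) ℝ :=
  Matrix.of fun e b => S e.1 e.2 b

variable (A : Matrix (Fin K × ParamIdx q₁ q₂ q₃) (Fin K × ParamIdx q₁ q₂ q₃) ℝ)
  (S T : Fin K → Matrix (ParamIdx q₁ q₂ q₃) (ParamIdx q₁ q₂ q₃) ℝ)

lemma stack_transpose_mul_stack : (stack S)ᵀ * stack T = ∑ k, (S k)ᵀ * T k := by
  ext a b
  simp only [Matrix.mul_apply, Matrix.transpose_apply, stack, Matrix.of_apply, Matrix.sum_apply,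
    Fintype.sum_prod_type]

lemma mul_stack : A * stack S = stack fun k => ∑ k', blk A k k' * S k' := by
  ext e b
  simp only [Matrix.mul_apply, stack, Matrix.of_apply, Matrix.sum_apply, Fintype.sum_prod_type,
    blk, Matrix.submatrix_apply]

lemma blk_diagBlocks (k k' : Fin K) :
    blk (diagBlocks A) k k' = if k = k' then blk A k k' else 0 := by
  ext a b
  by_cases h : k = k' <;> simp [blk, diagBlocks, h]

lemma diagBlocks_mul_stack : diagBlocks A * stack S = stack fun k => blk A k k * S k := by
  rw [mul_stack]
  congr 1
  ext1 k
  rw [Finset.sum_eq_single k]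
  · simp [blk_diagBlocks]
  · intro k' _ hk
    simp [blk_diagBlocks, hk.symm]
  · simp

lemma gramMat_stack :
    gramMat (stack S) A = ∑ k, (S k)ᵀ * blk A⁻¹ k k * S k := by
  rw [gramMat, Matrix.mul_assoc, diagBlocks_mul_stack, stack_transpose_mul_stack]
  simp only [Matrix.mul_assoc]

lemma sandwich_stack :
    (stack S)ᵀ * diagBlocks A⁻¹ * A * diagBlocks A⁻¹ * stack S =
      ∑ k, ∑ k', (S k)ᵀ * blk A⁻¹ k k * blk A k k' * blk A⁻¹ k' k' * S k' := by
  rw [Matrix.mul_assoc, Matrix.mul_assoc, Matrix.mul_assoc, diagBlocks_mul_stack, mul_stack,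
    diagBlocks_mul_stack, stack_transpose_mul_stack]
  simp only [Matrix.mul_sum, Matrix.mul_assoc]

lemma dotProduct_diagBlocks_mulVec_eq_sum (x : Fin K × ParamIdx q₁ q₂ q₃ → ℝ) :
    x ⬝ᵥ diagBlocks A *ᵥ x =
      ∑ k, (fun a => x (k, a)) ⬝ᵥ (blk A k k *ᵥ fun a => x (k, a)) := by
  simp only [dotProduct, Matrix.mulVec, Fintype.sum_prod_type, diagBlocks, Matrix.of_apply, blk,
    Matrix.submatrix_apply]
  refine Finset.sum_congr rfl fun k _ => Finset.sum_congr rfl fun a _ => ?_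
  rw [Finset.sum_eq_single k]
  · simp
  · intro k' _ hk
    simp [hk.symm]
  · simp

/-- The covariance matrix of the limit of the linearized minimizer. -/
lemma influenceMat_mul_mul_transpose (hA : A.PosDef) :
    influenceMat (stack S) A * A * (influenceMat (stack S) A)ᵀ =
      (gramMat (stack S) A)⁻¹ * ((stack S)ᵀ * diagBlocks A⁻¹ * A * diagBlocks A⁻¹ * stack S) *
        ((gramMat (stack S) A)ᵀ)⁻¹ := by
  have hW : (diagBlocks A⁻¹)ᵀ = diagBlocks A⁻¹ := by
    simpa using (posDef_diagBlocks_inv hA).isHermitian.eq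
  rw [influenceMat, Matrix.transpose_neg, Matrix.transpose_mul, Matrix.transpose_mul, hW,
    Matrix.transpose_transpose, Matrix.transpose_nonsing_inv]
  simp only [Matrix.neg_mul, Matrix.mul_neg, neg_neg, Matrix.mul_assoc]

end Stack

/-! ### The censored composite scores -/

section Scores

variable {d K q₁ q₂ q₃ : ℕ} {D : Design d K} {Θ : Set (Param q₁ q₂ q₃)}
  {P : Param q₁ q₂ q₃ → Measure (Obs d q₁ q₂ q₃)} {θ₀ : Param q₁ q₂ q₃}

lemma sampleScore_apply (n : ℕ) (o : ℕ → Obs d q₁ q₂ q₃) (k : Fin K) (θ : Param q₁ q₂ q₃)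
    (a : ParamIdx q₁ q₂ q₃) : sampleScore D n o k θ a = sampleMean (scoreAll D) n o θ (k, a) := by
  simp [sampleScore, sampleMean, scoreAll]

lemma gmmObjective_eq_gmmCriterion (n : ℕ) (o : ℕ → Obs d q₁ q₂ q₃) (θ : Param q₁ q₂ q₃) :
    gmmObjective D n o θ =
      gmmCriterion (√(n : ℝ)) (sampleGram (scoreAll D) n o θ) (sampleMean (scoreAll D) n o θ) := by
  have hn : (n : ℝ) = √(n : ℝ) * √(n : ℝ) := (Real.mul_self_sqrt n.cast_nonneg).symm
  have h : ∀ k, (sampleScore D n o k θ).ofLp = fun a => sampleMean (scoreAll D) n o θ (k, a) :=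
    fun k => funext fun a => sampleScore_apply n o k θ a
  rw [gmmCriterion, Matrix.mulVec_smul, smul_dotProduct, dotProduct_smul, smul_smul, ← hn,
    dotProduct_diagBlocks_mulVec_eq_sum, smul_eq_mul, gmmObjective]
  simp only [h]
  rfl

lemma meanScore_scoreAll {Q : Measure (Obs d q₁ q₂ q₃)} {θ : Param q₁ q₂ q₃}
    (h : ∀ k, Integrable (fun o => score D k o θ) Q) (k : Fin K) (a : ParamIdx q₁ q₂ q₃) :
    meanScore Q (scoreAll D) θ (k, a) = (∫ o, score D k o θ ∂Q) a :=
  (eval_integral_piLp (fun i => (h k).eval_piLp i) a).symm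

lemma meanScore_scoreAll_eq_zero_iff (hC1 : ScoreRegularity D Θ P θ₀) {θ : Param q₁ q₂ q₃}
    (hθ : θ ∈ Θ) : meanScore (P θ₀) (scoreAll D) θ = 0 ↔ θ = θ₀ := by
  rw [← hC1.unique_zero θ hθ]
  constructor
  · intro h k
    ext a
    rw [← meanScore_scoreAll (hC1.integrable θ hθ), h]
    rfl
  · intro h
    ext ⟨k, a⟩
    rw [meanScore_scoreAll (hC1.integrable θ hθ), h k]
    rfl

/-- The uniform expansion of the sample scores, for the sums of the stacked fluctuations. -/
lemma exists_norm_sum_fluct_bound {Ω : Type*} [MeasurableSpace Ω] {μ : Measure Ω}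
    {O : ℕ → Ω → Obs d q₁ q₂ q₃} (hΘ : IsCompact Θ) (hC1 : ScoreRegularity D Θ P θ₀)
    (hC2 : UniformExpansion μ O D Θ P θ₀) {ε : ℝ} (hε : 0 < ε) :
    ∃ M : ℝ, 0 ≤ M ∧ ∀ᶠ n : ℕ in atTop,
      μ {w | ∃ θ ∈ Θ, M * (1 + √n * ‖θ - θ₀‖) <
        ‖∑ i ∈ Finset.range n, fluct (P θ₀) (scoreAll D) θ₀ (O i w) θ‖} ≤ ENNReal.ofReal ε := by
  set δ := ε / (K + 1) with hδ
  have hδ0 : 0 < δ := by positivity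
  have hk := fun k => hC2 (fun n => n) tendsto_natCast_atTop_atTop k δ hδ0
  choose M hM using hk
  obtain ⟨R, hR⟩ := hΘ.isBounded.subset_closedBall θ₀
  refine ⟨∑ k, |M k|, Finset.sum_nonneg fun k _ => abs_nonneg _, ?_⟩
  filter_upwards [eventually_all.2 hM, eventually_gt_atTop 0,
    tendsto_natCast_atTop_atTop.eventually_ge_atTop R] with n hn hn0 hnR
  have hn' : (0 : ℝ) < n := by exact_mod_cast hn0
  have hs : 0 < √(n : ℝ) := Real.sqrt_pos.2 hn'
  calc _ ≤ μ (⋃ k, {w | ENNReal.ofReal (M k * (1 / √(n : ℝ))) <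
        ⨆ θ ∈ {θ ∈ Θ | ‖θ - θ₀‖ ≤ n}, ENNReal.ofReal (√(n : ℝ) / (1 + √(n : ℝ) * ‖θ - θ₀‖) *
          ‖sampleScore D n (fun i => O i w) k θ - sampleScore D n (fun i => O i w) k θ₀ -
            ∫ o, score D k o θ ∂P θ₀‖)}) := measure_mono fun w hw => ?_
    _ ≤ ∑ k, μ _ := measure_iUnion_fintype_le _ _
    _ ≤ ∑ _k : Fin K, ENNReal.ofReal δ := Finset.sum_le_sum fun k _ => hn k
    _ = ENNReal.ofReal (K * δ) := by
        rw [Finset.sum_const, ← ENNReal.ofReal_nsmul]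
        simp
    _ ≤ ENNReal.ofReal ε := by
        refine ENNReal.ofReal_le_ofReal ?_
        rw [hδ, mul_div_assoc', div_le_iff₀ (by positivity)]
        nlinarith
  by_contra hcon
  simp only [Set.mem_iUnion, Set.mem_ofPred_eq, not_exists, not_lt] at hcon
  obtain ⟨θ, hθ, hlt⟩ := hw
  have hd : ‖θ - θ₀‖ ≤ n := by
    have : ‖θ - θ₀‖ ≤ R := by simpa [dist_eq_norm] using hR hθ
    exact this.trans hnR
  have h0 : 0 ≤ √(n : ℝ) * ‖θ - θ₀‖ := by positivity
  have hθ₀ : θ₀ ∈ Θ := interior_subset hC1.interior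
  refine absurd hlt (not_lt.2 ((pi_norm_le_iff_of_nonneg ?_).2 ?_))
  · exact mul_nonneg (Finset.sum_nonneg fun k _ => abs_nonneg _) (by linarith)
  rintro ⟨k, a⟩
  set r := sampleScore D n (fun i => O i w) k θ - sampleScore D n (fun i => O i w) k θ₀ -
            ∫ o, score D k o θ ∂P θ₀ with hr
  have h1 : (∑ i ∈ Finset.range n, fluct (P θ₀) (scoreAll D) θ₀ (O i w) θ) (k, a) = n * r a := by
    have e1 := sampleScore_apply (D := D) n (fun i => O i w) k θ a
    have e2 := sampleScore_apply (D := D) n (fun i => O i w) k θ₀ a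
    have e3 := meanScore_scoreAll (hC1.integrable θ hθ) k a
    rw [hr, PiLp.sub_apply, PiLp.sub_apply, e1, e2, ← e3]
    simp only [sampleMean, fluct, Finset.sum_apply, Pi.smul_apply, Pi.sub_apply,
      Finset.sum_sub_distrib, Finset.sum_const, Finset.card_range, nsmul_eq_mul, smul_eq_mul]
    field_simp
  have h2 : ENNReal.ofReal (√(n : ℝ) / (1 + √(n : ℝ) * ‖θ - θ₀‖) * ‖r‖) ≤
      ENNReal.ofReal (M k * (1 / √(n : ℝ))) :=
    le_trans (le_iSup₂ (f := fun θ (_ : θ ∈ {θ ∈ Θ | ‖θ - θ₀‖ ≤ n}) =>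
      ENNReal.ofReal (√(n : ℝ) / (1 + √(n : ℝ) * ‖θ - θ₀‖) *
          ‖sampleScore D n (fun i => O i w) k θ - sampleScore D n (fun i => O i w) k θ₀ -
            ∫ o, score D k o θ ∂P θ₀‖)) θ ⟨hθ, hd⟩) (hcon k)
  have h3 : √(n : ℝ) / (1 + √(n : ℝ) * ‖θ - θ₀‖) * ‖r‖ ≤ |M k| * (1 / √(n : ℝ)) := by
    refine (ENNReal.ofReal_le_ofReal_iff (by positivity)).1 (h2.trans ?_)
    refine ENNReal.ofReal_le_ofReal ?_
    gcongr
    exact le_abs_self _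
  have h4 : n * ‖r‖ ≤ |M k| * (1 + √(n : ℝ) * ‖θ - θ₀‖) := by
    have hpos : 0 < 1 + √(n : ℝ) * ‖θ - θ₀‖ := by linarith
    rw [div_mul_eq_mul_div, div_le_iff₀ hpos, mul_one_div, div_mul_eq_mul_div, le_div_iff₀ hs] at h3
    calc n * ‖r‖ = √(n : ℝ) * ‖r‖ * √(n : ℝ) := by
          rw [mul_right_comm, Real.mul_self_sqrt hn'.le]
      _ ≤ _ := h3
  rw [h1, norm_mul, Real.norm_natCast]
  calc (n : ℝ) * ‖r a‖ ≤ n * ‖r‖ := by gcongr; exact PiLp.norm_apply_le r a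
    _ ≤ |M k| * (1 + √(n : ℝ) * ‖θ - θ₀‖) := h4
    _ ≤ _ := by
      gcongr
      exact Finset.single_le_sum (fun k _ => abs_nonneg (M k)) (Finset.mem_univ k)

lemma uniformSample_scoreAll {Ω : Type*} [MeasurableSpace Ω] {μ : Measure Ω}
    {O : ℕ → Ω → Obs d q₁ q₂ q₃} (hΘ : IsCompact Θ) (hm : ∀ i, Measurable (O i))
    (hind : iIndepFun O μ) (hlaw : ∀ i, μ.map (O i) = P θ₀) (hC1 : ScoreRegularity D Θ P θ₀)
    (hC2 : UniformExpansion μ O D Θ P θ₀) :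
    UniformSample μ (P θ₀) O Θ θ₀ (scoreAll D) where
  meas := hm
  indep := hind
  law := hlaw
  compact := hΘ
  interior := hC1.interior
  cont := by
    filter_upwards [Measure.support_mem_ae (μ := P θ₀)] with o ho
    refine continuousOn_pi.2 fun e => ?_
    exact (PiLp.continuous_apply 2 _ e.2).comp_continuousOn (hC1.contDiff o ho e.1).continuousOn
  integrable θ hθ e := (hC1.integrable θ hθ e.1).eval_piLp e.2
  uniform _ hε := exists_norm_sum_fluct_bound hΘ hC1 hC2 hε

/-- The derivative in the parameter of the stacked score of one replicate. -/
noncomputable def scoreAllDeriv (D : Design d K) (o : Obs d q₁ q₂ q₃) (θ : Param q₁ q₂ q₃) :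
    Matrix (Fin K × ParamIdx q₁ q₂ q₃) (ParamIdx q₁ q₂ q₃) ℝ :=
  Matrix.of fun e b => scoreDeriv D e.1 o θ e.2 b

lemma isLittleO_scoreAll (hC1 : ScoreRegularity D Θ P θ₀) :
    ∀ᵐ o ∂P θ₀, (fun θ => scoreAll D o θ - scoreAll D o θ₀ -
      scoreAllDeriv D o θ₀ *ᵥ (θ - θ₀).ofLp) =o[𝓝 θ₀] fun θ => θ - θ₀ := by
  filter_upwards [Measure.support_mem_ae (μ := P θ₀)] with o ho
  refine Asymptotics.isLittleO_pi.2 fun e => ?_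
  have hdiff : DifferentiableAt ℝ (fun τ => score D e.1 o τ) θ₀ :=
    ((hC1.contDiff o ho e.1).contDiffAt
      (mem_interior_iff_mem_nhds.1 hC1.interior)).differentiableAt (by norm_num)
  have h1 := hdiff.hasFDerivAt.isLittleO
  refine (Asymptotics.IsBigO.of_bound 1 (.of_forall fun θ => ?_)).trans_isLittleO h1
  set L := fderiv ℝ (fun τ => score D e.1 o τ) θ₀ with hL
  have h2 : (scoreAllDeriv D o θ₀ *ᵥ (θ - θ₀).ofLp) e = (L (θ - θ₀)) e.2 := by
    have h3 : θ - θ₀ = ∑ b, (θ - θ₀) b • EuclideanSpace.single b (1 : ℝ) := by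
      conv_lhs => rw [← (EuclideanSpace.basisFun (ParamIdx q₁ q₂ q₃) ℝ).sum_repr (θ - θ₀)]
      simp
    conv_rhs => rw [h3, map_sum]
    simp [Matrix.mulVec, dotProduct, scoreAllDeriv, scoreDeriv, hL, mul_comm]
  have h4 := PiLp.norm_apply_le (score D e.1 o θ - score D e.1 o θ₀ - L (θ - θ₀)) e.2
  rw [one_mul]
  refine le_trans (le_of_eq ?_) h4
  rw [Pi.sub_apply, Pi.sub_apply, h2]
  rfl

end Scores

end CensoredBR

open CensoredBR in
theorem theorem2 {d K q₁ q₂ q₃ : ℕ} (D : CensoredBR.Design d K)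
    (Θ : Set (CensoredBR.Param q₁ q₂ q₃)) (hΘ : IsCompact Θ)
    (ν : Measure (CensoredBR.Covariates d q₁ q₂ q₃))
    (κ : CensoredBR.Param q₁ q₂ q₃ →
      Kernel (CensoredBR.Covariates d q₁ q₂ q₃) (Fin d → ℝ))
    (hmodel : CensoredBR.IsModel D Θ ν κ)
    (θ₀ : CensoredBR.Param q₁ q₂ q₃)
    {Ω : Type*} [MeasurableSpace Ω] (μ : Measure Ω) [IsProbabilityMeasure μ]
    (O : ℕ → Ω → CensoredBR.Obs d q₁ q₂ q₃)
    (hO_meas : ∀ i, Measurable (O i))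
    (hO_indep : iIndepFun O μ)
    (hO_law : ∀ i, μ.map (O i) = CensoredBR.obsLaw ν κ θ₀)
    (hC1 : CensoredBR.ScoreRegularity D Θ (CensoredBR.obsLaw ν κ) θ₀)
    (hC2 : CensoredBR.UniformExpansion μ O D Θ (CensoredBR.obsLaw ν κ) θ₀)
    (hh : IsUnit (CensoredBR.hMat D (CensoredBR.obsLaw ν κ) θ₀).det)
    (θhat : ℕ → Ω → CensoredBR.Param q₁ q₂ q₃)
    (hθhat_meas : ∀ n, AEMeasurable (θhat n) μ)
    (hθhat : Tendsto (fun n => μ {w | ¬ CensoredBR.IsGMM D Θ n (fun i => O i w) (θhat n w)})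
      atTop (𝓝 0)) :
    (CensoredBR.gMat D (CensoredBR.obsLaw ν κ) θ₀).PosSemidef ∧
    TendstoInDistribution (fun (n : ℕ) w => Real.sqrt n • (θhat n w - θ₀)) atTop id
      (fun _ => μ)
      (multivariateGaussian 0
        ((CensoredBR.hMat D (CensoredBR.obsLaw ν κ) θ₀)⁻¹ *
          CensoredBR.gMat D (CensoredBR.obsLaw ν κ) θ₀ *
          ((CensoredBR.hMat D (CensoredBR.obsLaw ν κ) θ₀)ᵀ)⁻¹)) := by
  set P := obsLaw ν κ with hP
  have hprob : IsProbabilityMeasure (P θ₀) := by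
    rw [← hO_law 0]; exact Measure.isProbabilityMeasure_map (hO_meas 0).aemeasurable
  have hθ₀ : θ₀ ∈ Θ := interior_subset hC1.interior
  set c := variab D P θ₀ with hc
  have hcpos : c.PosDef := hC1.posDef θ₀ hθ₀
  set G := stack fun k => sens D P k θ₀ with hG
  have hhG : hMat D P θ₀ = gramMat G c := (gramMat_stack c _).symm
  have hgG : gMat D P θ₀ = Gᵀ * diagBlocks c⁻¹ * c * diagBlocks c⁻¹ * G :=
    (sandwich_stack c _).symm
  have hW : (diagBlocks c⁻¹)ᵀ = diagBlocks c⁻¹ := by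
    simpa using (posDef_diagBlocks_inv hcpos).isHermitian.eq
  refine ⟨?_, ?_⟩
  · have h1 := hcpos.posSemidef.conjTranspose_mul_mul_same (diagBlocks c⁻¹ * G)
    rw [Matrix.conjTranspose_eq_transpose_of_trivial, Matrix.transpose_mul, hW] at h1
    rw [hgG]
    simpa only [Matrix.mul_assoc] using h1
  -- the linearized estimator
  have hU := uniformSample_scoreAll hΘ hO_meas hO_indep hO_law hC1 hC2
  have hmem : ∀ e, MemLp (fun o => scoreAll D o θ₀ e) 2 (P θ₀) := fun e =>
    (hC1.finite_var θ₀ hθ₀ e.1).eval_piLp e.2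
  have hzero : ∀ θ ∈ Θ, meanScore (P θ₀) (scoreAll D) θ = 0 ↔ θ = θ₀ := fun θ hθ =>
    meanScore_scoreAll_eq_zero_iff hC1 hθ
  have hmean : ∀ e, ∫ o, scoreAll D o θ₀ e ∂P θ₀ = 0 := fun e =>
    congrFun ((hzero θ₀ hθ₀).2 rfl) e
  have hcov : ∀ e e', ∫ o, scoreAll D o θ₀ e * scoreAll D o θ₀ e' ∂P θ₀ = c e e' := fun e e' => by
    simp [hc, variab, covariance, hmean]
  have hDint : ∀ e b, Integrable (fun o => scoreAllDeriv D o θ₀ e b) (P θ₀) := fun e b =>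
    hC1.sens_integrable.self_of_nhds e.1 e.2 b
  have hGeq : (Matrix.of fun e b => ∫ o, scoreAllDeriv D o θ₀ e b ∂P θ₀) = G := rfl
  have hlin := hU.tendstoInMeasure_argmin hmem hzero hcpos hcov hDint (isLittleO_scoreAll hC1)
    (by rw [hGeq, ← hhG]; exact hh) (τ := θhat) (by
      refine mem_probFilter.2 (tendsto_of_tendsto_of_tendsto_of_le_of_le tendsto_const_nhds hθhat
        (fun _ => bot_le) fun n => measure_mono fun w hw hgmm => hw ⟨hgmm.2.1, hgmm.2.2, ?_⟩)
      intro θ hθ hu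
      have : gmmObjective D n (fun i => O i w) (θhat n w) ≤ gmmObjective D n (fun i => O i w) θ :=
        hgmm.1 (⟨hθ, hu⟩ : θ ∈ {τ ∈ Θ | IsUnit (sampleCov D n (fun i => O i w) τ).det})
      simpa only [gmmObjective_eq_gmmCriterion] using this)
  rw [hGeq] at hlin
  set L := influenceMat G c with hL
  -- its limit distribution
  have hcov' : (hMat D P θ₀)⁻¹ * gMat D P θ₀ * ((hMat D P θ₀)ᵀ)⁻¹ = L * c * Lᵀ := by
    rw [hhG, hgG, hL, hG, influenceMat_mul_mul_transpose _ _ hcpos]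
  rw [hcov']
  have hpsd : (L * c * Lᵀ).PosSemidef := by
    simpa using hcpos.posSemidef.mul_mul_conjTranspose_same L
  set Y : Obs d q₁ q₂ q₃ → Param q₁ q₂ q₃ := fun o => WithLp.toLp 2 (L *ᵥ scoreAll D o θ₀) with hY
  have hYmem : MemLp Y 2 (P θ₀) := by
    refine MemLp.of_eval_piLp fun a => ?_
    exact memLp_finsetSum _ fun e _ => (hmem e).const_mul (L a e)
  have hclt := tendstoInDistribution_inv_sqrt_smul_sum hO_meas hO_indep hO_law hYmem
    (fun a => by
      have : ∀ e ∈ Finset.univ, Integrable (fun o => L a e * scoreAll D o θ₀ e) (P θ₀) :=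
        fun e _ => ((hmem e).integrable (by norm_num)).const_mul _
      simp only [hY, Matrix.mulVec, dotProduct]
      rw [integral_finsetSum _ this]
      simp [integral_const_mul, hmean]) hpsd
    (fun a b => by
      have hint : ∀ e e', Integrable (fun o =>
          L a e * (scoreAll D o θ₀ e * scoreAll D o θ₀ e') * L b e') (P θ₀) := fun e e' =>
        (((hmem e).integrable_mul (hmem e')).const_mul _).mul_const _
      have h1 : ∀ o, Y o a * Y o b = ∑ e', ∑ e,
          L a e * (scoreAll D o θ₀ e * scoreAll D o θ₀ e') * L b e' := fun o => by
        simp only [hY, Matrix.mulVec, dotProduct]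
        rw [Finset.sum_mul_sum, Finset.sum_comm]
        refine Finset.sum_congr rfl fun e _ => Finset.sum_congr rfl fun e' _ => ?_
        ring
      simp only [h1]
      rw [integral_finsetSum _ fun e' _ => integrable_finsetSum _ fun e _ => hint e e']
      simp only [Matrix.mul_apply, Matrix.transpose_apply, Finset.sum_mul]
      refine Finset.sum_congr rfl fun e' _ => ?_
      rw [integral_finsetSum _ fun e _ => hint e e']
      refine Finset.sum_congr rfl fun e _ => ?_
      rw [integral_mul_const, integral_const_mul, hcov])
  refine tendstoInDistribution_of_tendstoInMeasure_sub _ id hclt ?_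
    fun n => (hθhat_meas n).sub_const θ₀ |>.const_smul (√(n : ℝ))
  -- both sides vanish for `n = 0`, as the inverse of zero is zero
  have hsum : ∀ (n : ℕ) (w : Ω), (√(n : ℝ))⁻¹ • ∑ i ∈ Finset.range n, Y (O i w) =
      WithLp.toLp 2 (L *ᵥ (√(n : ℝ) • sampleMean (scoreAll D) n (fun i => O i w) θ₀)) := by
    intro n w
    rw [sampleMean, smul_smul, mul_one_div, Real.sqrt_div_self, Matrix.mulVec_smul,
      Matrix.mulVec_sum, WithLp.toLp_smul, WithLp.toLp_sum]
  have hlin' := ((PiLp.continuous_toLp 2 fun _ : ParamIdx q₁ q₂ q₃ => ℝ).tendsto 0).comp hlin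
  rw [WithLp.toLp_zero] at hlin'
  rw [tendstoInMeasure_iff_norm]
  intro η hη
  have hη' := mem_probFilter.1 (Metric.tendsto_nhds.1 hlin' η hη)
  refine hη'.congr fun n => ?_
  congr 1
  ext w
  simp only [Set.mem_ofPred_eq, not_lt, Function.comp_apply, dist_zero_right, Pi.sub_apply,
    Pi.zero_apply, sub_zero, hsum, WithLp.toLp_sub, WithLp.toLp_ofLp]
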